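/- **Setting.** A dynamic flow path network has vertices $v_1,\dots,v_n$ ($n\ge 2$) from left to right, edges $e_i=(v_i,v_{i+1})$ of lengths $d(e_i)>0$, a common edge capacity $c>0$ (persons per unit time), a transit time $\tau>0$ per unit distance, and real weight bounds $0<\underline w(v_i)\le\overline w(v_i)$. A scenario $s$ assigns to every vertex a weight $w^s(v_i)\in[\underline w(v_i),\overline w(v_i)]$. For a point $x$ of the path (a vertex or a point on an edge), the evacuees of the vertices to the right of $x$ travel left to $x$ and those to the left of $x$ travel right to $x$; the evacuees at $x$ cost nothing. For the vertices $v_k,\dots,v_n$ to the right of $x$ (with $v_{k-1}\preceq x\prec v_k$), the $R$-clusters with respect to $e_{k-1}$ are obtained by reading $v_k,v_{k+1},\dots$ in order: $v_k$ is the front vertex of the first cluster, and $v_i$ starts a new cluster if $d(v_h,v_i)\,\tau>\frac1c\sum_{j=h}^{i-1}w^s(v_j)$, where $v_h$ is the front vertex of the current cluster, and otherwise joins that cluster. If $\lambda(C)$ is the total weight of a cluster $C$ and $v_C$ its front vertex, the cost of these evacuees is $\sum_C \big(d(x,v_C)\lambda(C)\tau+\lambda(C)^2/(2c)\big)$. $L$-clusters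 with respect to $e_k$, and the cost of the evacuees to the left of $x$, are defined symmetrically. $\Phi^s(x)$ is the sum of the two costs, and an aggregate-time sink $\mu^s$ under $s$ is a point of the path that minimizes $\Phi^s$ over all points of the path. An $L$-pseudo-bipartite (resp. $R$-pseudo-bipartite) scenario has a boundary vertex $v_b$ of arbitrary weight in $[\underline w(v_b),\overline w(v_b)]$, weights $\overline w$ (resp. $\underline w$) at all vertices to the left of $v_b$ and weights $\underline w$ (resp. $\overline w$) at all vertices to the right of $v_b$. It is critical if its weight $w>\underline w(v_b)$ at $v_b$ is critical, that is, if two distinct clusters ($R$-clusters with respect to some edge, or $L$-clusters with respect to some edge) merge exactly when the weight of $v_b$, increasing from $\underline w(v_b)$, reaches $w$. Let $\mathcal S^*$ be the set of all critical $L$- and $R$-pseudo-bipartite scenarios. **Lemma.** $|\mathcal S^*|=O(n^2)$, and the sinks $\{\mu^s\mid s\in\mathcal S^*\}$ can be computed in $O(n^2\log n)$ total time: there are a single real-RAM program (unit-cost arithmetic and comparisons of reals, no rounding of reals to integers, and integer words of $O(\log n)$ bits) and absolute constants such that, for every $n\ge2$ and every network with $n$ vertices, given $n$, $c$, $\tau$,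 the edge lengths and the weight bounds, the program halts after $O(n^2\log n)$ steps with a list that contains every $s\in\mathcal S^*$ and no other scenario, each specified by its type ($L$ or $R$), its boundary vertex and the weight of that vertex, together with the index of a vertex that is an aggregate-time sink under $s$. -/

import Mathlib

/-! ### Dynamic flow path networks, clusters and the aggregate evacuation time -/

/-- A dynamic flow path network with vertices `v_1, …, v_n` and edges `e_i = (v_i, v_{i+1})`,
`1 ≤ i ≤ n - 1`: edge lengths `len i`, lower and upper limits `lo i ≤ hi i` on the weight of `v_i`,
the common edge capacity `cap` (persons per unit time) and the transit time `tau` per unit distance.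
Entries outside the index ranges are `0` by convention. -/
structure PathNetwork (n : ℕ) where
  len : ℕ → ℝ
  lo : ℕ → ℝ
  hi : ℕ → ℝ
  cap : ℝ
  tau : ℝ
  cap_pos : 0 < cap
  tau_pos : 0 < tau
  len_pos : ∀ i, 1 ≤ i → i + 1 ≤ n → 0 < len i
  len_off : ∀ i, ¬ (1 ≤ i ∧ i + 1 ≤ n) → len i = 0
  lo_pos : ∀ i, 1 ≤ i → i ≤ n → 0 < lo i
  lo_le_hi : ∀ i, 1 ≤ i → i ≤ n → lo i ≤ hi i
  lo_off : ∀ i, ¬ (1 ≤ i ∧ i ≤ n) → lo i = 0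
  hi_off : ∀ i, ¬ (1 ≤ i ∧ i ≤ n) → hi i = 0

/-- Consider vertices numbered `0, 1, 2, …` in the order in which one meets them when walking away
from the destination; `p j` is the coordinate of vertex `j` (increasing along the walk) and `ω j`
its weight.  `clusterFront cap tau p ω j` is the front vertex of the cluster that contains `j`.
Vertex `j + 1` starts a new cluster exactly if its first evacuee reaches the front vertex `h` of the
current cluster strictly after all evacuees of `h, …, j`, which leave `h` at the rate `cap`, have
left `h`; otherwise the flow is uninterrupted and `j + 1` belongs to the current cluster. -/
noncomputable def clusterFront (cap tau : ℝ) (p ω : ℕ → ℝ) : ℕ → ℕ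
  | 0 => 0
  | j + 1 =>
    let h := clusterFront cap tau p ω j
    if (∑ i ∈ Finset.Icc h j, ω i) / cap < (p (j + 1) - p h) * tau then j + 1 else h

/-- The total weight of the cluster with front vertex `f`, among the first `m` vertices. -/
noncomputable def clusterWeight (cap tau : ℝ) (p ω : ℕ → ℝ) (m f : ℕ) : ℝ :=
  ∑ i ∈ (Finset.range m).filter (fun i => clusterFront cap tau p ω i = f), ω i

/-- The cost of moving the evacuees of the first `m` vertices to the point with coordinate `y`: the
sum, over the clusters, of the extra cost (distance from the front vertex to the destination, times
the cluster weight, times `tau`) and of the intra cost (cluster weight squared, over `2 * cap`). -/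
noncomputable def clusterCost (cap tau : ℝ) (p ω : ℕ → ℝ) (m : ℕ) (y : ℝ) : ℝ :=
  ∑ f ∈ (Finset.range m).filter (fun f => clusterFront cap tau p ω f = f),
    ((p f - y) * clusterWeight cap tau p ω m f * tau
      + clusterWeight cap tau p ω m f ^ 2 / (2 * cap))

namespace PathNetwork

variable {n : ℕ}

/-- The coordinate of `v_i` (its distance from `v_1`).  Points of the path are identified with their
coordinates, i.e. with the elements of `[0, pos n]`. -/
noncomputable def pos (N : PathNetwork n) (i : ℕ) : ℝ := ∑ j ∈ Finset.Ico 1 i, N.len j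

/-- The points of the path. -/
noncomputable def points (N : PathNetwork n) : Set ℝ := Set.Icc 0 (N.pos n)

/-- The `R`-clusters with respect to `e_{k-1}` under the weights `s`: the front vertex of the cluster
of `v_{k+j}` is `v_{k + frontR s k j}`. -/
noncomputable def frontR (N : PathNetwork n) (s : ℕ → ℝ) (k : ℕ) : ℕ → ℕ :=
  clusterFront N.cap N.tau (fun j => N.pos (k + j)) (fun j => s (k + j))

/-- The `L`-clusters with respect to `e_k` under the weights `s`: the front vertex of the cluster
of `v_{k-j}` (`j < k`) is `v_{k - frontL s k j}`. -/
noncomputable def frontL (N : PathNetwork n) (s : ℕ → ℝ) (k : ℕ) : ℕ → ℕ :=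
  clusterFront N.cap N.tau (fun j => - N.pos (k - j)) (fun j => s (k - j))

/-- The cost at `x` of the evacuees of `v_k, …, v_n`, who arrive at `x` from the right. -/
noncomputable def costR (N : PathNetwork n) (s : ℕ → ℝ) (k : ℕ) (x : ℝ) : ℝ :=
  clusterCost N.cap N.tau (fun j => N.pos (k + j)) (fun j => s (k + j)) (n + 1 - k) x

/-- The cost at `x` of the evacuees of `v_1, …, v_k`, who arrive at `x` from the left. -/
noncomputable def costL (N : PathNetwork n) (s : ℕ → ℝ) (k : ℕ) (x : ℝ) : ℝ :=
  clusterCost N.cap N.tau (fun j => - N.pos (k - j)) (fun j => s (k - j)) k (-x)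

/-- The number of vertices strictly to the left of the point `x`. -/
noncomputable def numLeft (N : PathNetwork n) (x : ℝ) : ℕ :=
  ((Finset.Icc 1 n).filter (fun i => N.pos i < x)).card

/-- The number of vertices to the left of the point `x`, or at `x`. -/
noncomputable def numLeftOrAt (N : PathNetwork n) (x : ℝ) : ℕ :=
  ((Finset.Icc 1 n).filter (fun i => N.pos i ≤ x)).card

/-- The aggregate evacuation time to the point `x` under the weights `s`. -/
noncomputable def Phi (N : PathNetwork n) (s : ℕ → ℝ) (x : ℝ) : ℝ :=
  N.costL s (N.numLeft x) x + N.costR s (N.numLeftOrAt x + 1) x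

/-- `x` is an aggregate time sink (minsum sink) under `s`: it minimizes `Phi` over all points of
the path. -/
def IsSink (N : PathNetwork n) (s : ℕ → ℝ) (x : ℝ) : Prop :=
  x ∈ N.points ∧ ∀ y ∈ N.points, N.Phi s x ≤ N.Phi s y

/-! ### Pseudo-bipartite scenarios and critical weights -/

/-- The `L`-pseudo-bipartite scenario with boundary vertex `v_b` of weight `w`: maximum weights to
the left of `v_b`, minimum weights to the right. -/
noncomputable def scenL (N : PathNetwork n) (b : ℕ) (w : ℝ) : ℕ → ℝ :=
  fun i => if i < b then N.hi i else if i = b then w else N.lo i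

/-- The `R`-pseudo-bipartite scenario with boundary vertex `v_b` of weight `w`: minimum weights to
the left of `v_b`, maximum weights to the right. -/
noncomputable def scenR (N : PathNetwork n) (b : ℕ) (w : ℝ) : ℕ → ℝ :=
  fun i => if i < b then N.lo i else if i = b then w else N.hi i

/-- `w` is a critical weight of `v_b` for the one-parameter family `σ` of scenarios, `σ w'` being the
scenario in which `v_b` has weight `w'`: as the weight of `v_b` increases from `lo b` to `w`, two
clusters with respect to some edge, distinct for all smaller weights, merge at `w`. -/
def IsCritical (N : PathNetwork n) (σ : ℝ → ℕ → ℝ) (b : ℕ) (w : ℝ) : Prop :=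
  w ∈ Set.Ioc (N.lo b) (N.hi b) ∧
    ((∃ k i j : ℕ, 2 ≤ k ∧ k + i ≤ n ∧ k + j ≤ n ∧
        (∀ w' ∈ Set.Ico (N.lo b) w, N.frontR (σ w') k i ≠ N.frontR (σ w') k j) ∧
        N.frontR (σ w) k i = N.frontR (σ w) k j) ∨
     (∃ k i j : ℕ, k + 1 ≤ n ∧ i < k ∧ j < k ∧
        (∀ w' ∈ Set.Ico (N.lo b) w, N.frontL (σ w') k i ≠ N.frontL (σ w') k j) ∧
        N.frontL (σ w) k i = N.frontL (σ w) k j))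

/-- The `L`-pseudo-bipartite scenarios that correspond to critical weights. -/
def SstarL (N : PathNetwork n) : Set (ℕ → ℝ) :=
  {s | ∃ b w, 1 ≤ b ∧ b ≤ n ∧ N.IsCritical (N.scenL b) b w ∧ s = N.scenL b w}

/-- The `R`-pseudo-bipartite scenarios that correspond to critical weights. -/
def SstarR (N : PathNetwork n) : Set (ℕ → ℝ) :=
  {s | ∃ b w, 1 ≤ b ∧ b ≤ n ∧ N.IsCritical (N.scenR b) b w ∧ s = N.scenR b w}

/-- All critical pseudo-bipartite scenarios. -/
def Sstar (N : PathNetwork n) : Set (ℕ → ℝ) := N.SstarL ∪ N.SstarR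

end PathNetwork

/-! ### Real random access machine

Structured programs over a memory of natural-number and real-number variables and arrays, with
unit cost for every arithmetic operation, comparison, (indirect) memory access and assignment.
There is no conversion from reals to integers, the only literals are natural numbers, and the
natural numbers stored in memory are bounded by a word bound. -/

namespace RealRAM

/-- The memory: variables and arrays, all named by natural numbers. -/
structure State where
  nvar : ℕ → ℕ
  rvar : ℕ → ℝ
  narr : ℕ → ℕ → ℕ
  rarr : ℕ → ℕ → ℝ

/-- Natural-number expressions; `sub` is truncated and `div` is integer division. -/
inductive NExp where
  | lit (c : ℕ)
  | var (x : ℕ)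
  | get (a : ℕ) (i : NExp)
  | add (e f : NExp)
  | sub (e f : NExp)
  | mul (e f : NExp)
  | div (e f : NExp)

/-- Real expressions. -/
inductive RExp where
  | ofNat (e : NExp)
  | var (x : ℕ)
  | get (a : ℕ) (i : NExp)
  | add (e f : RExp)
  | sub (e f : RExp)
  | mul (e f : RExp)
  | div (e f : RExp)

/-- Tests. -/
inductive BExp where
  | ltN (e f : NExp)
  | ltR (e f : RExp)
  | not (b : BExp)
  | and (b c : BExp)

/-- Programs. -/
inductive Cmd where
  | nop
  | setN (x : ℕ) (e : NExp)
  | setR (x : ℕ) (e : RExp)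
  | storeN (a : ℕ) (i e : NExp)
  | storeR (a : ℕ) (i : NExp) (e : RExp)
  | seq (c d : Cmd)
  | branch (b : BExp) (c d : Cmd)
  | loop (b : BExp) (c : Cmd)

def NExp.eval (σ : State) : NExp → ℕ
  | .lit c => c
  | .var x => σ.nvar x
  | .get a i => σ.narr a (i.eval σ)
  | .add e f => e.eval σ + f.eval σ
  | .sub e f => e.eval σ - f.eval σ
  | .mul e f => e.eval σ * f.eval σ
  | .div e f => e.eval σ / f.eval σ

/-- The number of elementary operations in the evaluation of an expression. -/
def NExp.cost : NExp → ℕ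
  | .lit _ => 1
  | .var _ => 1
  | .get _ i => i.cost + 1
  | .add e f => e.cost + f.cost + 1
  | .sub e f => e.cost + f.cost + 1
  | .mul e f => e.cost + f.cost + 1
  | .div e f => e.cost + f.cost + 1

noncomputable def RExp.eval (σ : State) : RExp → ℝ
  | .ofNat e => (e.eval σ : ℝ)
  | .var x => σ.rvar x
  | .get a i => σ.rarr a (i.eval σ)
  | .add e f => e.eval σ + f.eval σ
  | .sub e f => e.eval σ - f.eval σ
  | .mul e f => e.eval σ * f.eval σ
  | .div e f => e.eval σ / f.eval σ

/-- The number of elementary operations in the evaluation of an expression. -/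
def RExp.cost : RExp → ℕ
  | .ofNat e => e.cost + 1
  | .var _ => 1
  | .get _ i => i.cost + 1
  | .add e f => e.cost + f.cost + 1
  | .sub e f => e.cost + f.cost + 1
  | .mul e f => e.cost + f.cost + 1
  | .div e f => e.cost + f.cost + 1

def BExp.eval (σ : State) : BExp → Prop
  | .ltN e f => e.eval σ < f.eval σ
  | .ltR e f => e.eval σ < f.eval σ
  | .not b => ¬ b.eval σ
  | .and b c => b.eval σ ∧ c.eval σ

/-- The number of elementary operations in the evaluation of a test. -/
def BExp.cost : BExp → ℕ
  | .ltN e f => e.cost + f.cost + 1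
  | .ltR e f => e.cost + f.cost + 1
  | .not b => b.cost + 1
  | .and b c => b.cost + c.cost + 1

/-- `Exec W c σ σ' t`: started in the memory `σ`, the program `c` halts in the memory `σ'` after
exactly `t` elementary steps, and every natural number it stores is at most `W`. -/
inductive Exec (W : ℕ) : Cmd → State → State → ℕ → Prop where
  | nop (σ : State) : Exec W .nop σ σ 1
  | setN (σ : State) (x : ℕ) (e : NExp) (h : e.eval σ ≤ W) :
      Exec W (.setN x e) σ { σ with nvar := Function.update σ.nvar x (e.eval σ) } (e.cost + 1)
  | setR (σ : State) (x : ℕ) (e : RExp) :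
      Exec W (.setR x e) σ { σ with rvar := Function.update σ.rvar x (e.eval σ) } (e.cost + 1)
  | storeN (σ : State) (a : ℕ) (i e : NExp) (h : e.eval σ ≤ W) :
      Exec W (.storeN a i e) σ
        { σ with narr :=
            Function.update σ.narr a (Function.update (σ.narr a) (i.eval σ) (e.eval σ)) }
        (i.cost + e.cost + 1)
  | storeR (σ : State) (a : ℕ) (i : NExp) (e : RExp) :
      Exec W (.storeR a i e) σ
        { σ with rarr :=
            Function.update σ.rarr a (Function.update (σ.rarr a) (i.eval σ) (e.eval σ)) }
        (i.cost + e.cost + 1)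
  | seq {c d : Cmd} {σ σ' σ'' : State} {t t' : ℕ} (h : Exec W c σ σ' t) (h' : Exec W d σ' σ'' t') :
      Exec W (.seq c d) σ σ'' (t + t')
  | branchTrue {b : BExp} {c d : Cmd} {σ σ' : State} {t : ℕ} (hb : b.eval σ)
      (h : Exec W c σ σ' t) : Exec W (.branch b c d) σ σ' (b.cost + t)
  | branchFalse {b : BExp} {c d : Cmd} {σ σ' : State} {t : ℕ} (hb : ¬ b.eval σ)
      (h : Exec W d σ σ' t) : Exec W (.branch b c d) σ σ' (b.cost + t)
  | loopDone {b : BExp} {c : Cmd} {σ : State} (hb : ¬ b.eval σ) :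
      Exec W (.loop b c) σ σ b.cost
  | loopStep {b : BExp} {c : Cmd} {σ σ' σ'' : State} {t t' : ℕ} (hb : b.eval σ)
      (h : Exec W c σ σ' t) (h' : Exec W (.loop b c) σ' σ'' t') :
      Exec W (.loop b c) σ σ'' (b.cost + t + t')

end RealRAM

namespace PathNetwork

variable {n : ℕ}

/-- The initial memory: `n` in natural variable `0`, the capacity and the transit time in the real
variables `0` and `1`, the edge lengths and the lower and upper limits of the vertex weights in the
real arrays `0`, `1` and `2`; everything else is `0`. -/
noncomputable def initState (N : PathNetwork n) : RealRAM.State where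
  nvar := fun x => if x = 0 then n else 0
  rvar := fun x => if x = 0 then N.cap else if x = 1 then N.tau else 0
  narr := fun _ _ => 0
  rarr := fun a => if a = 0 then N.len else if a = 1 then N.lo else if a = 2 then N.hi else fun _ => 0

/-- The scenario described by the `r`-th output record of a final memory: natural array `0` holds
the type (`0` for `L`, anything else for `R`), natural array `1` the index of the boundary vertex,
real array `0` the weight of the boundary vertex. -/
noncomputable def outScenario (N : PathNetwork n) (σ : RealRAM.State) (r : ℕ) : ℕ → ℝ :=
  if σ.narr 0 r = 0 then N.scenL (σ.narr 1 r) (σ.rarr 0 r)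
  else N.scenR (σ.narr 1 r) (σ.rarr 0 r)

/-- The final memory lists all critical pseudo-bipartite scenarios, and nothing else, each with a
sink: natural variable `0` holds the number of records, and natural array `2` the index of a vertex
that is an aggregate time sink under the scenario of the record. -/
def IsSinkTable (N : PathNetwork n) (σ : RealRAM.State) : Prop :=
  (∀ r < σ.nvar 0,
    (1 ≤ σ.narr 1 r ∧ σ.narr 1 r ≤ n) ∧ N.outScenario σ r ∈ N.Sstar ∧
    (1 ≤ σ.narr 2 r ∧ σ.narr 2 r ≤ n) ∧ N.IsSink (N.outScenario σ r) (N.pos (σ.narr 2 r))) ∧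
  (∀ s ∈ N.Sstar, ∃ r < σ.nvar 0, N.outScenario σ r = s)

end PathNetwork

/-!
The positions of the vertices are measured in units of flow, that is, multiplied by transit time and
capacity. For a walk along the path away from the destination, `off z w l` is the position of
vertex `l` minus the weight met before `l`. A vertex opens a new cluster iff `off` exceeds all its
previous values there, so that the fronts of the clusters are the strict running maxima of `off`,
and two vertices share a cluster iff the running maxima `mx` at the two vertices agree
(`clusterFront_spec`, `clusterFront_eq_iff_mx`). The cost of the evacuees behind a point is then the
sum over the vertices of weight times running maximum, plus a term that depends on the total weight
only (`cap_mul_clusterCost_eq_cost`). The evacuees to the left of a point are treated by reflection of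
the path: `mir` numbers the vertices from the side `sd`. The aggregate time is linear on edges and
does not increase in the limit at a vertex, so that a vertex which is best among the vertices is a
sink (`exists_vertex_Phi_le`, `isSink_of_forall_vertex`).

When the boundary vertex `b` gets heavier by `δ`, the values of `off` behind `b` drop by `δ` and the
others stay. A merger among the clusters behind `i` therefore happens exactly when the value at a
record `m` behind `b` drops to the maximum over `(i, b]`, that is, at `δ = off m - mx i b`
(`exists_merge_iff`, `isCritical_iff`). Such a pair `(i, m)` is an event. From one boundary vertex to
the next, in the right direction, the scenarios of a type only grow, and fronts that have vanished do
not come back; hence a pair `(i, m)` is an event at one boundary vertex at most, and there are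
`O(n²)` events in total (`not_isEvent_of_le`, `sum_card_evS_le`). This bounds the number of critical
scenarios.

The running time rests on three facts about a fixed type, boundary vertex and side. The aggregate time
at a vertex `i` before `b` is a quadratic polynomial in `δ` with tabulated coefficients plus the
`excess` of the running maxima behind `b` over `mx i b + δ` (`cost_mixw`); the excess is a difference
of partial sums over the records behind `b`, so that it takes constant time once the number of
records up to `mx i b + δ` is known (`eval_expPhi`). The best vertex moves towards `b` as `δ` grows
(`phiS_sub_le`, `isFirstMin_phiS_mono`). Hence, with the `q` events sorted, the best vertices are found
for all events in rounds: the stride of the events already treated is halved, and every vertex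
between two neighbouring known minima is examined once, which takes `O(n + q)` evaluations per round.
Within a round the pointer that counts the records moves down along a scan, as `mx i b` decreases in
`i`, and it moves up between two scans past at most as many records as there are events in between,
because each of these records belongs to an event (`EventList.count`). All in all a boundary vertex
takes `O((n + q) log n)` steps, and summation over the boundary vertices gives `O(n² log n)`.

Statements about the program have the form `Run W c σ Q`; every such statement comes with the frame
condition `Agree`, which protects the memory that `c` does not write to. Running times are bounded by
potentials in the rules for loops, `Run.loop` and `Run.forUp`.
-/

/-! ### Reasoning about programs of the random access machine -/

namespace RealRAM

/-- The memory after the assignment of `v` to the natural variable `x`. -/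
def State.setN (σ : State) (x v : ℕ) : State :=
  { σ with nvar := Function.update σ.nvar x v }

/-- The memory after the assignment of `v` to the real variable `x`. -/
def State.setR (σ : State) (x : ℕ) (v : ℝ) : State :=
  { σ with rvar := Function.update σ.rvar x v }

/-- The memory after the assignment of `v` to entry `i` of the natural array `a`. -/
def State.putN (σ : State) (a i v : ℕ) : State :=
  { σ with narr := Function.update σ.narr a (Function.update (σ.narr a) i v) }

/-- The memory after the assignment of `v` to entry `i` of the real array `a`. -/
def State.putR (σ : State) (a i : ℕ) (v : ℝ) : State :=
  { σ with rarr := Function.update σ.rarr a (Function.update (σ.rarr a) i v) }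

section Access
variable (σ : State) (x v a i y : ℕ) (r : ℝ)

theorem nvar_setN : (σ.setN x v).nvar y = if y = x then v else σ.nvar y := by
  simp [State.setN, Function.update_apply]
theorem rvar_setN : (σ.setN x v).rvar = σ.rvar := rfl
theorem narr_setN : (σ.setN x v).narr = σ.narr := rfl
theorem rarr_setN : (σ.setN x v).rarr = σ.rarr := rfl
theorem nvar_setR : (σ.setR x r).nvar = σ.nvar := rfl
theorem rvar_setR : (σ.setR x r).rvar y = if y = x then r else σ.rvar y := by
  simp [State.setR, Function.update_apply]
theorem narr_setR : (σ.setR x r).narr = σ.narr := rfl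
theorem rarr_setR : (σ.setR x r).rarr = σ.rarr := rfl
theorem nvar_putN : (σ.putN a i v).nvar = σ.nvar := rfl
theorem rvar_putN : (σ.putN a i v).rvar = σ.rvar := rfl
theorem narr_putN : (σ.putN a i v).narr y =
    if y = a then Function.update (σ.narr a) i v else σ.narr y := by
  simp [State.putN, Function.update_apply]
theorem rarr_putN : (σ.putN a i v).rarr = σ.rarr := rfl
theorem nvar_putR : (σ.putR a i r).nvar = σ.nvar := rfl
theorem rvar_putR : (σ.putR a i r).rvar = σ.rvar := rfl
theorem narr_putR : (σ.putR a i r).narr = σ.narr := rfl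
theorem rarr_putR : (σ.putR a i r).rarr y =
    if y = a then Function.update (σ.rarr a) i r else σ.rarr y := by
  simp [State.putR, Function.update_apply]

end Access

/-- The natural variables a program assigns. -/
def Cmd.modNVar : Cmd → List ℕ
  | .setN x _ => [x]
  | .seq c d => c.modNVar ++ d.modNVar
  | .branch _ c d => c.modNVar ++ d.modNVar
  | .loop _ c => c.modNVar
  | _ => []

/-- The real variables a program assigns. -/
def Cmd.modRVar : Cmd → List ℕ
  | .setR x _ => [x]
  | .seq c d => c.modRVar ++ d.modRVar
  | .branch _ c d => c.modRVar ++ d.modRVar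
  | .loop _ c => c.modRVar
  | _ => []

/-- The natural arrays a program writes to. -/
def Cmd.modNArr : Cmd → List ℕ
  | .storeN a _ _ => [a]
  | .seq c d => c.modNArr ++ d.modNArr
  | .branch _ c d => c.modNArr ++ d.modNArr
  | .loop _ c => c.modNArr
  | _ => []

/-- The real arrays a program writes to. -/
def Cmd.modRArr : Cmd → List ℕ
  | .storeR a _ _ => [a]
  | .seq c d => c.modRArr ++ d.modRArr
  | .branch _ c d => c.modRArr ++ d.modRArr
  | .loop _ c => c.modRArr
  | _ => []

/-- The memories `σ` and `σ'` agree outside the variables and arrays that `c` can change. -/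
structure Agree (c : Cmd) (σ σ' : State) : Prop where
  nvar : ∀ x, x ∉ c.modNVar → σ'.nvar x = σ.nvar x
  rvar : ∀ x, x ∉ c.modRVar → σ'.rvar x = σ.rvar x
  narr : ∀ x, x ∉ c.modNArr → σ'.narr x = σ.narr x
  rarr : ∀ x, x ∉ c.modRArr → σ'.rarr x = σ.rarr x

theorem Agree.refl (c : Cmd) (σ : State) : Agree c σ σ :=
  ⟨fun _ _ => rfl, fun _ _ => rfl, fun _ _ => rfl, fun _ _ => rfl⟩

theorem Agree.trans {c : Cmd} {σ σ' σ'' : State} (h : Agree c σ σ') (h' : Agree c σ' σ'') :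
    Agree c σ σ'' :=
  ⟨fun x hx => (h'.nvar x hx).trans (h.nvar x hx), fun x hx => (h'.rvar x hx).trans (h.rvar x hx),
    fun x hx => (h'.narr x hx).trans (h.narr x hx), fun x hx => (h'.rarr x hx).trans (h.rarr x hx)⟩

theorem Agree.of_subset {c d : Cmd} {σ σ' : State} (h : Agree c σ σ')
    (h1 : c.modNVar ⊆ d.modNVar) (h2 : c.modRVar ⊆ d.modRVar)
    (h3 : c.modNArr ⊆ d.modNArr) (h4 : c.modRArr ⊆ d.modRArr) : Agree d σ σ' :=
  ⟨fun x hx => h.nvar x fun hx' => hx (h1 hx'), fun x hx => h.rvar x fun hx' => hx (h2 hx'),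
    fun x hx => h.narr x fun hx' => hx (h3 hx'), fun x hx => h.rarr x fun hx' => hx (h4 hx')⟩

/-- The frame rule: a program changes only what it assigns. -/
theorem Exec.agree {W : ℕ} {c : Cmd} {σ σ' : State} {t : ℕ} (h : Exec W c σ σ' t) :
    Agree c σ σ' := by
  induction h with
  | nop => exact Agree.refl _ _
  | setN σ x e h =>
    refine ⟨fun y hy => ?_, fun _ _ => rfl, fun _ _ => rfl, fun _ _ => rfl⟩
    simp only [Cmd.modNVar, List.mem_singleton] at hy
    simp [Function.update_of_ne hy]
  | setR σ x e =>
    refine ⟨fun _ _ => rfl, fun y hy => ?_, fun _ _ => rfl, fun _ _ => rfl⟩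
    simp only [Cmd.modRVar, List.mem_singleton] at hy
    simp [Function.update_of_ne hy]
  | storeN σ a i e h =>
    refine ⟨fun _ _ => rfl, fun _ _ => rfl, fun y hy => ?_, fun _ _ => rfl⟩
    simp only [Cmd.modNArr, List.mem_singleton] at hy
    simp [Function.update_of_ne hy]
  | storeR σ a i e =>
    refine ⟨fun _ _ => rfl, fun _ _ => rfl, fun _ _ => rfl, fun y hy => ?_⟩
    simp only [Cmd.modRArr, List.mem_singleton] at hy
    simp [Function.update_of_ne hy]
  | seq _ _ ih ih' =>
    exact (ih.of_subset (d := .seq _ _) (List.subset_append_left _ _)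
      (List.subset_append_left _ _) (List.subset_append_left _ _)
      (List.subset_append_left _ _)).trans
      (ih'.of_subset (d := .seq _ _) (List.subset_append_right _ _)
      (List.subset_append_right _ _) (List.subset_append_right _ _)
      (List.subset_append_right _ _))
  | branchTrue _ _ ih =>
    exact ih.of_subset (d := .branch _ _ _) (List.subset_append_left _ _)
      (List.subset_append_left _ _) (List.subset_append_left _ _) (List.subset_append_left _ _)
  | branchFalse _ _ ih =>
    exact ih.of_subset (d := .branch _ _ _) (List.subset_append_right _ _)
      (List.subset_append_right _ _) (List.subset_append_right _ _) (List.subset_append_right _ _)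
  | loopDone => exact Agree.refl _ _
  | loopStep _ _ _ ih ih' =>
    exact (ih.of_subset (d := .loop _ _) (List.Subset.refl _) (List.Subset.refl _)
      (List.Subset.refl _) (List.Subset.refl _)).trans ih'

/-- Started in `σ`, the program `c` halts, storing only natural numbers up to `W`, and the final
memory and the number of steps satisfy `Q`. -/
def Run (W : ℕ) (c : Cmd) (σ : State) (Q : State → ℕ → Prop) : Prop :=
  ∃ σ' t, Exec W c σ σ' t ∧ Q σ' t

variable {W : ℕ} {σ : State} {Q R : State → ℕ → Prop}

theorem run_nop : Run W .nop σ Q ↔ Q σ 1 := by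
  constructor
  · rintro ⟨_, _, h, hQ⟩; cases h; exact hQ
  · exact fun h => ⟨_, _, .nop _, h⟩

theorem run_setN {x : ℕ} {e : NExp} :
    Run W (.setN x e) σ Q ↔ e.eval σ ≤ W ∧ Q (σ.setN x (e.eval σ)) (e.cost + 1) := by
  constructor
  · rintro ⟨_, _, h, hQ⟩; cases h with | setN _ _ _ h => exact ⟨h, hQ⟩
  · exact fun h => ⟨_, _, .setN _ _ _ h.1, h.2⟩

theorem run_setR {x : ℕ} {e : RExp} :
    Run W (.setR x e) σ Q ↔ Q (σ.setR x (e.eval σ)) (e.cost + 1) := by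
  constructor
  · rintro ⟨_, _, h, hQ⟩; cases h; exact hQ
  · exact fun h => ⟨_, _, .setR _ _ _, h⟩

theorem run_storeN {a : ℕ} {i e : NExp} :
    Run W (.storeN a i e) σ Q ↔
      e.eval σ ≤ W ∧ Q (σ.putN a (i.eval σ) (e.eval σ)) (i.cost + e.cost + 1) := by
  constructor
  · rintro ⟨_, _, h, hQ⟩; cases h with | storeN _ _ _ _ h => exact ⟨h, hQ⟩
  · exact fun h => ⟨_, _, .storeN _ _ _ _ h.1, h.2⟩

theorem run_storeR {a : ℕ} {i : NExp} {e : RExp} :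
    Run W (.storeR a i e) σ Q ↔ Q (σ.putR a (i.eval σ) (e.eval σ)) (i.cost + e.cost + 1) := by
  constructor
  · rintro ⟨_, _, h, hQ⟩; cases h; exact hQ
  · exact fun h => ⟨_, _, .storeR _ _ _ _, h⟩

theorem run_seq {c d : Cmd} :
    Run W (.seq c d) σ Q ↔
      Run W c σ fun σ' t => Run W d σ' fun σ'' t' => Q σ'' (t + t') := by
  constructor
  · rintro ⟨_, _, h, hQ⟩
    cases h with | seq h h' => exact ⟨_, _, h, _, _, h', hQ⟩
  · rintro ⟨_, _, h, _, _, h', hQ⟩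
    exact ⟨_, _, .seq h h', hQ⟩

theorem run_branch {b : BExp} {c d : Cmd} :
    Run W (.branch b c d) σ Q ↔
      (b.eval σ → Run W c σ fun σ' t => Q σ' (b.cost + t)) ∧
      (¬ b.eval σ → Run W d σ fun σ' t => Q σ' (b.cost + t)) := by
  constructor
  · rintro ⟨_, _, h, hQ⟩
    cases h with
    | branchTrue hb h => exact ⟨fun _ => ⟨_, _, h, hQ⟩, fun hb' => absurd hb hb'⟩
    | branchFalse hb h => exact ⟨fun hb' => absurd hb' hb, fun _ => ⟨_, _, h, hQ⟩⟩
  · rintro ⟨h1, h2⟩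
    by_cases hb : b.eval σ
    · obtain ⟨_, _, h, hQ⟩ := h1 hb
      exact ⟨_, _, .branchTrue hb h, hQ⟩
    · obtain ⟨_, _, h, hQ⟩ := h2 hb
      exact ⟨_, _, .branchFalse hb h, hQ⟩

/-- Weakening of the postcondition, in which the frame condition may be used. -/
theorem Run.mono {c : Cmd} (h : Run W c σ Q) (hQ : ∀ σ' t, Agree c σ σ' → Q σ' t → R σ' t) :
    Run W c σ R := by
  obtain ⟨σ', t, h, hq⟩ := h
  exact ⟨σ', t, h, hQ σ' t h.agree hq⟩

theorem Run.seq {c d : Cmd} (h : Run W c σ R)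
    (h' : ∀ τ t, Agree c σ τ → R τ t → Run W d τ fun τ' t' => Q τ' (t + t')) :
    Run W (.seq c d) σ Q :=
  run_seq.2 (h.mono h')

/-- The rule for loops: `I` is an invariant, and every iteration, together with the test that
precedes it, is paid for by a decrease of the potential `pot`. -/
theorem Run.loop {b : BExp} {c : Cmd} (I : State → Prop) (pot : State → ℕ) (h0 : I σ)
    (hstep : ∀ τ, Agree c σ τ → I τ → b.eval τ →
      Run W c τ fun τ' t => I τ' ∧ b.cost + t + pot τ' ≤ pot τ)
    (hQ : ∀ τ t, Agree c σ τ → I τ → ¬ b.eval τ → t + pot τ ≤ pot σ + b.cost → Q τ t) :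
    Run W (.loop b c) σ Q := by
  -- a test takes at least one step, so that every iteration lowers the potential
  have hpos : ∀ b : BExp, 0 < b.cost := by intro b; cases b <;> simp [BExp.cost]
  have key : ∀ k, ∀ τ, pot τ = k → Agree c σ τ → I τ →
      ∃ τ' t, Exec W (.loop b c) τ τ' t ∧ Agree c σ τ' ∧ I τ' ∧ ¬ b.eval τ' ∧
        t + pot τ' ≤ pot τ + b.cost := by
    intro k
    induction k using Nat.strong_induction_on with
    | _ k ih =>
      intro τ hk hA hI
      by_cases hb : b.eval τ
      · obtain ⟨τ', t, he, hI', ht⟩ := hstep τ hA hI hb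
        have hc := hpos b
        obtain ⟨τ'', t', he', hA'', hI'', hb'', ht''⟩ :=
          ih (pot τ') (by omega) τ' rfl (hA.trans he.agree) hI'
        exact ⟨τ'', _, .loopStep hb he he', hA'', hI'', hb'', by omega⟩
      · exact ⟨τ, _, .loopDone hb, hA, hI, hb, by omega⟩
  obtain ⟨τ, t, he, hA, hI, hb, ht⟩ := key _ σ rfl (Agree.refl _ _) h0
  exact ⟨τ, t, he, hQ τ t hA hI hb ht⟩

/-- Counting loop: the natural variable `x` runs through `lo, …, hi - 1`. -/
def Cmd.forUp (x : ℕ) (lo hi : NExp) (c : Cmd) : Cmd :=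
  .seq (.setN x lo) (.loop (.ltN (.var x) hi) (.seq c (.setN x (.add (.var x) (.lit 1)))))

/-- The rule for counting loops: `I k` is the invariant, and `pot k` the potential, when the counter
is `k`. An iteration pays `hi.cost + 6` for the test and the increment of the counter. -/
theorem Run.forUp {x : ℕ} {lo hi : NExp} {c : Cmd} (a H : ℕ)
    (I : ℕ → State → Prop) (pot : ℕ → State → ℕ)
    (hx : x ∉ c.modNVar) (hlo : lo.eval σ = a) (ha : a ≤ H) (hW : H ≤ W)
    (h0 : I a (σ.setN x a))
    (hhi : ∀ τ, Agree (Cmd.forUp x lo hi c) σ τ → hi.eval τ = H)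
    (hstep : ∀ k τ, Agree (Cmd.forUp x lo hi c) σ τ → τ.nvar x = k → a ≤ k → k < H → I k τ →
      Run W c τ fun τ' t => I (k + 1) (τ'.setN x (k + 1)) ∧
        hi.cost + 6 + t + pot (k + 1) (τ'.setN x (k + 1)) ≤ pot k τ)
    (hQ : ∀ τ t, Agree (Cmd.forUp x lo hi c) σ τ → τ.nvar x = H → I H τ →
      t + pot H τ ≤ pot a (σ.setN x a) + lo.cost + hi.cost + 3 → Q τ t) :
    Run W (Cmd.forUp x lo hi c) σ Q := by
  have hsub : ∀ τ, Agree (Cmd.seq c (.setN x (.add (.var x) (.lit 1)))) (σ.setN x a) τ →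
      Agree (Cmd.forUp x lo hi c) σ τ := by
    intro τ h
    have h1 : Agree (Cmd.forUp x lo hi c) (σ.setN x a) τ :=
      h.of_subset (by simp [Cmd.forUp, Cmd.modNVar]) (by simp [Cmd.forUp, Cmd.modRVar])
        (by simp [Cmd.forUp, Cmd.modNArr]) (by simp [Cmd.forUp, Cmd.modRArr])
    have h2 : Agree (Cmd.forUp x lo hi c) σ (σ.setN x a) := by
      refine ⟨fun y hy => ?_, fun _ _ => rfl, fun _ _ => rfl, fun _ _ => rfl⟩
      rw [nvar_setN, if_neg]
      rintro rfl
      exact hy (by simp [Cmd.forUp, Cmd.modNVar])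
    exact h2.trans h1
  rw [Cmd.forUp, run_seq, run_setN, hlo]
  refine ⟨ha.trans hW, ?_⟩
  refine Run.loop (fun τ => a ≤ τ.nvar x ∧ τ.nvar x ≤ H ∧ I (τ.nvar x) τ)
    (fun τ => pot (τ.nvar x) τ) ?_ ?_ ?_
  · have : (σ.setN x a).nvar x = a := by simp [nvar_setN]
    rw [this]
    exact ⟨le_rfl, ha, h0⟩
  · rintro τ hA ⟨h1, h2, h3⟩ hb
    have hA' := hsub τ hA
    simp only [BExp.eval, NExp.eval, hhi τ hA'] at hb
    rw [run_seq]
    refine (hstep _ τ hA' rfl h1 hb h3).mono fun τ' t hA'' h => ?_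
    obtain ⟨e', e''⟩ := h
    have e := hA''.nvar x hx
    have : NExp.eval τ' ((NExp.var x).add (.lit 1)) = τ.nvar x + 1 := by simp [NExp.eval, e]
    rw [run_setN, this]
    have hx' : (τ'.setN x (τ.nvar x + 1)).nvar x = τ.nvar x + 1 := by simp [nvar_setN]
    refine ⟨by omega, ?_, ?_⟩
    · rw [hx']; exact ⟨by omega, hb, e'⟩
    · simp only [hx', BExp.cost, NExp.cost]; omega
  · rintro τ t hA ⟨h1, h2, h3⟩ hb ht
    have hA' := hsub τ hA
    simp only [BExp.eval, NExp.eval, hhi τ hA', not_lt] at hb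
    have hxH : τ.nvar x = H := le_antisymm h2 hb
    have : (σ.setN x a).nvar x = a := by simp [nvar_setN]
    rw [hxH] at h3 ht
    rw [this] at ht
    refine hQ τ _ hA' hxH h3 ?_
    simp only [BExp.cost, NExp.cost] at ht
    omega

/-- Sequential composition of a list of programs. -/
def Cmd.block : List Cmd → Cmd
  | [] => .nop
  | [c] => c
  | c :: d :: l => .seq c (Cmd.block (d :: l))

end RealRAM

/-! ### Running maxima -/

namespace Evac

/-- The total weight of the vertices `1, …, i - 1`. -/
noncomputable def pre (w : ℕ → ℝ) (i : ℕ) : ℝ := ∑ j ∈ Finset.Ico 1 i, w j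

theorem pre_one (w : ℕ → ℝ) : pre w 1 = 0 := by simp [pre]

theorem pre_succ (w : ℕ → ℝ) {i : ℕ} (h : 1 ≤ i) : pre w (i + 1) = pre w i + w i := by
  rw [pre, Finset.sum_Ico_succ_top h, pre]

theorem pre_congr {w w' : ℕ → ℝ} {i : ℕ} (h : ∀ j, 1 ≤ j → j < i → w j = w' j) :
    pre w i = pre w' i :=
  Finset.sum_congr rfl fun j hj => h j (Finset.mem_Ico.1 hj).1 (Finset.mem_Ico.1 hj).2

theorem pre_add_Ioc (w : ℕ → ℝ) {i j : ℕ} (h : i ≤ j) :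
    pre w (j + 1) = pre w (i + 1) + ∑ l ∈ Finset.Ioc i j, w l := by
  have : Finset.Ioc i j = Finset.Ico (i + 1) (j + 1) := by
    ext; simp only [Finset.mem_Ioc, Finset.mem_Ico]; omega
  rw [this, pre, pre, Finset.sum_Ico_consecutive _ (Nat.le_add_left 1 i) (Nat.succ_le_succ h)]

/-- The position `z l` of vertex `l`, in units of flow, reduced by the weight of the vertices before
it.  For a walk away from the destination, the fronts of the clusters are the strict running maxima
of this function. -/
noncomputable def off (z w : ℕ → ℝ) (l : ℕ) : ℝ := z l - pre w l

/-- The maximum of `A` over the indices in `(i, j]`; for `j ≤ i` it is `A (i + 1)` by convention. -/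
noncomputable def mx (A : ℕ → ℝ) (i : ℕ) : ℕ → ℝ
  | 0 => A (i + 1)
  | j + 1 => if j < i then A (i + 1) else max (mx A i j) (A (j + 1))

theorem mx_of_le (A : ℕ → ℝ) {i j : ℕ} (h : j ≤ i) : mx A i j = A (i + 1) := by
  cases j with
  | zero => rfl
  | succ j => rw [mx, if_pos (by omega)]

theorem mx_succ (A : ℕ → ℝ) {i j : ℕ} (h : i ≤ j) :
    mx A i (j + 1) = max (mx A i j) (A (j + 1)) := by
  rw [mx, if_neg (by omega)]

theorem le_mx (A : ℕ → ℝ) {i j l : ℕ} (h : i < l) (h' : l ≤ j) : A l ≤ mx A i j := by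
  induction j, h' using Nat.le_induction with
  | base =>
    obtain ⟨l, rfl⟩ : ∃ k, l = k + 1 := ⟨l - 1, by omega⟩
    rw [mx_succ A (by omega)]; exact le_max_right _ _
  | succ j hj ih => rw [mx_succ A (by omega)]; exact ih.trans (le_max_left _ _)

/-- The maximum is attained, and the first index at which it is attained is a record. -/
theorem exists_mx (A : ℕ → ℝ) {i j : ℕ} (h : i < j) :
    ∃ l, i < l ∧ l ≤ j ∧ A l = mx A i j ∧ ∀ l', i < l' → l' < l → A l' < A l := by
  induction j, h using Nat.le_induction with
  | base =>
    refine ⟨i + 1, by omega, le_rfl, ?_, fun l' h1 h2 => by omega⟩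
    rw [Nat.succ_eq_add_one, mx_succ A le_rfl, mx_of_le A le_rfl, max_self]
  | succ j hj ih =>
    obtain ⟨l, h1, h2, h3, h4⟩ := ih
    rw [mx_succ A (by omega)]
    rcases le_or_gt (A (j + 1)) (mx A i j) with hc | hc
    · exact ⟨l, h1, by omega, by rw [h3, max_eq_left hc], h4⟩
    · refine ⟨j + 1, by omega, le_rfl, by rw [max_eq_right hc.le], fun l' h5 h6 => ?_⟩
      exact (le_mx A h5 (by omega)).trans_lt hc

theorem mx_le_iff (A : ℕ → ℝ) {i j : ℕ} (h : i < j) {t : ℝ} :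
    mx A i j ≤ t ↔ ∀ l, i < l → l ≤ j → A l ≤ t := by
  constructor
  · exact fun ht l h1 h2 => (le_mx A h1 h2).trans ht
  · intro H
    obtain ⟨l, h1, h2, h3, -⟩ := exists_mx A h
    rw [← h3]; exact H l h1 h2

theorem mx_mono (A : ℕ → ℝ) {i j j' : ℕ} (h : j ≤ j') (hi : i < j) : mx A i j ≤ mx A i j' :=
  (mx_le_iff A hi).2 fun _ h1 h2 => le_mx A h1 (h2.trans h)

theorem mx_anti (A : ℕ → ℝ) {i i' j : ℕ} (h : i ≤ i') (hj : i' < j) : mx A i' j ≤ mx A i j :=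
  (mx_le_iff A hj).2 fun _ h1 h2 => le_mx A (h.trans_lt h1) h2

theorem mx_congr_add {A B : ℕ → ℝ} {i j : ℕ} (d : ℝ) (hij : i < j)
    (h : ∀ l, i < l → l ≤ j → A l = B l + d) : mx A i j = mx B i j + d := by
  apply le_antisymm
  · rw [mx_le_iff A hij]
    intro l h1 h2
    rw [h l h1 h2]
    linarith [le_mx B h1 h2]
  · rw [← le_sub_iff_add_le, mx_le_iff B hij]
    intro l h1 h2
    linarith [h l h1 h2, le_mx A h1 h2]

theorem mx_congr {A B : ℕ → ℝ} {i j : ℕ} (hij : i < j)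
    (h : ∀ l, i < l → l ≤ j → A l = B l) : mx A i j = mx B i j := by
  have := mx_congr_add (A := A) (B := B) 0 hij (fun l h1 h2 => by rw [h l h1 h2, add_zero])
  rw [this, add_zero]

theorem mx_split (A : ℕ → ℝ) {i b j : ℕ} (h : i < b) (h' : b < j) :
    mx A i j = max (mx A i b) (mx A b j) := by
  apply le_antisymm
  · rw [mx_le_iff A (h.trans h')]
    intro l h1 h2
    rcases le_or_gt l b with hl | hl
    · exact (le_mx A h1 hl).trans (le_max_left _ _)
    · exact (le_mx A hl h2).trans (le_max_right _ _)
  · exact max_le (mx_mono A h'.le h) (mx_anti A h.le h')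

/-! ### The cost of a cluster sequence -/

section Cluster

variable {cap tau : ℝ} {p ω : ℕ → ℝ}

/-- The scaled distance of vertex `j` reduced by the weight met before it, for vertices numbered
from `0` as in `clusterFront`. -/
noncomputable def lead (cap tau : ℝ) (p ω : ℕ → ℝ) (j : ℕ) : ℝ :=
  p j * tau * cap - ∑ l ∈ Finset.range j, ω l

/-- The front vertex of the cluster of `j` is the first vertex at which `lead` attains its maximum
over the vertices up to `j`. -/
theorem clusterFront_spec (hc : 0 < cap) (j : ℕ) :
    clusterFront cap tau p ω j ≤ j ∧
    (∀ i ≤ j, lead cap tau p ω i ≤ lead cap tau p ω (clusterFront cap tau p ω j)) ∧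
    ∀ i < clusterFront cap tau p ω j,
      lead cap tau p ω i < lead cap tau p ω (clusterFront cap tau p ω j) := by
  induction j with
  | zero => simp [clusterFront]
  | succ j ih =>
    obtain ⟨h1, h2, h3⟩ := ih
    set h := clusterFront cap tau p ω j with hh
    have hcond : (∑ i ∈ Finset.Icc h j, ω i) / cap < (p (j + 1) - p h) * tau ↔
        lead cap tau p ω h < lead cap tau p ω (j + 1) := by
      rw [div_lt_iff₀ hc, lead, lead]
      have : ∑ l ∈ Finset.range (j + 1), ω l =
          ∑ l ∈ Finset.range h, ω l + ∑ i ∈ Finset.Icc h j, ω i := by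
        have e : Finset.Icc h j = Finset.Ico h (j + 1) := by
          ext; simp only [Finset.mem_Icc, Finset.mem_Ico]; omega
        rw [e, Finset.sum_range_add_sum_Ico _ (h1.trans (Nat.le_succ j))]
      rw [this]
      constructor <;> intro H <;> nlinarith
    have hrec : clusterFront cap tau p ω (j + 1) =
        if lead cap tau p ω h < lead cap tau p ω (j + 1) then j + 1 else h := by
      rw [clusterFront]
      simp only [← hh, hcond]
    rw [hrec]
    split_ifs with hlt
    · refine ⟨le_rfl, fun i hi => ?_, fun i hi => ?_⟩
      · rcases Nat.lt_or_ge i (j + 1) with h' | h'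
        · exact (h2 i (by omega)).trans hlt.le
        · rw [le_antisymm hi h']
      · exact (h2 i (by omega)).trans_lt hlt
    · refine ⟨by omega, fun i hi => ?_, h3⟩
      rcases Nat.lt_or_ge i (j + 1) with h' | h'
      · exact h2 i (by omega)
      · rw [le_antisymm hi h']; exact not_lt.1 hlt

theorem clusterFront_unique (hc : 0 < cap) {j h : ℕ} (h1 : h ≤ j)
    (h2 : ∀ i ≤ j, lead cap tau p ω i ≤ lead cap tau p ω h)
    (h3 : ∀ i < h, lead cap tau p ω i < lead cap tau p ω h) :
    clusterFront cap tau p ω j = h := by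
  obtain ⟨g1, g2, g3⟩ := clusterFront_spec (tau := tau) (p := p) (ω := ω) hc j
  rcases lt_trichotomy (clusterFront cap tau p ω j) h with hlt | heq | hlt
  · exact absurd (g2 h h1) (not_le.2 (h3 _ hlt))
  · exact heq
  · exact absurd (h2 _ g1) (not_le.2 (g3 _ hlt))

/-- The cost is the sum of the arrival times: the evacuees of vertex `j` arrive as if they had left
the front vertex of their cluster right behind all evacuees met before. -/
theorem cap_mul_clusterCost (hc : 0 < cap) (m : ℕ) (y : ℝ) :
    cap * clusterCost cap tau p ω m y =
      ∑ j ∈ Finset.range m, ω j * lead cap tau p ω (clusterFront cap tau p ω j) +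
        (∑ j ∈ Finset.range m, ω j) ^ 2 / 2 - y * tau * cap * ∑ j ∈ Finset.range m, ω j := by
  induction m with
  | zero => simp [clusterCost]
  | succ m ih =>
    set F := clusterFront cap tau p ω with hF
    have hle : ∀ j, F j ≤ j := fun j => (clusterFront_spec hc j).1
    have hFm : clusterFront cap tau p ω m = F m := rfl
    have hcw : ∀ f, clusterWeight cap tau p ω (m + 1) f =
        clusterWeight cap tau p ω m f + if F m = f then ω m else 0 := by
      intro f
      rw [clusterWeight, Finset.range_add_one, Finset.filter_insert]
      split_ifs with h
      · rw [Finset.sum_insert (by simp), add_comm]; rfl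
      · rw [add_zero]; rfl
    rw [Finset.sum_range_succ, Finset.sum_range_succ]
    set S := ∑ j ∈ Finset.range m, ω j with hS
    -- vertex `m` either opens a cluster or joins the cluster of `m - 1`, with front vertex `F m`
    rcases (hle m).eq_or_lt with hm | hm
    · have h0 : clusterWeight cap tau p ω m m = 0 := by
        rw [clusterWeight, Finset.sum_eq_zero]
        intro i hi
        simp only [Finset.mem_filter, Finset.mem_range] at hi
        have h1 : F i = m := hi.2
        have := hle i
        omega
      have : clusterCost cap tau p ω (m + 1) y = clusterCost cap tau p ω m y +
          ((p m - y) * ω m * tau + ω m ^ 2 / (2 * cap)) := by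
        rw [clusterCost, Finset.range_add_one, Finset.filter_insert, if_pos hm,
          Finset.sum_insert (by simp), add_comm, hcw, if_pos hm, h0, zero_add, clusterCost]
        congr 1
        refine Finset.sum_congr rfl fun f hf => ?_
        simp only [Finset.mem_filter, Finset.mem_range] at hf
        rw [hcw, if_neg (by omega), add_zero]
      rw [this, mul_add, ih, hm, lead, ← hS]
      field_simp
      ring
    · set h := F m with hh
      obtain ⟨g1, g2, g3⟩ := clusterFront_spec (tau := tau) (p := p) (ω := ω) hc m
      have hFh : ∀ i, h ≤ i → i ≤ m → F i = h := fun i h1 h2 =>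
        clusterFront_unique hc h1 (fun i' hi' => g2 i' (hi'.trans h2)) g3
      have hw : clusterWeight cap tau p ω m h = S - ∑ j ∈ Finset.range h, ω j := by
        have e : (Finset.range m).filter (fun i => clusterFront cap tau p ω i = h) =
            Finset.Ico h m := by
          ext i
          simp only [Finset.mem_filter, Finset.mem_range, Finset.mem_Ico]
          constructor
          · rintro ⟨h1, h2⟩
            have h3 : F i = h := h2
            have := hle i
            omega
          · rintro ⟨h1, h2⟩
            exact ⟨h2, hFh i h1 h2.le⟩
        rw [clusterWeight, e, hS, ← Finset.sum_range_add_sum_Ico _ hm.le]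
        ring
      have : clusterCost cap tau p ω (m + 1) y = clusterCost cap tau p ω m y +
          ((p h - y) * ω m * tau +
            (2 * clusterWeight cap tau p ω m h * ω m + ω m ^ 2) / (2 * cap)) := by
        rw [clusterCost, Finset.range_add_one, Finset.filter_insert, if_neg (by omega), clusterCost]
        have hmem : h ∈ (Finset.range m).filter (fun f => clusterFront cap tau p ω f = f) := by
          simp only [Finset.mem_filter, Finset.mem_range]
          exact ⟨hm, hFh h le_rfl hm.le⟩
        rw [← Finset.add_sum_erase _ _ hmem, ← Finset.add_sum_erase _ _ hmem]
        have : ∀ f ∈ ((Finset.range m).filter (fun f => clusterFront cap tau p ω f = f)).erase h,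
            (p f - y) * clusterWeight cap tau p ω (m + 1) f * tau
              + clusterWeight cap tau p ω (m + 1) f ^ 2 / (2 * cap) =
            (p f - y) * clusterWeight cap tau p ω m f * tau
              + clusterWeight cap tau p ω m f ^ 2 / (2 * cap) := by
          intro f hf
          rw [hcw, if_neg (Finset.ne_of_mem_erase hf).symm, add_zero]
        rw [Finset.sum_congr rfl this, hcw, if_pos rfl]
        field_simp
        ring
      rw [this, mul_add, ih, hw, lead]
      field_simp
      ring

/-- Two vertices are in the same cluster iff the running maxima at the two vertices agree. -/
theorem clusterFront_eq_iff (hc : 0 < cap) (i j : ℕ) :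
    clusterFront cap tau p ω i = clusterFront cap tau p ω j ↔
      lead cap tau p ω (clusterFront cap tau p ω i) =
        lead cap tau p ω (clusterFront cap tau p ω j) := by
  refine ⟨fun h => by rw [h], fun h => ?_⟩
  obtain ⟨-, -, g3⟩ := clusterFront_spec (tau := tau) (p := p) (ω := ω) hc i
  obtain ⟨-, -, g3'⟩ := clusterFront_spec (tau := tau) (p := p) (ω := ω) hc j
  rcases lt_trichotomy (clusterFront cap tau p ω i) (clusterFront cap tau p ω j) with hl | he | hl
  · exact absurd h (g3' _ hl).ne
  · exact he
  · exact absurd h (g3 _ hl).ne'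

end Cluster

end Evac

namespace Evac

/-! ### Costs on a line, and the aggregate time of a path network -/

/-- The cost, times the capacity, of moving the evacuees of the vertices `i + 1, …, n` of a line
with scaled positions `z` and weights `w` to the point with scaled coordinate `x` before them. -/
noncomputable def cost (n : ℕ) (z w : ℕ → ℝ) (i : ℕ) (x : ℝ) : ℝ :=
  ∑ j ∈ Finset.Ioc i n, w j * mx (off z w) i j + (∑ j ∈ Finset.Ioc i n, w j) ^ 2 / 2
    - (x - pre w (i + 1)) * ∑ j ∈ Finset.Ioc i n, w j

/-- The weights of the vertices up to `i` do not matter: they shift `off` by a constant, which the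
last term compensates. -/
theorem cost_congr {n : ℕ} {z w w' : ℕ → ℝ} {i : ℕ} (h : ∀ j, i < j → j ≤ n → w j = w' j)
    (x : ℝ) : cost n z w i x = cost n z w' i x := by
  have hs : ∑ j ∈ Finset.Ioc i n, w j = ∑ j ∈ Finset.Ioc i n, w' j :=
    Finset.sum_congr rfl fun j hj => h j (Finset.mem_Ioc.1 hj).1 (Finset.mem_Ioc.1 hj).2
  have hA : ∀ l, i < l → l ≤ n → off z w l = off z w' l + (pre w' (i + 1) - pre w (i + 1)) := by
    intro l h1 h2
    obtain ⟨l, rfl⟩ : ∃ k, l = k + 1 := ⟨l - 1, by omega⟩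
    rw [off, off, pre_add_Ioc w (show i ≤ l by omega), pre_add_Ioc w' (show i ≤ l by omega)]
    have : ∑ j ∈ Finset.Ioc i l, w j = ∑ j ∈ Finset.Ioc i l, w' j :=
      Finset.sum_congr rfl fun j hj => h j (Finset.mem_Ioc.1 hj).1
        (by have := (Finset.mem_Ioc.1 hj).2; omega)
    rw [this]; ring
  have hm : ∑ j ∈ Finset.Ioc i n, w j * mx (off z w) i j =
      ∑ j ∈ Finset.Ioc i n, (w' j * mx (off z w') i j +
        w' j * (pre w' (i + 1) - pre w (i + 1))) := by
    refine Finset.sum_congr rfl fun j hj => ?_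
    rw [Finset.mem_Ioc] at hj
    rw [mx_congr_add _ hj.1 (fun l h1 h2 => hA l h1 (h2.trans hj.2)), h j hj.1 hj.2]
    ring
  rw [cost, cost, hm, hs, Finset.sum_add_distrib, ← Finset.sum_mul]
  ring

/-- Evacuees who are already at the destination can only delay the others. -/
theorem cost_succ_le {n : ℕ} {z w : ℕ → ℝ} (hw : ∀ j, 1 ≤ j → j ≤ n → 0 ≤ w j) {i : ℕ}
    (hi : i + 1 ≤ n) : cost n z w (i + 1) (z (i + 1)) ≤ cost n z w i (z (i + 1)) := by
  have hI : Finset.Ioc i n = insert (i + 1) (Finset.Ioc (i + 1) n) := by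
    ext; simp only [Finset.mem_Ioc, Finset.mem_insert]; omega
  have hm : ∑ j ∈ Finset.Ioc (i + 1) n, w j * mx (off z w) (i + 1) j ≤
      ∑ j ∈ Finset.Ioc (i + 1) n, w j * mx (off z w) i j := by
    refine Finset.sum_le_sum fun j hj => ?_
    rw [Finset.mem_Ioc] at hj
    exact mul_le_mul_of_nonneg_left (mx_anti _ (Nat.le_succ i) hj.1) (hw j (by omega) hj.2)
  have hw0 := hw (i + 1) (by omega) hi
  rw [cost, cost, hI, Finset.sum_insert (by simp), Finset.sum_insert (by simp),
    mx_succ _ le_rfl, mx_of_le _ le_rfl, max_self, off, pre_succ w (show 1 ≤ i + 1 by omega)]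
  nlinarith

section Cluster

variable {cap tau : ℝ} {p ω z w : ℕ → ℝ} {i : ℕ}

theorem lead_clusterFront (hc : 0 < cap) (hp : ∀ j, p j * tau * cap = z (i + 1 + j))
    (hω : ∀ j, ω j = w (i + 1 + j)) (j : ℕ) :
    lead cap tau p ω (clusterFront cap tau p ω j) =
      mx (off z w) i (i + 1 + j) + pre w (i + 1) := by
  have hl : ∀ j, lead cap tau p ω j = off z w (i + 1 + j) + pre w (i + 1) := by
    intro j
    rw [lead, hp, off, show i + 1 + j = (i + j) + 1 by omega,
      pre_add_Ioc w (show i ≤ i + j by omega)]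
    have : Finset.Ioc i (i + j) = Finset.Ico (i + 1) (i + 1 + j) := by
      ext; simp only [Finset.mem_Ioc, Finset.mem_Ico]; omega
    rw [this, Finset.sum_Ico_eq_sum_range, Finset.sum_congr rfl fun l _ => hω l]
    simp only [Nat.add_sub_cancel_left]
    ring
  obtain ⟨h1, h2, -⟩ := clusterFront_spec (tau := tau) (p := p) (ω := ω) hc j
  rw [hl]
  congr 1
  apply le_antisymm
  · exact le_mx _ (by omega) (by omega)
  · rw [mx_le_iff _ (by omega)]
    intro l h3 h4
    have := h2 (l - (i + 1)) (by omega)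
    rw [hl, hl, show i + 1 + (l - (i + 1)) = l by omega] at this
    linarith

theorem clusterFront_eq_iff_mx (hc : 0 < cap) (hp : ∀ j, p j * tau * cap = z (i + 1 + j))
    (hω : ∀ j, ω j = w (i + 1 + j)) (a b : ℕ) :
    clusterFront cap tau p ω a = clusterFront cap tau p ω b ↔
      mx (off z w) i (i + 1 + a) = mx (off z w) i (i + 1 + b) := by
  rw [clusterFront_eq_iff hc, lead_clusterFront hc hp hω, lead_clusterFront hc hp hω,
    add_left_inj]

theorem cap_mul_clusterCost_eq_cost (hc : 0 < cap) (hp : ∀ j, p j * tau * cap = z (i + 1 + j))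
    (hω : ∀ j, ω j = w (i + 1 + j)) (n : ℕ) (y : ℝ) :
    cap * clusterCost cap tau p ω (n - i) y = cost n z w i (y * tau * cap) := by
  have hI : Finset.Ioc i n = Finset.Ico (i + 1) (n + 1) := by
    ext; simp only [Finset.mem_Ioc, Finset.mem_Ico]; omega
  have hS : ∑ j ∈ Finset.range (n - i), ω j = ∑ j ∈ Finset.Ioc i n, w j := by
    rw [hI, Finset.sum_Ico_eq_sum_range, Nat.add_sub_add_right]
    exact Finset.sum_congr rfl fun j _ => hω j
  have hM : ∑ j ∈ Finset.range (n - i), ω j * lead cap tau p ω (clusterFront cap tau p ω j) =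
      ∑ j ∈ Finset.Ioc i n, w j * mx (off z w) i j +
        (∑ j ∈ Finset.Ioc i n, w j) * pre w (i + 1) := by
    rw [Finset.sum_mul, ← Finset.sum_add_distrib, hI, Finset.sum_Ico_eq_sum_range,
      Nat.add_sub_add_right]
    refine Finset.sum_congr rfl fun j _ => ?_
    rw [hω, lead_clusterFront hc hp hω]
    ring
  rw [cap_mul_clusterCost hc, hS, hM, cost]
  ring

end Cluster

/-- The index of vertex `i` of the path on the line seen from side `sd`: the line itself for
`sd = 0`, its mirror image otherwise. -/
def mir (n sd i : ℕ) : ℕ := if sd = 0 then i else n + 1 - i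

theorem mir_zero (n i : ℕ) : mir n 0 i = i := rfl

theorem mir_one (n i : ℕ) : mir n 1 i = n + 1 - i := rfl

theorem mir_mem {n sd i : ℕ} (h : 1 ≤ i) (h' : i ≤ n) : 1 ≤ mir n sd i ∧ mir n sd i ≤ n := by
  unfold mir; split_ifs <;> omega

variable {n : ℕ}

/-- The scaled positions on the line seen from side `sd`. -/
noncomputable def zS (N : PathNetwork n) (sd i : ℕ) : ℝ :=
  if sd = 0 then N.pos i * N.tau * N.cap else -(N.pos (n + 1 - i) * N.tau * N.cap)

theorem cap_mul_costR (N : PathNetwork n) (s : ℕ → ℝ) (i : ℕ) (x : ℝ) :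
    N.cap * N.costR s (i + 1) x = cost n (zS N 0) s i (x * N.tau * N.cap) := by
  rw [PathNetwork.costR, Nat.add_sub_add_right]
  exact cap_mul_clusterCost_eq_cost N.cap_pos (fun j => by simp [zS]) (fun j => rfl) n x

theorem cap_mul_costL (N : PathNetwork n) (s : ℕ → ℝ) {k : ℕ} (hk : k ≤ n) (x : ℝ) :
    N.cap * N.costL s k x =
      cost n (zS N 1) (fun i => s (mir n 1 i)) (n - k) (-(x * N.tau * N.cap)) := by
  have hi : ∀ j, n + 1 - (n - k + 1 + j) = k - j := fun j => by omega
  have := cap_mul_clusterCost_eq_cost (cap := N.cap) (tau := N.tau)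
    (p := fun j => -N.pos (k - j)) (ω := fun j => s (k - j)) (z := zS N 1)
    (w := fun i => s (mir n 1 i)) (i := n - k) N.cap_pos
    (fun j => by simp [zS, hi]) (fun j => by simp [mir, hi]) n (-x)
  rw [Nat.sub_sub_self hk] at this
  rw [PathNetwork.costL, this]
  congr 1
  ring

theorem frontR_eq_iff (N : PathNetwork n) (s : ℕ → ℝ) (i a b : ℕ) :
    N.frontR s (i + 1) a = N.frontR s (i + 1) b ↔
      mx (off (zS N 0) s) i (i + 1 + a) = mx (off (zS N 0) s) i (i + 1 + b) :=
  clusterFront_eq_iff_mx N.cap_pos (fun j => by simp [zS]) (fun j => rfl) a b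

theorem frontL_eq_iff (N : PathNetwork n) (s : ℕ → ℝ) {k : ℕ} (hk : k ≤ n) (a b : ℕ) :
    N.frontL s k a = N.frontL s k b ↔
      mx (off (zS N 1) (fun i => s (mir n 1 i))) (n - k) (n - k + 1 + a) =
        mx (off (zS N 1) (fun i => s (mir n 1 i))) (n - k) (n - k + 1 + b) := by
  have hi : ∀ j, n + 1 - (n - k + 1 + j) = k - j := fun j => by omega
  exact clusterFront_eq_iff_mx (w := fun i => s (mir n 1 i)) N.cap_pos
    (fun j => by simp [zS, hi]) (fun j => by simp [mir, hi]) a b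

theorem pos_one (N : PathNetwork n) : N.pos 1 = 0 := by simp [PathNetwork.pos]

theorem pos_succ (N : PathNetwork n) {i : ℕ} (h : 1 ≤ i) : N.pos (i + 1) = N.pos i + N.len i := by
  rw [PathNetwork.pos, Finset.sum_Ico_succ_top h, PathNetwork.pos]

theorem pos_lt_pos (N : PathNetwork n) {i j : ℕ} (hi : 1 ≤ i) (hij : i < j) (hj : j ≤ n) :
    N.pos i < N.pos j := by
  induction j, hij using Nat.le_induction with
  | base => rw [Nat.succ_eq_add_one, pos_succ N hi]; linarith [N.len_pos i hi hj]
  | succ j hij ih =>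
    rw [pos_succ N (by omega)]
    linarith [N.len_pos j (by omega) hj, ih (by omega)]

theorem pos_lt_pos_iff (N : PathNetwork n) {i j : ℕ} (hi : 1 ≤ i) (hin : i ≤ n) (hj : 1 ≤ j)
    (hjn : j ≤ n) : N.pos i < N.pos j ↔ i < j := by
  constructor
  · intro h
    by_contra hc
    rcases (not_lt.1 hc).eq_or_lt with h' | h'
    · rw [h'] at h; exact lt_irrefl _ h
    · exact lt_asymm h (pos_lt_pos N hj h' hin)
  · exact fun h => pos_lt_pos N hi h hjn

/-- The evacuees to the left of vertex `i` are those behind vertex `n + 1 - i` on the mirror image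
of the path. -/
theorem cap_mul_Phi_pos (N : PathNetwork n) (s : ℕ → ℝ) {i : ℕ} (hi : 1 ≤ i) (hin : i ≤ n) :
    N.cap * N.Phi s (N.pos i) =
      cost n (zS N 1) (fun l => s (mir n 1 l)) (n + 1 - i) (zS N 1 (n + 1 - i)) +
        cost n (zS N 0) s i (zS N 0 i) := by
  have h1 : N.numLeft (N.pos i) = i - 1 := by
    have : (Finset.Icc 1 n).filter (fun j => N.pos j < N.pos i) = Finset.Icc 1 (i - 1) := by
      ext j
      simp only [Finset.mem_filter, Finset.mem_Icc]
      constructor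
      · rintro ⟨h1, h2⟩
        have := (pos_lt_pos_iff N h1.1 h1.2 hi hin).1 h2
        omega
      · intro h
        exact ⟨by omega, (pos_lt_pos_iff N h.1 (by omega) hi hin).2 (by omega)⟩
    rw [PathNetwork.numLeft, this, Nat.card_Icc, Nat.add_sub_cancel]
  have h2 : N.numLeftOrAt (N.pos i) = i := by
    have : (Finset.Icc 1 n).filter (fun j => N.pos j ≤ N.pos i) = Finset.Icc 1 i := by
      ext j
      simp only [Finset.mem_filter, Finset.mem_Icc]
      constructor
      · rintro ⟨h1, h2⟩
        exact ⟨h1.1, not_lt.1 fun h => not_lt.2 h2 ((pos_lt_pos_iff N hi hin h1.1 h1.2).2 h)⟩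
      · intro h
        exact ⟨by omega, not_lt.1 fun h' =>
          absurd ((pos_lt_pos_iff N hi hin h.1 (by omega)).1 h') (by omega)⟩
    rw [PathNetwork.numLeftOrAt, this, Nat.card_Icc, Nat.add_sub_cancel]
  rw [PathNetwork.Phi, h1, h2, mul_add, cap_mul_costR, cap_mul_costL N s (by omega)]
  have e : n - (i - 1) = n + 1 - i := by omega
  have e' : n + 1 - (n + 1 - i) = i := by omega
  simp [zS, e, e']

theorem cap_mul_Phi_edge (N : PathNetwork n) (s : ℕ → ℝ) {i : ℕ} (hi : 1 ≤ i) (hin : i + 1 ≤ n)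
    {x : ℝ} (h : N.pos i < x) (h' : x < N.pos (i + 1)) :
    N.cap * N.Phi s x =
      cost n (zS N 1) (fun l => s (mir n 1 l)) (n - i) (-(x * N.tau * N.cap)) +
        cost n (zS N 0) s i (x * N.tau * N.cap) := by
  have hlt : ∀ j, 1 ≤ j → j ≤ n → j ≤ i → N.pos j < x := fun j h1 h2 h3 => by
    refine lt_of_le_of_lt (not_lt.1 fun h4 => ?_) h
    have := (pos_lt_pos_iff N hi (by omega) h1 h2).1 h4
    omega
  have hgt : ∀ j, 1 ≤ j → j ≤ n → i < j → x < N.pos j := fun j h1 h2 h3 => by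
    refine lt_of_lt_of_le h' (not_lt.1 fun h4 => ?_)
    have := (pos_lt_pos_iff N h1 h2 (by omega) hin).1 h4
    omega
  have h1 : N.numLeft x = i := by
    have : (Finset.Icc 1 n).filter (fun j => N.pos j < x) = Finset.Icc 1 i := by
      ext j
      simp only [Finset.mem_filter, Finset.mem_Icc]
      constructor
      · rintro ⟨h1, h2⟩
        exact ⟨h1.1, not_lt.1 fun h3 => lt_asymm h2 (hgt j h1.1 h1.2 h3)⟩
      · exact fun h => ⟨by omega, hlt j h.1 (by omega) h.2⟩
    rw [PathNetwork.numLeft, this, Nat.card_Icc, Nat.add_sub_cancel]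
  have h2 : N.numLeftOrAt x = i := by
    have : (Finset.Icc 1 n).filter (fun j => N.pos j ≤ x) = Finset.Icc 1 i := by
      ext j
      simp only [Finset.mem_filter, Finset.mem_Icc]
      constructor
      · rintro ⟨h1, h2⟩
        exact ⟨h1.1, not_lt.1 fun h3 => not_lt.2 h2 (hgt j h1.1 h1.2 h3)⟩
      · exact fun h => ⟨by omega, (hlt j h.1 (by omega) h.2).le⟩
    rw [PathNetwork.numLeftOrAt, this, Nat.card_Icc, Nat.add_sub_cancel]
  rw [PathNetwork.Phi, h1, h2, mul_add, cap_mul_costR, cap_mul_costL N s (by omega)]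

/-- On an edge the aggregate time is linear, and it does not increase in the limit at a vertex: some
vertex is at least as good as a given point of the path. -/
theorem exists_vertex_Phi_le (N : PathNetwork n) {s : ℕ → ℝ} (hn : 1 ≤ n)
    (hs : ∀ i, 1 ≤ i → i ≤ n → 0 ≤ s i) {x : ℝ} (hx : x ∈ N.points) :
    ∃ i, 1 ≤ i ∧ i ≤ n ∧ N.Phi s (N.pos i) ≤ N.Phi s x := by
  have hx0 : N.pos 1 ≤ x := by rw [pos_one]; exact hx.1
  obtain ⟨i, hi, hin, hix, hmax⟩ : ∃ i, 1 ≤ i ∧ i ≤ n ∧ N.pos i ≤ x ∧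
      ∀ j, 1 ≤ j → j ≤ n → N.pos j ≤ x → j ≤ i := by
    classical
    have h1 := Nat.findGreatest_spec (P := fun i => 1 ≤ i ∧ N.pos i ≤ x) hn ⟨le_rfl, hx0⟩
    exact ⟨_, h1.1, Nat.findGreatest_le _, h1.2, fun j h2 h3 h4 =>
      Nat.le_findGreatest (P := fun i => 1 ≤ i ∧ N.pos i ≤ x) h3 ⟨h2, h4⟩⟩
  rcases hix.eq_or_lt with heq | hlt
  · exact ⟨i, hi, hin, by rw [heq]⟩
  have hin' : i + 1 ≤ n := by
    rcases hin.eq_or_lt with h | h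
    · rw [h] at hlt; exact absurd hx.2 (not_le.2 hlt)
    · exact h
  have hlt' : x < N.pos (i + 1) := not_le.1 fun h => by
    have := hmax (i + 1) (by omega) hin' h
    omega
  have hτc : 0 < N.tau * N.cap := mul_pos N.tau_pos N.cap_pos
  have hs' : ∀ l, 1 ≤ l → l ≤ n → 0 ≤ (fun l => s (mir n 1 l)) l := fun l h1 h2 =>
    hs _ (mir_mem h1 h2).1 (mir_mem h1 h2).2
  have hE := cap_mul_Phi_edge N s hi hin' hlt hlt'
  set U := ∑ j ∈ Finset.Ioc i n, s j with hU
  set U' := ∑ j ∈ Finset.Ioc (n - i) n, (fun l => s (mir n 1 l)) j with hU'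
  have hlin : ∀ y y', cost n (zS N 0) s i y' = cost n (zS N 0) s i y + (y - y') * U := by
    intro y y'; rw [cost, cost, hU]; ring
  have hlin' : ∀ y y', cost n (zS N 1) (fun l => s (mir n 1 l)) (n - i) y' =
      cost n (zS N 1) (fun l => s (mir n 1 l)) (n - i) y + (y - y') * U' := by
    intro y y'; rw [cost, cost, hU']; ring
  have hz : zS N 1 (n + 1 - i) = - zS N 0 i := by
    have : n + 1 - (n + 1 - i) = i := by omega
    simp [zS, this]
  have hz' : zS N 1 (n - i) = - zS N 0 (i + 1) := by
    have : n + 1 - (n - i) = i + 1 := by omega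
    simp [zS, this]
  have hz0 : ∀ i, zS N 0 i = N.pos i * N.tau * N.cap := fun i => by simp [zS]
  -- the point moves to the end of the edge on the side with more evacuees
  rcases le_total U U' with h | h
  · refine ⟨i, hi, hin, le_of_mul_le_mul_left ?_ N.cap_pos⟩
    have hst := cost_succ_le (z := zS N 1) hs' (i := n - i) (by omega)
    rw [show n - i + 1 = n + 1 - i by omega, hz] at hst
    rw [hE, cap_mul_Phi_pos N s hi hin, hz, hlin (zS N 0 i) (x * N.tau * N.cap),
      hlin' (-zS N 0 i) (-(x * N.tau * N.cap))]
    have : 0 ≤ (x * N.tau * N.cap - zS N 0 i) * (U' - U) := by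
      refine mul_nonneg ?_ (by linarith)
      rw [hz0]; nlinarith
    nlinarith
  · refine ⟨i + 1, by omega, hin', le_of_mul_le_mul_left ?_ N.cap_pos⟩
    have hst := cost_succ_le (z := zS N 0) hs (i := i) hin'
    rw [hE, cap_mul_Phi_pos N s (by omega) hin', Nat.add_sub_add_right, hz',
      hlin (zS N 0 (i + 1)) (x * N.tau * N.cap),
      hlin' (-zS N 0 (i + 1)) (-(x * N.tau * N.cap))]
    have : 0 ≤ (zS N 0 (i + 1) - x * N.tau * N.cap) * (U - U') := by
      refine mul_nonneg ?_ (by linarith)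
      rw [hz0]; nlinarith
    nlinarith

theorem isSink_of_forall_vertex (N : PathNetwork n) {s : ℕ → ℝ}
    (hs : ∀ i, 1 ≤ i → i ≤ n → 0 ≤ s i) {i : ℕ} (hi : 1 ≤ i) (hin : i ≤ n)
    (h : ∀ j, 1 ≤ j → j ≤ n → N.cap * N.Phi s (N.pos i) ≤ N.cap * N.Phi s (N.pos j)) :
    N.IsSink s (N.pos i) := by
  refine ⟨⟨?_, ?_⟩, fun y hy => ?_⟩
  · rcases hi.eq_or_lt with h1 | h1
    · rw [← h1, pos_one]
    · rw [← pos_one N]; exact (pos_lt_pos N le_rfl h1 hin).le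
  · rcases hin.eq_or_lt with h1 | h1
    · rw [h1]
    · exact (pos_lt_pos N hi h1 le_rfl).le
  · obtain ⟨j, h1, h2, h3⟩ := exists_vertex_Phi_le N (hi.trans hin) hs hy
    exact (le_of_mul_le_mul_left (h j h1 h2) N.cap_pos).trans h3

end Evac

namespace Evac

/-! ### Changing the weight of the boundary vertex -/

/-- Weights `u` before the vertex `b`, weight `x` at `b`, and weights `v` behind `b`. -/
noncomputable def mixw (u v : ℕ → ℝ) (b : ℕ) (x : ℝ) (i : ℕ) : ℝ :=
  if i < b then u i else if i = b then x else v i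

section Mix

variable {n : ℕ} {z u v : ℕ → ℝ} {b : ℕ} {x δ : ℝ}

theorem pre_mixw_of_le {l : ℕ} (h : l ≤ b) : pre (mixw u v b x) l = pre u l :=
  pre_congr fun j _ hj => by rw [mixw, if_pos (by omega)]

theorem pre_mixw_of_gt (hb : 1 ≤ b) {l : ℕ} (h : b ≤ l) :
    pre (mixw u v b x) (l + 1) = pre u b + x + ∑ j ∈ Finset.Ioc b l, v j := by
  rw [pre_add_Ioc _ h, pre_succ _ hb, pre_mixw_of_le le_rfl]
  have : ∑ j ∈ Finset.Ioc b l, mixw u v b x j = ∑ j ∈ Finset.Ioc b l, v j :=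
    Finset.sum_congr rfl fun j hj => by
      rw [Finset.mem_Ioc] at hj
      rw [mixw, if_neg (by omega), if_neg (by omega)]
  rw [this, mixw, if_neg (lt_irrefl b), if_pos rfl]

theorem off_mixw_of_le {l : ℕ} (h : l ≤ b) : off z (mixw u v b x) l = off z u l := by
  rw [off, off, pre_mixw_of_le h]

theorem off_mixw_of_gt (hb : 1 ≤ b) {l : ℕ} (h : b < l) :
    off z (mixw u v b (x + δ)) l = off z (mixw u v b x) l + -δ := by
  obtain ⟨l, rfl⟩ : ∃ k, l = k + 1 := ⟨l - 1, by omega⟩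
  rw [off, off, pre_mixw_of_gt hb (by omega), pre_mixw_of_gt hb (by omega)]
  ring

theorem mx_mixw_of_le {i j : ℕ} (hij : i < j) (h : j ≤ b) :
    mx (off z (mixw u v b x)) i j = mx (off z u) i j :=
  mx_congr hij fun _ _ h2 => off_mixw_of_le (h2.trans h)

theorem mx_mixw_of_ge (hb : 1 ≤ b) {i j : ℕ} (hij : i < j) (h : b ≤ i) :
    mx (off z (mixw u v b (x + δ))) i j = mx (off z (mixw u v b x)) i j + -δ :=
  mx_congr_add _ hij fun _ h1 _ => off_mixw_of_gt hb (h.trans_lt h1)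

theorem mx_mixw_split (hb : 1 ≤ b) {i j : ℕ} (hib : i < b) (hbj : b < j) :
    mx (off z (mixw u v b (x + δ))) i j =
      max (mx (off z (mixw u v b x)) i b) (mx (off z (mixw u v b x)) b j + -δ) := by
  rw [mx_split _ hib hbj, mx_mixw_of_le hib le_rfl, mx_mixw_of_ge hb hbj le_rfl,
    mx_mixw_of_le hib le_rfl]

/-- Vertex `m` is a front in the part of the line behind the boundary vertex `b`, and the vertex `i`
lies before `b`.  When the weight of `b` grows by `A m - mx A i b`, the cluster of `m` merges with
the cluster of `b` among the clusters with respect to the edge behind `i`. -/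
def IsEvent (n : ℕ) (A : ℕ → ℝ) (b i m : ℕ) : Prop :=
  1 ≤ i ∧ i < b ∧ b < m ∧ m ≤ n ∧ ∀ l, b < l → l < m → A l < A m

/-- Two clusters merge when the weight of `b` reaches `x + δ` iff `δ` is the value of an event. -/
theorem exists_merge_iff (hδ : 0 < δ) :
    (∃ i a c : ℕ, 1 ≤ i ∧ i + 1 + a ≤ n ∧ i + 1 + c ≤ n ∧
      (∀ δ', 0 ≤ δ' → δ' < δ → mx (off z (mixw u v b (x + δ'))) i (i + 1 + a) ≠
        mx (off z (mixw u v b (x + δ'))) i (i + 1 + c)) ∧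
      mx (off z (mixw u v b (x + δ))) i (i + 1 + a) =
        mx (off z (mixw u v b (x + δ))) i (i + 1 + c)) ↔
    ∃ i m, IsEvent n (off z (mixw u v b x)) b i m ∧
      δ = off z (mixw u v b x) m - mx (off z (mixw u v b x)) i b := by
  set A := off z (mixw u v b x) with hA
  constructor
  · rintro ⟨i, a, c, hi, ha, hc, hne, heq⟩
    wlog hac : a < c generalizing a c
    · rcases (not_lt.1 hac).eq_or_lt with h | h
      · exact absurd (by rw [h]) (hne 0 le_rfl hδ)
      · exact this c a hc ha (fun δ' h1 h2 => (hne δ' h1 h2).symm) heq.symm h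
    obtain ⟨I, hI⟩ : ∃ I, I = i + 1 + a := ⟨_, rfl⟩
    obtain ⟨J, hJ⟩ : ∃ J, J = i + 1 + c := ⟨_, rfl⟩
    rw [← hI, ← hJ] at heq
    simp only [← hI, ← hJ] at hne
    have h0 := hne 0 le_rfl hδ
    rw [add_zero] at h0
    -- the two running maxima shift by the same amount unless `b` lies strictly between `i` and `J`
    rcases le_or_gt J b with hJb | hJb
    · rw [mx_mixw_of_le (by omega) (by omega), mx_mixw_of_le (by omega) hJb] at h0 heq
      exact absurd heq h0
    rcases le_or_gt b i with hbi | hbi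
    · rcases Nat.eq_zero_or_pos b with hb0 | hb1
      · exfalso
        have : ∀ y l, off z (mixw u v b y) l = off z v l := by
          intro y l
          rw [off, off, pre_congr fun j h1 _ => ?_]
          rw [mixw, if_neg (by omega), if_neg (by omega)]
        apply h0
        rw [mx_congr (by omega) (fun l _ _ => this _ l),
          mx_congr (i := i) (j := J) (by omega) (fun l _ _ => this _ l)]
        rw [mx_congr (by omega) (fun l _ _ => this _ l),
          mx_congr (i := i) (j := J) (by omega) (fun l _ _ => this _ l)] at heq
        exact heq
      · rw [mx_mixw_of_ge hb1 (by omega) hbi, mx_mixw_of_ge hb1 (by omega) hbi] at heq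
        exact absurd (add_right_cancel heq) h0
    have hb1 : 1 ≤ b := by omega
    -- the maxima become equal when the maximum behind `b`, which drops by `δ`, reaches that up to
    -- `b`
    have key : δ = mx A b J - mx A i b := by
      -- a strict inequality that holds before `δ` holds weakly at `δ`
      have hge : ∀ M X : ℝ, (∀ δ', 0 ≤ δ' → δ' < δ → M < X - δ') → M ≤ X - δ := by
        intro M X h
        by_contra hlt
        have := h (max 0 (X - M)) (le_max_left _ _) (max_lt hδ (by linarith))
        linarith [le_max_right 0 (X - M)]
      rcases le_or_gt I b with hIb | hIb
      · have e : ∀ δ', mx (off z (mixw u v b (x + δ'))) i I = mx A i I := fun δ' => by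
          rw [hA, mx_mixw_of_le (by omega) hIb, mx_mixw_of_le (by omega) hIb]
        have hle : mx A i I ≤ mx A i b := mx_mono A hIb (by omega)
        simp only [e, mx_mixw_split hb1 hbi hJb, ← hA] at hne heq
        have h1 : mx A i I = mx A i b :=
          le_antisymm hle (by rw [heq]; exact le_max_left _ _)
        have h2 : mx A b J - δ ≤ mx A i b := by
          have := le_max_right (mx A i b) (mx A b J + -δ)
          rw [← heq, h1] at this; linarith
        have h3 := hge (mx A i b) (mx A b J) fun δ' h4 h5 => by
          by_contra h6
          exact hne δ' h4 h5 (by rw [h1, max_eq_left (by linarith)])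
        linarith
      · have hle : mx A b I ≤ mx A b J := mx_mono A (by omega) hIb
        simp only [mx_mixw_split hb1 hbi hJb, mx_mixw_split hb1 hbi hIb, ← hA] at hne heq
        have h3 : ∀ δ', 0 ≤ δ' → δ' < δ → mx A i b < mx A b J - δ' := fun δ' h4 h5 => by
          by_contra h6
          exact hne δ' h4 h5 (by rw [max_eq_left (by linarith), max_eq_left (by linarith)])
        have h4 : mx A b I < mx A b J := lt_of_le_of_ne hle fun h => hne 0 le_rfl hδ (by rw [h])
        have h5 : mx A b J - δ ≤ mx A i b := by
          by_contra h6
          rw [max_eq_right (a := mx A i b) (b := mx A b J + -δ) (by linarith)] at heq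
          rcases max_choice (mx A i b) (mx A b I + -δ) with h7 | h7 <;> rw [h7] at heq <;> linarith
        linarith [hge _ _ h3]
    obtain ⟨m, h1, h2, h3, h4⟩ := exists_mx A hJb
    exact ⟨i, m, ⟨hi, hbi, h1, by omega, h4⟩, by rw [h3, key]⟩
  · rintro ⟨i, m, ⟨hi, hib, hbm, hmn, hrec⟩, hδe⟩
    have hm : mx A b m = A m := le_antisymm
      ((mx_le_iff A hbm).2 fun l h1 h2 => by
        rcases h2.eq_or_lt with h | h
        · rw [h]
        · exact (hrec l h1 h).le) (le_mx A hbm le_rfl)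
    have hb1 : 1 ≤ b := by omega
    have e : ∀ δ', mx (off z (mixw u v b (x + δ'))) i b = mx A i b := fun δ' => by
      rw [hA, mx_mixw_of_le (by omega) le_rfl, mx_mixw_of_le (by omega) le_rfl]
    -- the vertices `b` and `m`, counted from `i + 1`, are in distinct clusters before `δ`
    refine ⟨i, b - (i + 1), m - (i + 1), hi, by omega, by omega, ?_, ?_⟩
    · intro δ' h1 h2
      rw [show i + 1 + (b - (i + 1)) = b by omega, show i + 1 + (m - (i + 1)) = m by omega, e,
        mx_mixw_split hb1 hib hbm, ← hA, hm]
      exact (lt_max_of_lt_right (by linarith)).ne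
    · rw [show i + 1 + (b - (i + 1)) = b by omega, show i + 1 + (m - (i + 1)) = m by omega, e,
        mx_mixw_split hb1 hib hbm, ← hA, hm, max_eq_left (by linarith)]

/-- Fronts only vanish as weights grow: a cluster that has merged at a boundary vertex does not take
part in an event of the same edge under larger weights. -/
theorem not_isEvent_of_le (hx : ∀ l, 1 ≤ l → l ≤ n → mixw u v b (x + δ) l ≤ v' l) {b' i m : ℕ}
    (h1 : IsEvent n (off z (mixw u v b x)) b i m)
    (h2 : off z (mixw u v b x) m - mx (off z (mixw u v b x)) i b ≤ δ)
    (h3 : IsEvent n (off z v') b' i m) (h4 : 0 < off z v' m - mx (off z v') i b') : False := by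
  obtain ⟨hi, hib, hbm, hmn, -⟩ := h1
  obtain ⟨-, hib', hbm', -, hrec⟩ := h3
  -- under `v'`, the vertex `m` is a front among all vertices behind `i`
  have hfront : ∀ l, i < l → l < m → off z v' l < off z v' m := by
    intro l hl hlm
    rcases le_or_gt l b' with h | h
    · linarith [le_mx (off z v') hl h]
    · exact hrec l h hlm
  obtain ⟨l, hil, hlb, hl, -⟩ := exists_mx (off z (mixw u v b x)) hib
  have hb1 : 1 ≤ b := by omega
  -- once `b` has the additional weight `δ`, the vertex `l` prevents `m` from being a front
  have h5 : off z (mixw u v b (x + δ)) m ≤ off z (mixw u v b (x + δ)) l := by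
    rw [off_mixw_of_gt hb1 hbm, off_mixw_of_le hlb]
    rw [off_mixw_of_le hlb] at hl
    linarith
  have h6 := hfront l hil (by omega)
  -- larger weights between `l` and `m` lower `off` at `m` even further relative to `l`
  have hsub : ∀ w : ℕ → ℝ, pre w m = pre w l + ∑ j ∈ Finset.Ico l m, w j := fun w => by
    rw [pre, pre, Finset.sum_Ico_consecutive _ (by omega) (by omega)]
  have h7 : ∑ j ∈ Finset.Ico l m, mixw u v b (x + δ) j ≤ ∑ j ∈ Finset.Ico l m, v' j :=
    Finset.sum_le_sum fun j hj => by
      rw [Finset.mem_Ico] at hj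
      exact hx j (by omega) (by omega)
  rw [off, off, hsub] at h5 h6
  linarith

/-- The delay behind the boundary vertex that exceeds the lead `t`. -/
noncomputable def excess (n : ℕ) (A v : ℕ → ℝ) (b : ℕ) (t : ℝ) : ℝ :=
  ∑ j ∈ Finset.Ioc b n, v j * max 0 (mx A b j - t)

/-- The cost at a vertex before the boundary vertex, as a function of the additional weight `δ` of
the boundary vertex. -/
theorem cost_mixw (hb : 1 ≤ b) (hbn : b ≤ n) {i : ℕ} (hib : i < b) (y : ℝ) :
    cost n z (mixw u v b (x + δ)) i y =
      ∑ j ∈ Finset.Ioc i (b - 1), u j * mx (off z u) i j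
      + (x + δ) * mx (off z u) i b
      + mx (off z u) i b * ∑ j ∈ Finset.Ioc b n, v j
      + excess n (off z (mixw u v b x)) v b (mx (off z u) i b + δ)
      + (pre u b + x + ∑ j ∈ Finset.Ioc b n, v j - pre u (i + 1) + δ) ^ 2 / 2
      - (y - pre u (i + 1)) *
        (pre u b + x + ∑ j ∈ Finset.Ioc b n, v j - pre u (i + 1) + δ) := by
  have hU : ∑ j ∈ Finset.Ioc i n, mixw u v b (x + δ) j =
      pre u b + x + ∑ j ∈ Finset.Ioc b n, v j - pre u (i + 1) + δ := by
    have h1 := pre_add_Ioc (mixw u v b (x + δ)) (show i ≤ n by omega)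
    rw [pre_mixw_of_gt hb hbn, pre_mixw_of_le (show i + 1 ≤ b by omega)] at h1
    linarith
  have hM : ∑ j ∈ Finset.Ioc i n, mixw u v b (x + δ) j * mx (off z (mixw u v b (x + δ))) i j =
      ∑ j ∈ Finset.Ioc i (b - 1), u j * mx (off z u) i j + (x + δ) * mx (off z u) i b +
        (mx (off z u) i b * ∑ j ∈ Finset.Ioc b n, v j +
          excess n (off z (mixw u v b x)) v b (mx (off z u) i b + δ)) := by
    have hI : Finset.Ioc i n = Finset.Ioc i b ∪ Finset.Ioc b n := by
      ext; simp only [Finset.mem_Ioc, Finset.mem_union]; omega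
    have hI' : Finset.Ioc i b = insert b (Finset.Ioc i (b - 1)) := by
      ext; simp only [Finset.mem_Ioc, Finset.mem_insert]; omega
    rw [hI, Finset.sum_union (by
      rw [Finset.disjoint_left]; intro a; simp only [Finset.mem_Ioc]; omega), hI',
      Finset.sum_insert (by simp only [Finset.mem_Ioc]; omega), excess, Finset.mul_sum,
      ← Finset.sum_add_distrib]
    congr 1
    · rw [add_comm]
      congr 1
      · refine Finset.sum_congr rfl fun j hj => ?_
        rw [Finset.mem_Ioc] at hj
        rw [mx_mixw_of_le hj.1 (by omega), mixw, if_pos (by omega)]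
      · rw [mx_mixw_of_le hib le_rfl, mixw, if_neg (lt_irrefl b), if_pos rfl]
    · refine Finset.sum_congr rfl fun j hj => ?_
      rw [Finset.mem_Ioc] at hj
      rw [mx_mixw_split hb hib hj.1, mixw, if_neg (by omega), if_neg (by omega),
        mx_mixw_of_le hib le_rfl]
      have : ∀ M X : ℝ, max M (X + -δ) = M + max 0 (X - (M + δ)) := by
        intro M X
        rcases le_total M (X + -δ) with h | h
        · rw [max_eq_right h, max_eq_right (by linarith)]; ring
        · rw [max_eq_left h, max_eq_left (by linarith)]; ring
      rw [this]; ring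
  rw [cost, hU, hM, pre_mixw_of_le (show i + 1 ≤ b by omega)]
  ring

/-- As the boundary vertex gets heavier, its evacuees being farther from `i` than from `i'`, the
cost at `i` grows at least as fast as the cost at `i'`. -/
theorem cost_mixw_sub_le (hb : 1 ≤ b) (hbn : b ≤ n) (hv : ∀ j, b < j → j ≤ n → 0 ≤ v j)
    {i i' : ℕ} (hii : i ≤ i') (hib : i' < b) (hz : z i ≤ z i') {δ' : ℝ} (hδ : δ ≤ δ') :
    cost n z (mixw u v b (x + δ')) i' (z i') - cost n z (mixw u v b (x + δ)) i' (z i') ≤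
      cost n z (mixw u v b (x + δ')) i (z i) - cost n z (mixw u v b (x + δ)) i (z i) := by
  rw [cost_mixw hb hbn hib, cost_mixw hb hbn hib, cost_mixw hb hbn (hii.trans_lt hib),
    cost_mixw hb hbn (hii.trans_lt hib)]
  have hM : mx (off z u) i' b ≤ mx (off z u) i b := mx_anti _ hii hib
  set M := mx (off z u) i b
  set M' := mx (off z u) i' b
  have hP : excess n (off z (mixw u v b x)) v b (M' + δ') -
      excess n (off z (mixw u v b x)) v b (M' + δ) ≤
      excess n (off z (mixw u v b x)) v b (M + δ') -
      excess n (off z (mixw u v b x)) v b (M + δ) := by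
    rw [excess, excess, excess, excess, ← Finset.sum_sub_distrib, ← Finset.sum_sub_distrib]
    refine Finset.sum_le_sum fun j hj => ?_
    rw [Finset.mem_Ioc] at hj
    rw [← mul_sub, ← mul_sub]
    refine mul_le_mul_of_nonneg_left ?_ (hv j hj.1 hj.2)
    generalize mx (off z (mixw u v b x)) b j = R
    -- the increments of the convex function `t ↦ max 0 (R - t)` grow with `t`, and `M' ≤ M`
    rcases le_total 0 (R - (M' + δ')) with h1 | h1 <;>
      rcases le_total 0 (R - (M' + δ)) with h2 | h2 <;>
      rcases le_total 0 (R - (M + δ')) with h3 | h3 <;>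
      rcases le_total 0 (R - (M + δ)) with h4 | h4 <;>
      simp only [max_eq_left, max_eq_right, h1, h2, h3, h4] <;> linarith
  nlinarith [mul_nonneg (sub_nonneg.2 hδ) (sub_nonneg.2 hM),
    mul_nonneg (sub_nonneg.2 hδ) (sub_nonneg.2 hz)]

end Mix

end Evac

namespace Evac

/-! ### Pseudo-bipartite scenarios seen from a side of the path -/

variable {n : ℕ}

/-- The `L`-pseudo-bipartite (`T = 0`) or `R`-pseudo-bipartite (`T = 1`) scenario. -/
noncomputable def scen (N : PathNetwork n) (T b : ℕ) (w : ℝ) : ℕ → ℝ :=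
  if T = 0 then N.scenL b w else N.scenR b w

/-- Whether, in the scenarios of type `T`, the vertices before the boundary vertex on the line seen
from side `sd` have their maximum weights (`1`) or their minimum weights (`0`). -/
def kap (T sd : ℕ) : ℕ := if sd = T then 1 else 0

/-- The minimum (`κ = 0`) or maximum (`κ = 1`) weights on the line seen from side `sd`. -/
noncomputable def wS (N : PathNetwork n) (κ sd i : ℕ) : ℝ :=
  if κ = 0 then N.lo (mir n sd i) else N.hi (mir n sd i)

/-- The scenario of type `T` with weight `x` at `v_b`, on the line seen from side `sd`. -/
noncomputable def mixS (N : PathNetwork n) (T sd b : ℕ) (x : ℝ) : ℕ → ℝ :=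
  mixw (wS N (kap T sd) sd) (wS N (1 - kap T sd) sd) (mir n sd b) x

theorem scen_mir (N : PathNetwork n) {T sd b i : ℕ} (hT : T < 2) (hsd : sd < 2)
    (hb : 1 ≤ b ∧ b ≤ n) (hi : 1 ≤ i ∧ i ≤ n) (w : ℝ) :
    scen N T b w (mir n sd i) = mixS N T sd b w i := by
  interval_cases T <;> interval_cases sd <;>
    simp only [scen, mixS, mixw, kap, wS, mir, if_pos, one_ne_zero, zero_ne_one, if_false,
      PathNetwork.scenL, PathNetwork.scenR, Nat.sub_self, Nat.sub_zero] <;>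
    split_ifs <;> first | rfl | omega

/-- The scaled position, reduced by the weight of the vertices before, under the scenario of type
`T` with minimum weight at the boundary vertex. -/
noncomputable def offS (N : PathNetwork n) (T sd b : ℕ) : ℕ → ℝ :=
  off (zS N sd) (mixS N T sd b (N.lo b))

/-- The additional weight of the boundary vertex that triggers an event. -/
noncomputable def evVal (N : PathNetwork n) (T sd b : ℕ) (q : ℕ × ℕ) : ℝ :=
  offS N T sd b q.2 - mx (offS N T sd b) q.1 (mir n sd b)

open Classical in
/-- The events of type `T` at the boundary vertex `v_b`, seen from side `sd`, that are triggered by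
weights in the admissible range. -/
noncomputable def evS (N : PathNetwork n) (T sd b : ℕ) : Finset (ℕ × ℕ) :=
  (Finset.range (n + 1) ×ˢ Finset.range (n + 1)).filter fun q =>
    IsEvent n (offS N T sd b) (mir n sd b) q.1 q.2 ∧ 0 < evVal N T sd b q ∧
      evVal N T sd b q ≤ N.hi b - N.lo b

open Classical in
theorem mem_evS {N : PathNetwork n} {T sd b : ℕ} {q : ℕ × ℕ} :
    q ∈ evS N T sd b ↔ IsEvent n (offS N T sd b) (mir n sd b) q.1 q.2 ∧ 0 < evVal N T sd b q ∧
      evVal N T sd b q ≤ N.hi b - N.lo b := by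
  rw [evS, Finset.mem_filter, and_iff_right_iff_imp]
  rintro ⟨⟨h1, h2, h3, h4, -⟩, -⟩
  simp only [Finset.mem_product, Finset.mem_range]
  omega

theorem mx_scen (N : PathNetwork n) {T sd b i j : ℕ} (hT : T < 2) (hsd : sd < 2)
    (hb : 1 ≤ b ∧ b ≤ n) (hij : i < j) (hj : j ≤ n) (w : ℝ) :
    mx (off (zS N sd) (fun l => scen N T b w (mir n sd l))) i j =
      mx (off (zS N sd) (mixS N T sd b w)) i j := by
  refine mx_congr hij fun l h1 h2 => ?_
  rw [off, off, pre_congr fun l' h3 h4 => ?_]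
  exact scen_mir N hT hsd hb ⟨h3, by omega⟩ w

/-- The weight of `v_b` is critical iff it exceeds the minimum weight by the value of an event on
one of the two sides. -/
theorem isCritical_iff (N : PathNetwork n) {T b : ℕ} (hT : T < 2) (hb : 1 ≤ b ∧ b ≤ n) (w : ℝ) :
    N.IsCritical (scen N T b) b w ↔
      ∃ sd < 2, ∃ q ∈ evS N T sd b, w = N.lo b + evVal N T sd b q := by
  have hmerge : ∀ sd < 2, N.lo b < w → ((∃ i a c : ℕ, 1 ≤ i ∧ i + 1 + a ≤ n ∧ i + 1 + c ≤ n ∧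
      (∀ w' ∈ Set.Ico (N.lo b) w,
        mx (off (zS N sd) (fun l => scen N T b w' (mir n sd l))) i (i + 1 + a) ≠
        mx (off (zS N sd) (fun l => scen N T b w' (mir n sd l))) i (i + 1 + c)) ∧
      mx (off (zS N sd) (fun l => scen N T b w (mir n sd l))) i (i + 1 + a) =
        mx (off (zS N sd) (fun l => scen N T b w (mir n sd l))) i (i + 1 + c)) ↔
      ∃ i m, IsEvent n (offS N T sd b) (mir n sd b) i m ∧
        w - N.lo b = evVal N T sd b (i, m)) := by
    intro sd hsd hw
    rw [offS, mixS]
    refine Iff.trans ?_ (exists_merge_iff (n := n) (sub_pos.2 hw))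
    refine exists_congr fun i => exists_congr fun a => exists_congr fun c =>
      and_congr_right fun hi => and_congr_right fun ha => and_congr_right fun hc => ?_
    refine and_congr ?_ ?_
    · constructor
      · intro H δ' h1 h2
        have := H (N.lo b + δ') ⟨by linarith, by linarith⟩
        rwa [mx_scen N hT hsd hb (by omega) ha, mx_scen N hT hsd hb (by omega) hc] at this
      · rintro H w' ⟨h1, h2⟩
        have := H (w' - N.lo b) (by linarith) (by linarith)
        rw [add_sub_cancel] at this
        rwa [mx_scen N hT hsd hb (by omega) ha, mx_scen N hT hsd hb (by omega) hc]
    · rw [mx_scen N hT hsd hb (by omega) ha, mx_scen N hT hsd hb (by omega) hc, mixS,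
        add_sub_cancel]
  -- the `R`-clusters with respect to the edge `e_i` start at vertex `i + 1` of the line itself
  have hR : ∀ s : ℝ → ℕ → ℝ, (∃ k i j : ℕ, 2 ≤ k ∧ k + i ≤ n ∧ k + j ≤ n ∧
        (∀ w' ∈ Set.Ico (N.lo b) w, N.frontR (s w') k i ≠ N.frontR (s w') k j) ∧
        N.frontR (s w) k i = N.frontR (s w) k j) ↔
      (∃ i a c : ℕ, 1 ≤ i ∧ i + 1 + a ≤ n ∧ i + 1 + c ≤ n ∧
      (∀ w' ∈ Set.Ico (N.lo b) w,
        mx (off (zS N 0) (fun l => s w' (mir n 0 l))) i (i + 1 + a) ≠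
        mx (off (zS N 0) (fun l => s w' (mir n 0 l))) i (i + 1 + c)) ∧
      mx (off (zS N 0) (fun l => s w (mir n 0 l))) i (i + 1 + a) =
        mx (off (zS N 0) (fun l => s w (mir n 0 l))) i (i + 1 + c)) := by
    intro s
    constructor
    · rintro ⟨k, a, c, hk, ha, hc, h1, h2⟩
      obtain ⟨i, rfl⟩ : ∃ i, k = i + 1 := ⟨k - 1, by omega⟩
      exact ⟨i, a, c, by omega, ha, hc, fun w' hw' h => h1 w' hw' ((frontR_eq_iff ..).2 h),
        (frontR_eq_iff ..).1 h2⟩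
    · rintro ⟨i, a, c, hi, ha, hc, h1, h2⟩
      exact ⟨i + 1, a, c, by omega, ha, hc, fun w' hw' h => h1 w' hw' ((frontR_eq_iff ..).1 h),
        (frontR_eq_iff ..).2 h2⟩
  -- the `L`-clusters with respect to `e_k` start at vertex `n - k + 1` of the mirror image
  have hL : ∀ s : ℝ → ℕ → ℝ, (∃ k i j : ℕ, k + 1 ≤ n ∧ i < k ∧ j < k ∧
        (∀ w' ∈ Set.Ico (N.lo b) w, N.frontL (s w') k i ≠ N.frontL (s w') k j) ∧
        N.frontL (s w) k i = N.frontL (s w) k j) ↔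
      (∃ i a c : ℕ, 1 ≤ i ∧ i + 1 + a ≤ n ∧ i + 1 + c ≤ n ∧
      (∀ w' ∈ Set.Ico (N.lo b) w,
        mx (off (zS N 1) (fun l => s w' (mir n 1 l))) i (i + 1 + a) ≠
        mx (off (zS N 1) (fun l => s w' (mir n 1 l))) i (i + 1 + c)) ∧
      mx (off (zS N 1) (fun l => s w (mir n 1 l))) i (i + 1 + a) =
        mx (off (zS N 1) (fun l => s w (mir n 1 l))) i (i + 1 + c)) := by
    intro s
    constructor
    · rintro ⟨k, a, c, hk, ha, hc, h1, h2⟩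
      exact ⟨n - k, a, c, by omega, by omega, by omega,
        fun w' hw' h => h1 w' hw' ((frontL_eq_iff N _ (by omega) _ _).2 h),
        (frontL_eq_iff N _ (by omega) _ _).1 h2⟩
    · rintro ⟨i, a, c, hi, ha, hc, h1, h2⟩
      have e : n - (n - i) = i := by omega
      refine ⟨n - i, a, c, by omega, by omega, by omega, fun w' hw' h => h1 w' hw' ?_, ?_⟩
      · have := (frontL_eq_iff N _ (by omega) _ _).1 h
        rwa [e] at this
      · refine (frontL_eq_iff N _ (by omega) _ _).2 ?_
        rwa [e]
  rw [PathNetwork.IsCritical, hR, hL]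
  constructor
  · rintro ⟨hw, h | h⟩
    · obtain ⟨i, m, h1, h2⟩ := (hmerge 0 (by norm_num) hw.1).1 h
      exact ⟨0, by norm_num, (i, m), mem_evS.2 ⟨h1, by linarith [hw.1], by linarith [hw.2]⟩,
        by linarith⟩
    · obtain ⟨i, m, h1, h2⟩ := (hmerge 1 (by norm_num) hw.1).1 h
      exact ⟨1, by norm_num, (i, m), mem_evS.2 ⟨h1, by linarith [hw.1], by linarith [hw.2]⟩,
        by linarith⟩
  · rintro ⟨sd, hsd, q, hq, rfl⟩
    obtain ⟨h1, h2, h3⟩ := mem_evS.1 hq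
    have hw : N.lo b < N.lo b + evVal N T sd b q := by linarith
    have := (hmerge sd hsd hw).2 ⟨q.1, q.2, h1, by ring⟩
    refine ⟨⟨hw, by linarith⟩, ?_⟩
    interval_cases sd
    · exact Or.inl this
    · exact Or.inr this

/-- Events with the same edge and the same front vertex occur at one boundary vertex only, because
the scenarios of type `T` with minimum or maximum weight at the boundary vertex form a monotone
sequence. -/
theorem sum_card_evS_le (N : PathNetwork n) {T sd : ℕ} (hT : T < 2) (hsd : sd < 2) :
    ∑ b ∈ Finset.Icc 1 n, (evS N T sd b).card ≤ (n + 1) ^ 2 := by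
  -- the larger boundary vertex has the larger weights for type `0`, and the smaller weights for
  -- type `1`
  have hmono : ∀ b b', (1 ≤ b ∧ b ≤ n) → (1 ≤ b' ∧ b' ≤ n) →
      (if T = 0 then b < b' else b' < b) →
      ∀ l, 1 ≤ l → l ≤ n → mixS N T sd b (N.hi b) l ≤ mixS N T sd b' (N.lo b') l := by
    intro b b' hb hb' hlt l h1 h2
    rw [← scen_mir N hT hsd hb ⟨h1, h2⟩, ← scen_mir N hT hsd hb' ⟨h1, h2⟩]
    have hm := mir_mem (sd := sd) h1 h2
    generalize mir n sd l = i at hm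
    have := N.lo_le_hi i hm.1 hm.2
    interval_cases T
    · simp only [if_pos] at hlt
      simp only [scen, PathNetwork.scenL, if_pos]
      split_ifs <;> first | omega | (subst_vars; linarith)
    · simp only [one_ne_zero, if_false] at hlt
      simp only [scen, PathNetwork.scenR, one_ne_zero, if_false]
      split_ifs <;> first | omega | (subst_vars; linarith)
  have hdisj : ∀ b b', (1 ≤ b ∧ b ≤ n) → (1 ≤ b' ∧ b' ≤ n) →
      (if T = 0 then b < b' else b' < b) → Disjoint (evS N T sd b) (evS N T sd b') := by
    intro b b' hb hb' hlt
    rw [Finset.disjoint_left]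
    intro q hq hq'
    obtain ⟨h1, h2, h3⟩ := mem_evS.1 hq
    obtain ⟨h1', h2', h3'⟩ := mem_evS.1 hq'
    refine not_isEvent_of_le (δ := N.hi b - N.lo b) (fun l hl hl' => ?_) h1 h3 h1' h2'
    have := hmono b b' hb hb' hlt l hl hl'
    rwa [mixS, ← add_sub_cancel (N.lo b) (N.hi b)] at this
  rw [← Finset.card_biUnion]
  · refine (Finset.card_le_card (t := Finset.range (n + 1) ×ˢ Finset.range (n + 1)) ?_).trans ?_
    · rw [Finset.biUnion_subset]
      classical exact fun b _ => Finset.filter_subset _ _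
    · rw [Finset.card_product, Finset.card_range, sq]
  · intro b hb b' hb' hne
    rw [Finset.mem_coe, Finset.mem_Icc] at hb hb'
    rcases hne.lt_or_gt with h | h
    · by_cases hT0 : T = 0
      · exact hdisj b b' hb hb' (by rw [if_pos hT0]; exact h)
      · exact (hdisj b' b hb' hb (by rw [if_neg hT0]; exact h)).symm
    · by_cases hT0 : T = 0
      · exact (hdisj b' b hb' hb (by rw [if_pos hT0]; exact h)).symm
      · exact hdisj b b' hb hb' (by rw [if_neg hT0]; exact h)

/-- The cost at vertex `i` of the evacuees behind it when all weights are minimum (`κ = 0`) or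
maximum (`κ = 1`). -/
noncomputable def costS (N : PathNetwork n) (κ sd i : ℕ) : ℝ :=
  cost n (zS N sd) (wS N κ sd) i (zS N sd i)

/-- The aggregate time (times the capacity) at vertex `i`, in the numbering of side `sd`, before the
boundary vertex, when the boundary vertex has the additional weight `δ`. -/
noncomputable def phiS (N : PathNetwork n) (T sd b i : ℕ) (δ : ℝ) : ℝ :=
  cost n (zS N sd) (mixS N T sd b (N.lo b + δ)) i (zS N sd i) +
    costS N (kap T sd) (1 - sd) (n + 1 - i)

/-- The aggregate time (times the capacity) at the boundary vertex. -/
noncomputable def phiB (N : PathNetwork n) (T b : ℕ) : ℝ :=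
  costS N (1 - kap T 0) 0 b + costS N (1 - kap T 1) 1 (n + 1 - b)

theorem cap_mul_Phi_mir (N : PathNetwork n) (s : ℕ → ℝ) {sd i : ℕ} (hsd : sd < 2) (hi : 1 ≤ i)
    (hin : i ≤ n) :
    N.cap * N.Phi s (N.pos (mir n sd i)) =
      cost n (zS N sd) (fun l => s (mir n sd l)) i (zS N sd i) +
        cost n (zS N (1 - sd)) (fun l => s (mir n (1 - sd) l)) (n + 1 - i)
          (zS N (1 - sd) (n + 1 - i)) := by
  interval_cases sd
  · rw [mir_zero, cap_mul_Phi_pos N s hi hin, add_comm]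
    rfl
  · have e : n + 1 - (n + 1 - i) = i := by omega
    rw [mir_one, cap_mul_Phi_pos N s (by omega) (by omega), e]
    rfl

/-- Only the cost of the side of the boundary vertex varies: on the other side of vertex `i`, all
weights are extreme. -/
theorem cap_mul_Phi_side (N : PathNetwork n) {T sd b i : ℕ} (hT : T < 2) (hsd : sd < 2)
    (hb : 1 ≤ b ∧ b ≤ n) (hi : 1 ≤ i) (hib : i < mir n sd b) (δ : ℝ) :
    N.cap * N.Phi (scen N T b (N.lo b + δ)) (N.pos (mir n sd i)) = phiS N T sd b i δ := by
  have hbm := mir_mem (sd := sd) hb.1 hb.2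
  rw [cap_mul_Phi_mir N _ hsd hi (by omega), phiS, costS]
  congr 1
  · exact cost_congr (fun j h1 h2 => scen_mir N hT hsd hb ⟨by omega, h2⟩ _) _
  · refine cost_congr (fun j h1 h2 => ?_) _
    rw [scen_mir N hT (by omega) hb ⟨by omega, h2⟩, mixS, mixw]
    have h3 : ¬ j < mir n (1 - sd) b ∧ ¬ j = mir n (1 - sd) b := by
      unfold mir at *; split_ifs at * <;> omega
    rw [if_neg h3.1, if_neg h3.2]
    have : 1 - kap T (1 - sd) = kap T sd := by
      interval_cases T <;> interval_cases sd <;> rfl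
    rw [this]

/-- The aggregate time at the boundary vertex does not depend on the weight of that vertex. -/
theorem cap_mul_Phi_boundary (N : PathNetwork n) {T b : ℕ} (hT : T < 2) (hb : 1 ≤ b ∧ b ≤ n)
    (w : ℝ) : N.cap * N.Phi (scen N T b w) (N.pos b) = phiB N T b := by
  have := cap_mul_Phi_mir N (scen N T b w) (sd := 0) (by norm_num) hb.1 hb.2
  rw [mir_zero] at this
  rw [this, phiB, costS, costS]
  congr 1
  · refine cost_congr (fun j h1 h2 => ?_) _
    rw [scen_mir N hT (by norm_num) hb ⟨by omega, h2⟩, mixS, mixw, mir_zero, if_neg (by omega),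
      if_neg (by omega)]
  · refine cost_congr (fun j h1 h2 => ?_) _
    rw [scen_mir N hT (by norm_num) hb ⟨by omega, h2⟩, mixS, mixw]
    have h3 : mir n (1 - 0) b = n + 1 - b := rfl
    rw [h3, if_neg (by omega), if_neg (by omega)]

theorem scen_nonneg (N : PathNetwork n) {T b : ℕ} (hb : 1 ≤ b ∧ b ≤ n) {w : ℝ} (hw : N.lo b ≤ w)
    {i : ℕ} (hi : 1 ≤ i) (hin : i ≤ n) : 0 ≤ scen N T b w i := by
  have h1 := (N.lo_pos i hi hin).le
  have h2 := N.lo_le_hi i hi hin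
  have h3 := (N.lo_pos b hb.1 hb.2).le
  unfold scen PathNetwork.scenL PathNetwork.scenR
  split_ifs <;> dsimp only <;> split_ifs <;> linarith

theorem wS_nonneg (N : PathNetwork n) (κ sd : ℕ) {i : ℕ} (hi : 1 ≤ i) (hin : i ≤ n) :
    0 ≤ wS N κ sd i := by
  have hm := mir_mem (sd := sd) hi hin
  have h1 := (N.lo_pos _ hm.1 hm.2).le
  have h2 := N.lo_le_hi _ hm.1 hm.2
  unfold wS
  split_ifs <;> linarith

theorem zS_mono (N : PathNetwork n) (sd : ℕ) {i j : ℕ} (hi : 1 ≤ i) (hij : i ≤ j) (hj : j ≤ n) :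
    zS N sd i ≤ zS N sd j := by
  have hle : ∀ a b, 1 ≤ a → a ≤ b → b ≤ n →
      N.pos a * N.tau * N.cap ≤ N.pos b * N.tau * N.cap := by
    intro a b h1 h2 h3
    have : N.pos a ≤ N.pos b := by
      rcases h2.eq_or_lt with h | h
      · rw [h]
      · exact (pos_lt_pos N h1 h h3).le
    have := N.tau_pos
    have := N.cap_pos
    gcongr
  unfold zS
  split_ifs
  · exact hle i j hi hij hj
  · exact neg_le_neg (hle _ _ (by omega) (by omega) (by omega))

/-- As the boundary vertex gets heavier, vertices closer to it become better. -/
theorem phiS_sub_le (N : PathNetwork n) {T sd b i i' : ℕ} (hb : 1 ≤ b ∧ b ≤ n)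
    (hi : 1 ≤ i) (hii : i ≤ i') (hib : i' < mir n sd b) {δ δ' : ℝ} (hδ : δ ≤ δ') :
    phiS N T sd b i' δ' - phiS N T sd b i' δ ≤ phiS N T sd b i δ' - phiS N T sd b i δ := by
  have hbm := mir_mem (sd := sd) hb.1 hb.2
  have := cost_mixw_sub_le (n := n) (z := zS N sd) (u := wS N (kap T sd) sd)
    (v := wS N (1 - kap T sd) sd) (b := mir n sd b) (x := N.lo b) hbm.1 hbm.2
    (fun j h1 h2 => wS_nonneg N _ _ (by omega) h2) hii hib (zS_mono N sd hi hii (by omega)) hδ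
  unfold phiS mixS
  linarith

end Evac

/-! ### The program -/

namespace Evac

open RealRAM

-- The natural variables. `vCnt` holds the number of vertices at the start and the number of
-- reported scenarios later; `vT`, `vB`, `vSd` are the type, the boundary vertex and the side,
-- `vBb` is the boundary vertex in the numbering of the side, `vK` the kind of the weights before
-- it, and `vG = 2 * vSd + vK`; `vQ` and `vLen` are the numbers of events and of records; `vP` is
-- the pointer to the records (and the target index of a merge), `vR` an event, `vS` a stride or a
-- length of blocks.
notation "vCnt" => 0
notation "vN" => 1
notation "vLg" => 2
notation "vBig" => 3
notation "vT" => 4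
notation "vB" => 5
notation "vQ" => 6
notation "vSd" => 7
notation "vK" => 8
notation "vBb" => 9
notation "vI" => 10
notation "vJ" => 11
notation "vP" => 12
notation "vL" => 13
notation "vLen" => 14
notation "vE" => 15
notation "vS" => 16
notation "vR" => 17
notation "vCol" => 18
notation "vHc" => 19
notation "vC" => 20
notation "vBi" => 21
notation "vSt" => 22
notation "vMid" => 23
notation "vEnd" => 24
notation "vG" => 25
-- The real variables. `rM` is a running maximum, `rT0` a sum of weights, `rQ` and `rT1` are sums of
-- weights times running maxima, `rBase` is the weight up to and including the boundary vertex.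
notation "rCap" => 0
notation "rTau" => 1
notation "rAcc" => 2
notation "rM" => 3
notation "rQ" => 4
notation "rA" => 5
notation "rT0" => 6
notation "rT1" => 7
notation "rD" => 8
notation "rG" => 9
notation "rBv" => 10
notation "rBase" => 11
-- The real arrays: the input (`aLen`, `aLo`, `aHi`); positions and weights (`aZ`, `aW`) and tables
-- (`aPre`, `aMT`, `aQT`, `aF`) of both lines; the records and their partial sums (`aV`, `aT0`,
-- `aT1`); the coefficients of the aggregate time at the vertices before the boundary vertex (`aM`,
-- `aC`, `aD`, `aU`); the events and the values found for them (`aEv`, `aTmp`, `aVal`, `aBest`).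
-- The output array has the number of `aLen`, which is no longer needed when the output is written.
notation "aLen" => 0
notation "aLo" => 1
notation "aHi" => 2
notation "aZ" => 3
notation "aW" => 4
notation "aPre" => 5
notation "aMT" => 6
notation "aQT" => 7
notation "aF" => 8
notation "aV" => 9
notation "aT0" => 10
notation "aT1" => 11
notation "aM" => 12
notation "aC" => 13
notation "aD" => 14
notation "aU" => 15
notation "aEv" => 16
notation "aTmp" => 17
notation "aVal" => 18
notation "aBest" => 19
-- The natural arrays beside the output: the best vertex of a side and of both sides, for every
-- event.
notation "aOpt" => 3
notation "aIdx" => 4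

infixl:65 " +ₙ " => NExp.add
infixl:65 " -ₙ " => NExp.sub
infixl:70 " *ₙ " => NExp.mul
infixl:65 " +ᵣ " => RExp.add
infixl:65 " -ᵣ " => RExp.sub
infixl:70 " *ᵣ " => RExp.mul
infixl:70 " /ᵣ " => RExp.div
notation "#ₙ" => NExp.lit
notation "!ₙ" => NExp.var
notation "!ᵣ" => RExp.var

/-- The constant of the language for a natural number, as a real number. -/
abbrev rlit (c : ℕ) : RExp := .ofNat (.lit c)

/-- Positions and weights on the two lines; the weights of kind `κ` on the line of side `sd` are
kept at the places `4 * i + (2 * sd + κ)`. -/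
def cmdSides : Cmd := .seq (.setR rAcc (rlit 0)) (.forUp vI (#ₙ 1) (!ₙ vN +ₙ #ₙ 1) (.block [
  .storeR aZ (#ₙ 2 *ₙ !ₙ vI) (!ᵣ rAcc),
  .storeR aZ (#ₙ 2 *ₙ (!ₙ vN +ₙ #ₙ 1 -ₙ !ₙ vI) +ₙ #ₙ 1) (rlit 0 -ᵣ !ᵣ rAcc),
  .storeR aW (#ₙ 4 *ₙ !ₙ vI) (.get aLo (!ₙ vI)),
  .storeR aW (#ₙ 4 *ₙ !ₙ vI +ₙ #ₙ 1) (.get aHi (!ₙ vI)),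
  .storeR aW (#ₙ 4 *ₙ (!ₙ vN +ₙ #ₙ 1 -ₙ !ₙ vI) +ₙ #ₙ 2) (.get aLo (!ₙ vI)),
  .storeR aW (#ₙ 4 *ₙ (!ₙ vN +ₙ #ₙ 1 -ₙ !ₙ vI) +ₙ #ₙ 3) (.get aHi (!ₙ vI)),
  .setR rAcc (!ᵣ rAcc +ᵣ .get aLen (!ₙ vI) *ᵣ !ᵣ rTau *ᵣ !ᵣ rCap)]))

/-- The least power of two above `2 (n + 1)²`, and its logarithm. -/
def cmdLog : Cmd := .block [
  .setN vBig (#ₙ 1),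
  .setN vLg (#ₙ 0),
  .loop (.not (.ltN (#ₙ 2 *ₙ ((!ₙ vN +ₙ #ₙ 1) *ₙ (!ₙ vN +ₙ #ₙ 1))) (!ₙ vBig)))
    (.seq (.setN vBig (#ₙ 2 *ₙ !ₙ vBig)) (.setN vLg (!ₙ vLg +ₙ #ₙ 1)))]

/-- Initialization of row `i` of the tables. -/
def cmdRowInit : Cmd := .block [
  .storeR aPre (#ₙ 4 *ₙ !ₙ vI +ₙ !ₙ vG) (!ᵣ rAcc),
  .setR rAcc (!ᵣ rAcc +ᵣ .get aW (#ₙ 4 *ₙ !ₙ vI +ₙ !ₙ vG)),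
  .setR rT0 (!ᵣ rAcc),
  .setR rM (.get aZ (#ₙ 2 *ₙ (!ₙ vI +ₙ #ₙ 1) +ₙ !ₙ vSd) -ᵣ !ᵣ rAcc),
  .setR rQ (rlit 0)]

/-- The running maxima and the sums of delays in row `i` of the tables. -/
def cmdRowLoop : Cmd := .forUp vJ (!ₙ vI) (!ₙ vN) (.block [
  .setR rA (.get aZ (#ₙ 2 *ₙ (!ₙ vJ +ₙ #ₙ 1) +ₙ !ₙ vSd) -ᵣ !ᵣ rT0),
  .branch (.ltR (!ᵣ rM) (!ᵣ rA)) (.setR rM (!ᵣ rA)) .nop,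
  .storeR aMT (#ₙ 4 *ₙ (!ₙ vI *ₙ (!ₙ vN +ₙ #ₙ 1) +ₙ !ₙ vJ) +ₙ !ₙ vG) (!ᵣ rM),
  .storeR aQT (#ₙ 4 *ₙ (!ₙ vI *ₙ (!ₙ vN +ₙ #ₙ 1) +ₙ !ₙ vJ) +ₙ !ₙ vG) (!ᵣ rQ),
  .setR rQ (!ᵣ rQ +ᵣ .get aW (#ₙ 4 *ₙ (!ₙ vJ +ₙ #ₙ 1) +ₙ !ₙ vG) *ᵣ !ᵣ rM),
  .setR rT0 (!ᵣ rT0 +ᵣ .get aW (#ₙ 4 *ₙ (!ₙ vJ +ₙ #ₙ 1) +ₙ !ₙ vG))])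

/-- The cost at vertex `i` of the evacuees behind it. -/
def cmdRowEnd : Cmd := .seq (.setR rT0 (!ᵣ rT0 -ᵣ !ᵣ rAcc))
  (.storeR aF (#ₙ 4 *ₙ !ₙ vI +ₙ !ₙ vG)
    (!ᵣ rQ +ᵣ !ᵣ rT0 *ᵣ !ᵣ rT0 /ᵣ rlit 2 -ᵣ
      (.get aZ (#ₙ 2 *ₙ !ₙ vI +ₙ !ₙ vSd) -ᵣ !ᵣ rAcc) *ᵣ !ᵣ rT0))

/-- The tables for all four combinations of a side and a kind of weights. -/
def cmdTables : Cmd := .forUp vSd (#ₙ 0) (#ₙ 2) (.forUp vK (#ₙ 0) (#ₙ 2) (.block [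
  .setN vG (#ₙ 2 *ₙ !ₙ vSd +ₙ !ₙ vK),
  .setR rAcc (rlit 0),
  .forUp vI (#ₙ 1) (!ₙ vN +ₙ #ₙ 1) (.block [cmdRowInit, cmdRowLoop, cmdRowEnd])]))

/-- The records behind the boundary vertex, with the partial sums from which the excess is found. -/
def cmdRecords : Cmd := .block [
  .setN vLen (#ₙ 0),
  .setR rT0 (rlit 0),
  .setR rT1 (rlit 0),
  .forUp vJ (!ₙ vBb +ₙ #ₙ 1) (!ₙ vN +ₙ #ₙ 1) (.block [
    .setR rA (.get aZ (#ₙ 2 *ₙ !ₙ vJ +ₙ !ₙ vSd) -ᵣ (!ᵣ rBase +ᵣ !ᵣ rT0)),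
    .branch (.not (.and (.not (.ltN (!ₙ vLen) (#ₙ 1))) (.not (.ltR (!ᵣ rM) (!ᵣ rA)))))
      (.block [
        .setR rM (!ᵣ rA),
        .storeR aV (!ₙ vLen) (!ᵣ rA),
        .storeR aT0 (!ₙ vLen) (!ᵣ rT0),
        .storeR aT1 (!ₙ vLen) (!ᵣ rT1),
        .setN vLen (!ₙ vLen +ₙ #ₙ 1)]) .nop,
    .setR rT1 (!ᵣ rT1 +ᵣ .get aW (#ₙ 4 *ₙ !ₙ vJ +ₙ (#ₙ 2 *ₙ !ₙ vSd +ₙ (#ₙ 1 -ₙ !ₙ vK))) *ᵣ !ᵣ rM),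
    .setR rT0 (!ᵣ rT0 +ᵣ .get aW (#ₙ 4 *ₙ !ₙ vJ +ₙ (#ₙ 2 *ₙ !ₙ vSd +ₙ (#ₙ 1 -ₙ !ₙ vK))))]),
  .storeR aT0 (!ₙ vLen) (!ᵣ rT0),
  .storeR aT1 (!ₙ vLen) (!ᵣ rT1)]

/-- The boundary vertex, the kind of the weights before it, and the load up to it, for the line of
side `sd`. -/
def cmdLoadInit : Cmd := .block [
  .branch (.ltN (!ₙ vSd) (#ₙ 1)) (.setN vBb (!ₙ vB)) (.setN vBb (!ₙ vN +ₙ #ₙ 1 -ₙ !ₙ vB)),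
  .branch (.and (.not (.ltN (!ₙ vSd) (!ₙ vT))) (.not (.ltN (!ₙ vT) (!ₙ vSd))))
    (.setN vK (#ₙ 1)) (.setN vK (#ₙ 0)),
  .setN vG (#ₙ 2 *ₙ !ₙ vSd +ₙ !ₙ vK),
  .setR rBase (.get aPre (#ₙ 4 *ₙ !ₙ vBb +ₙ !ₙ vG) +ᵣ .get aLo (!ₙ vB))]

/-- The data about the vertices before the boundary vertex. -/
def cmdLoadArrays : Cmd := .forUp vI (#ₙ 1) (!ₙ vBb) (.block [
  .storeR aM (!ₙ vI) (.get aMT (#ₙ 4 *ₙ (!ₙ vI *ₙ (!ₙ vN +ₙ #ₙ 1) +ₙ (!ₙ vBb -ₙ #ₙ 1)) +ₙ !ₙ vG)),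
  .storeR aD (!ₙ vI) (.get aZ (#ₙ 2 *ₙ !ₙ vI +ₙ !ₙ vSd) -ᵣ
    .get aPre (#ₙ 4 *ₙ (!ₙ vI +ₙ #ₙ 1) +ₙ !ₙ vG)),
  .storeR aU (!ₙ vI) (!ᵣ rBase +ᵣ !ᵣ rT0 -ᵣ .get aPre (#ₙ 4 *ₙ (!ₙ vI +ₙ #ₙ 1) +ₙ !ₙ vG)),
  .storeR aC (!ₙ vI) (.get aF (#ₙ 4 *ₙ (!ₙ vN +ₙ #ₙ 1 -ₙ !ₙ vI) +ₙ
      (#ₙ 2 *ₙ (#ₙ 1 -ₙ !ₙ vSd) +ₙ !ₙ vK)) +ᵣ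
    .get aQT (#ₙ 4 *ₙ (!ₙ vI *ₙ (!ₙ vN +ₙ #ₙ 1) +ₙ (!ₙ vBb -ₙ #ₙ 1)) +ₙ !ₙ vG) +ᵣ
    (.get aLo (!ₙ vB) +ᵣ !ᵣ rT0) *ᵣ .get aM (!ₙ vI))])

/-- All data about the line of side `sd` that the evaluation of the aggregate time at a vertex
before the boundary vertex needs. -/
def cmdLoad : Cmd := .block [cmdLoadInit, cmdRecords, cmdLoadArrays]

/-- The pointer `p` moves down to the number of records up to `x`. -/
def cmdDown (x : RExp) : Cmd :=
  .loop (.and (.ltN (#ₙ 0) (!ₙ vP)) (.ltR x (.get aV (!ₙ vP -ₙ #ₙ 1))))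
    (.setN vP (!ₙ vP -ₙ #ₙ 1))

/-- The events of vertex `i` are appended to the list of events. -/
def cmdAppend : Cmd := .loop (.and (.ltN (!ₙ vL) (!ₙ vLen))
    (.not (.ltR (!ᵣ rD) (.get aV (!ₙ vL) -ᵣ .get aM (!ₙ vI)))))
  (.block [
    .setN vQ (!ₙ vQ +ₙ #ₙ 1),
    .storeR aEv (!ₙ vQ) (.get aV (!ₙ vL) -ᵣ .get aM (!ₙ vI)),
    .setN vL (!ₙ vL +ₙ #ₙ 1)])

/-- The events of the current side are appended to the list of events. -/
def cmdEvents : Cmd := .seq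
  (.block [.setR rD (.get aHi (!ₙ vB) -ᵣ .get aLo (!ₙ vB)), .setN vP (!ₙ vLen)])
  (.forUp vI (#ₙ 1) (!ₙ vBb) (.block [
    cmdDown (.get aM (!ₙ vI)),
    .setN vL (!ₙ vP),
    cmdAppend]))

/-- The bounds of the next pair of blocks of length `s`. -/
def cmdBlockBounds : Cmd := .block [
  .setN vMid (!ₙ vSt +ₙ !ₙ vS),
  .branch (.ltN (!ₙ vQ) (!ₙ vMid)) (.setN vMid (!ₙ vQ +ₙ #ₙ 1)) .nop,
  .setN vEnd (!ₙ vMid +ₙ !ₙ vS),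
  .branch (.ltN (!ₙ vQ) (!ₙ vEnd)) (.setN vEnd (!ₙ vQ +ₙ #ₙ 1)) .nop,
  .setN vI (!ₙ vSt),
  .setN vJ (!ₙ vMid)]

/-- Two consecutive sorted blocks are merged. -/
def cmdMergeBlocks : Cmd := .forUp vP (!ₙ vSt) (!ₙ vEnd) (
  .branch (.and (.ltN (!ₙ vI) (!ₙ vMid)) (.not (.and (.ltN (!ₙ vJ) (!ₙ vEnd))
      (.ltR (.get aEv (!ₙ vJ)) (.get aEv (!ₙ vI))))))
    (.seq (.storeR aTmp (!ₙ vP) (.get aEv (!ₙ vI))) (.setN vI (!ₙ vI +ₙ #ₙ 1)))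
    (.seq (.storeR aTmp (!ₙ vP) (.get aEv (!ₙ vJ))) (.setN vJ (!ₙ vJ +ₙ #ₙ 1))))

/-- The merged list is copied back. -/
def cmdCopy : Cmd := .forUp vP (#ₙ 1) (!ₙ vQ +ₙ #ₙ 1) (.storeR aEv (!ₙ vP) (.get aTmp (!ₙ vP)))

/-- Pairs of consecutive sorted blocks are merged. -/
def cmdMergeAll : Cmd := .loop (.not (.ltN (!ₙ vQ) (!ₙ vSt)))
  (.seq cmdBlockBounds (.seq cmdMergeBlocks (.setN vSt (!ₙ vEnd))))

/-- One round of merge sort, which doubles the length of the sorted blocks. -/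
def cmdMerge : Cmd := .seq (.setN vSt (#ₙ 1)) (.seq cmdMergeAll cmdCopy)

/-- Merge sort of the list of events. -/
def cmdSort : Cmd := .seq (.setN vS (#ₙ 1)) (.forUp vE (#ₙ 0) (!ₙ vLg)
  (.seq cmdMerge (.setN vS (#ₙ 2 *ₙ !ₙ vS))))

/-- The aggregate time at the vertex `c` under the additional weight of the event `r`, provided that
`p` is the number of records up to the relevant lead. -/
def expPhi : RExp :=
  .get aC (!ₙ vC) +ᵣ .get aEv (!ₙ vR) *ᵣ .get aM (!ₙ vC) +ᵣ
    (.get aT1 (!ₙ vLen) -ᵣ .get aT1 (!ₙ vP) -ᵣ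
      (.get aM (!ₙ vC) +ᵣ .get aEv (!ₙ vR)) *ᵣ (.get aT0 (!ₙ vLen) -ᵣ .get aT0 (!ₙ vP))) +ᵣ
    (.get aU (!ₙ vC) +ᵣ .get aEv (!ₙ vR)) *ᵣ (.get aU (!ₙ vC) +ᵣ .get aEv (!ₙ vR)) /ᵣ rlit 2 -ᵣ
    .get aD (!ₙ vC) *ᵣ (.get aU (!ₙ vC) +ᵣ .get aEv (!ₙ vR))

/-- The pointer `p` moves up to the number of records up to the lead of the vertex `col`. -/
def cmdUp : Cmd := .loop (.and (.ltN (!ₙ vP) (!ₙ vLen))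
    (.not (.ltR (.get aM (!ₙ vCol) +ᵣ .get aEv (!ₙ vR)) (.get aV (!ₙ vP)))))
  (.setN vP (!ₙ vP +ₙ #ₙ 1))

/-- The best vertex among `col, …, hc` for the event `r`. -/
def cmdScan : Cmd := .seq (.setN vBi (#ₙ 0)) (.forUp vC (!ₙ vCol) (!ₙ vHc +ₙ #ₙ 1)
  (.seq (cmdDown (.get aM (!ₙ vC) +ᵣ .get aEv (!ₙ vR))) (.seq (.setR rG expPhi)
    (.branch (.not (.and (.not (.ltN (!ₙ vBi) (#ₙ 1))) (.not (.ltR (!ᵣ rG) (!ᵣ rBv)))))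
      (.seq (.setR rBv (!ᵣ rG)) (.setN vBi (!ₙ vC))) .nop))))

/-- The best vertex for the event `r`, and the preparation of the search for the event `r + 2 s`. -/
def cmdLevelRow : Cmd := .seq
  (.branch (.ltN (!ₙ vQ) (!ₙ vR +ₙ !ₙ vS)) (.setN vHc (!ₙ vBb -ₙ #ₙ 1))
    (.setN vHc (.get aOpt (!ₙ vR +ₙ !ₙ vS))))
  (.seq cmdUp (.seq cmdScan (.block [
    .storeN aOpt (!ₙ vR) (!ₙ vBi),
    .storeR aVal (!ₙ vR) (!ᵣ rBv),
    .setN vCol (!ₙ vHc),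
    .setN vR (!ₙ vR +ₙ #ₙ 2 *ₙ !ₙ vS)])))

/-- The best vertices for the events whose numbers are odd multiples of `s`; those for the
multiples of `2 s` are known. -/
def cmdLevel : Cmd := .seq
  (.block [.setN vR (!ₙ vS), .setN vCol (#ₙ 1), .setN vP (!ₙ vLen)])
  (.loop (.not (.ltN (!ₙ vQ) (!ₙ vR))) cmdLevelRow)

/-- The best vertex before the boundary vertex, for every event. -/
def cmdMinima : Cmd := .seq (.setN vS (!ₙ vBig)) (.forUp vE (#ₙ 0) (!ₙ vLg)
  (.seq (.setN vS (.div (!ₙ vS) (#ₙ 2))) cmdLevel))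

/-- The best vertices of the current side replace worse ones. -/
def cmdImprove : Cmd := .forUp vR (#ₙ 1) (!ₙ vQ +ₙ #ₙ 1)
  (.branch (.ltR (.get aVal (!ₙ vR)) (.get aBest (!ₙ vR)))
    (.seq (.storeR aBest (!ₙ vR) (.get aVal (!ₙ vR)))
      (.branch (.ltN (!ₙ vSd) (#ₙ 1)) (.storeN aIdx (!ₙ vR) (.get aOpt (!ₙ vR)))
        (.storeN aIdx (!ₙ vR) (!ₙ vN +ₙ #ₙ 1 -ₙ .get aOpt (!ₙ vR))))) .nop)

/-- The boundary vertex is the first candidate for every event. -/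
def cmdInitBest : Cmd := .forUp vR (#ₙ 1) (!ₙ vQ +ₙ #ₙ 1) (.seq
  (.storeR aBest (!ₙ vR) (.get aF (#ₙ 4 *ₙ !ₙ vB +ₙ !ₙ vT) +ᵣ
    .get aF (#ₙ 4 *ₙ (!ₙ vN +ₙ #ₙ 1 -ₙ !ₙ vB) +ₙ (#ₙ 2 +ₙ (#ₙ 1 -ₙ !ₙ vT)))))
  (.storeN aIdx (!ₙ vR) (!ₙ vB)))

/-- The events of the current boundary vertex are reported. -/
def cmdReport : Cmd := .forUp vR (#ₙ 1) (!ₙ vQ +ₙ #ₙ 1) (.block [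
  .storeN 0 (!ₙ vCnt) (!ₙ vT),
  .storeN 1 (!ₙ vCnt) (!ₙ vB),
  .storeN 2 (!ₙ vCnt) (.get aIdx (!ₙ vR)),
  .storeR 0 (!ₙ vCnt) (.get aLo (!ₙ vB) +ᵣ .get aEv (!ₙ vR)),
  .setN vCnt (!ₙ vCnt +ₙ #ₙ 1)])

/-- The events of both sides are collected. -/
def cmdCollect : Cmd := .seq (.setN vQ (#ₙ 0)) (.forUp vSd (#ₙ 0) (#ₙ 2) (.seq cmdLoad cmdEvents))

/-- The best vertices of both sides are found. -/
def cmdSearch : Cmd := .forUp vSd (#ₙ 0) (#ₙ 2) (.seq cmdLoad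
  (.branch (.ltN (#ₙ 1) (!ₙ vBb)) (.seq cmdMinima cmdImprove) .nop))

/-- All scenarios with a given type and boundary vertex. -/
def cmdVertex : Cmd := .seq cmdCollect (.seq cmdSort (.seq cmdInitBest (.seq cmdSearch cmdReport)))

/-- The auxiliary tables. -/
def cmdPrepare : Cmd := .seq (.block [.setN vN (!ₙ vCnt), .setN vCnt (#ₙ 0)])
  (.seq cmdSides (.seq cmdLog cmdTables))

/-- The program. -/
def cmdMain : Cmd := .seq cmdPrepare
  (.forUp vT (#ₙ 0) (#ₙ 2) (.forUp vB (#ₙ 1) (!ₙ vN +ₙ #ₙ 1) cmdVertex))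

end Evac

/-! ### Correctness: the tables -/

namespace RealRAM

attribute [simp] nvar_setN rvar_setN narr_setN rarr_setN nvar_setR rvar_setR narr_setR rarr_setR
  nvar_putN rvar_putN narr_putN rarr_putN nvar_putR rvar_putR narr_putR rarr_putR
  NExp.eval RExp.eval BExp.eval NExp.cost RExp.cost BExp.cost run_nop run_setN run_setR run_storeN
  run_storeR run_seq run_branch Cmd.block

end RealRAM

namespace Evac

open RealRAM

variable {n W : ℕ}

/-- The parts of the input the program never overwrites. -/
structure Input (N : PathNetwork n) (σ : State) : Prop where
  n_eq : σ.nvar vN = n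
  lo_eq : σ.rarr aLo = N.lo
  hi_eq : σ.rarr aHi = N.hi

/-- The arrays of positions and of weights on the two lines. -/
structure Sides (N : PathNetwork n) (σ : State) : Prop extends Input N σ where
  z_eq : ∀ sd < 2, ∀ i, 1 ≤ i → i ≤ n → σ.rarr aZ (2 * i + sd) = zS N sd i
  w_eq : ∀ sd < 2, ∀ κ < 2, ∀ i, 1 ≤ i → i ≤ n → σ.rarr aW (4 * i + (2 * sd + κ)) = wS N κ sd i

theorem run_cmdSides (N : PathNetwork n) {σ : State} (hW : n + 1 ≤ W) (h : Input N σ)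
    (hc : σ.rvar rCap = N.cap) (ht : σ.rvar rTau = N.tau) (hl : σ.rarr aLen = N.len) :
    Run W cmdSides σ fun τ t => Sides N τ ∧ t ≤ 100 * (n + 1) := by
  obtain ⟨hn, hlo, hhi⟩ := h
  rw [cmdSides, run_seq, run_setR]
  refine Run.forUp 1 (n + 1)
    (fun k τ => τ.rvar rAcc = N.pos k * N.tau * N.cap ∧ ∀ j, 1 ≤ j → j < k →
      τ.rarr aZ (2 * j) = N.pos j * N.tau * N.cap ∧
      τ.rarr aZ (2 * (n + 1 - j) + 1) = -(N.pos j * N.tau * N.cap) ∧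
      τ.rarr aW (4 * j) = N.lo j ∧ τ.rarr aW (4 * j + 1) = N.hi j ∧
      τ.rarr aW (4 * (n + 1 - j) + 2) = N.lo j ∧ τ.rarr aW (4 * (n + 1 - j) + 3) = N.hi j)
    (fun k _ => 80 * (n + 1 - k)) (by decide) (by simp) (by omega) hW ?_ ?_ ?_ ?_
  · refine ⟨by simp [pos_one], fun j h1 h2 => by omega⟩
  · intro τ hA
    have := hA.nvar vN (by decide)
    simp at this ⊢
    omega
  · rintro k τ hA hk h1 h2 ⟨hacc, hI⟩
    have e1 : τ.nvar vN = n := by simpa [hn] using hA.nvar vN (by decide)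
    have e2 : τ.rvar rCap = N.cap := by simpa [hc] using hA.rvar rCap (by decide)
    have e3 : τ.rvar rTau = N.tau := by simpa [ht] using hA.rvar rTau (by decide)
    have e4 : τ.rarr aLen = N.len := by simpa [hl] using hA.rarr aLen (by decide)
    have e5 : τ.rarr aLo = N.lo := by simpa [hlo] using hA.rarr aLo (by decide)
    have e6 : τ.rarr aHi = N.hi := by simpa [hhi] using hA.rarr aHi (by decide)
    simp [e1, e2, e3, e4, e5, e6, hk, hacc]
    refine ⟨⟨by rw [pos_succ N h1]; ring, fun j h3 h4 => ?_⟩, by omega⟩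
    simp only [Function.update_apply]
    rcases h4.lt_or_eq with h5 | rfl
    · obtain ⟨g1, g2, g3, g4, g5, g6⟩ := hI j h3 h5
      refine ⟨?_, ?_, ?_, ?_, ?_, ?_⟩ <;>
        (repeat rw [if_neg (by omega)]) <;> assumption
    · refine ⟨?_, ?_, ?_, ?_, ?_, ?_⟩ <;>
        (repeat first | rw [if_pos (by omega)] | rw [if_neg (by omega)])
  · rintro τ t hA - ⟨-, hI⟩ ht
    have e1 : τ.nvar vN = n := by simpa [hn] using hA.nvar vN (by decide)
    have e5 : τ.rarr aLo = N.lo := by simpa [hlo] using hA.rarr aLo (by decide)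
    have e6 : τ.rarr aHi = N.hi := by simpa [hhi] using hA.rarr aHi (by decide)
    refine ⟨⟨⟨e1, e5, e6⟩, ?_, ?_⟩, by simp at ht ⊢; omega⟩
    · intro sd hsd i h1 h2
      interval_cases sd
      · simpa [zS] using (hI i h1 (by omega)).1
      · have := (hI (n + 1 - i) (by omega) (by omega)).2.1
        rw [show n + 1 - (n + 1 - i) = i by omega] at this
        simpa [zS] using this
    · intro sd hsd κ hκ i h1 h2
      have g := hI i h1 (by omega)
      have g' := hI (n + 1 - i) (by omega) (by omega)
      rw [show n + 1 - (n + 1 - i) = i by omega] at g'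
      interval_cases sd <;> interval_cases κ
      · simpa [wS, mir] using g.2.2.1
      · simpa [wS, mir] using g.2.2.2.1
      · simpa [wS, mir] using g'.2.2.2.2.1
      · simpa [wS, mir] using g'.2.2.2.2.2

theorem run_cmdLog {σ : State} (hW : 8 * (n + 1) ^ 2 ≤ W) (hn : σ.nvar vN = n) :
    Run W cmdLog σ fun τ t => τ.nvar vBig = 2 ^ τ.nvar vLg ∧ 2 * (n + 1) ^ 2 < τ.nvar vBig ∧
      τ.nvar vBig ≤ 4 * (n + 1) ^ 2 ∧ t ≤ 100 * (n + 1) ^ 2 := by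
  have hpos : 1 ≤ (n + 1) ^ 2 := Nat.one_le_pow _ _ (by omega)
  simp only [cmdLog, Cmd.block, run_seq, run_setN, NExp.eval, NExp.cost]
  refine ⟨by omega, by omega, ?_⟩
  refine Run.loop (fun τ => τ.nvar vBig = 2 ^ τ.nvar vLg ∧ τ.nvar vBig ≤ 4 * (n + 1) ^ 2)
    -- the number that is doubled grows by at least one in every round
    (fun τ => 20 * (4 * (n + 1) ^ 2 - τ.nvar vBig)) ?_ ?_ ?_
  · simp; omega
  · rintro τ hA ⟨h1, h2⟩ hb
    have e1 : τ.nvar vN = n := by simpa [hn] using hA.nvar vN (by decide)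
    simp only [BExp.eval, NExp.eval, e1, not_lt, ← sq] at hb
    have h3 : τ.nvar vLg < τ.nvar vBig := by rw [h1]; exact Nat.lt_two_pow_self
    simp only [run_seq, run_setN, NExp.eval, NExp.cost, BExp.cost]
    simp
    refine ⟨by omega, by omega, ⟨by rw [h1, pow_succ]; ring, by omega⟩, by omega⟩
  · rintro τ t hA ⟨h1, h2⟩ hb ht
    have e1 : τ.nvar vN = n := by simpa [hn] using hA.nvar vN (by decide)
    simp only [BExp.eval, NExp.eval, e1, not_not, ← sq] at hb
    simp only [BExp.cost, NExp.cost] at ht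
    exact ⟨h1, hb, h2, by omega⟩

/-- Entry `(i, j)` of the tables of the combination `g` of side and kind has a place of its own. -/
theorem tableIndex_inj {m i j i' j' g g' : ℕ} (hj : j ≤ m) (hj' : j' ≤ m) (hg : g < 4)
    (hg' : g' < 4) (h : 4 * (i * (m + 1) + j) + g = 4 * (i' * (m + 1) + j') + g') :
    i = i' ∧ j = j' ∧ g = g' := by
  have h1 : g = g' := by omega
  have h2 : i * (m + 1) + j = i' * (m + 1) + j' := by omega
  have h3 : ∀ i j, j ≤ m → (i * (m + 1) + j) / (m + 1) = i := fun i j hj => by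
    rw [mul_comm, Nat.mul_add_div (by omega), Nat.div_eq_of_lt (by omega), add_zero]
  have h4 : i = i' := by rw [← h3 i j hj, h2, h3 i' j' hj']
  subst h4
  exact ⟨rfl, by omega, h1⟩

/-- The tables of side `sd` and kind `κ` are correct in row `i`. -/
structure RowOk (N : PathNetwork n) (σ : State) (sd κ i : ℕ) : Prop where
  pre_eq : σ.rarr aPre (4 * i + (2 * sd + κ)) = pre (wS N κ sd) i
  mt_eq : ∀ j, i ≤ j → j < n → σ.rarr aMT (4 * (i * (n + 1) + j) + (2 * sd + κ)) =
    mx (off (zS N sd) (wS N κ sd)) i (j + 1)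
  qt_eq : ∀ j, i ≤ j → j < n → σ.rarr aQT (4 * (i * (n + 1) + j) + (2 * sd + κ)) =
    ∑ l ∈ Finset.Ioc i j, wS N κ sd l * mx (off (zS N sd) (wS N κ sd)) i l
  cost_eq : σ.rarr aF (4 * i + (2 * sd + κ)) = costS N κ sd i

theorem Sides.of_agree {N : PathNetwork n} {σ τ : State} {c : Cmd} (h : Sides N σ)
    (hA : Agree c σ τ) (hN : vN ∉ c.modNVar) (hlo : aLo ∉ c.modRArr) (hhi : aHi ∉ c.modRArr)
    (hZ : aZ ∉ c.modRArr) (hw : aW ∉ c.modRArr) : Sides N τ where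
  n_eq := by rw [hA.nvar _ hN, h.n_eq]
  lo_eq := by rw [hA.rarr _ hlo, h.lo_eq]
  hi_eq := by rw [hA.rarr _ hhi, h.hi_eq]
  z_eq := by rw [hA.rarr _ hZ]; exact h.z_eq
  w_eq := by rw [hA.rarr _ hw]; exact h.w_eq

/-- The state of the computation of row `i` after column `j`; the tables were those of `σ₀` when the
row was begun. -/
structure RowInv (N : PathNetwork n) (σ₀ : State) (sd κ i j : ℕ) (σ : State) : Prop where
  m_eq : i < n → σ.rvar rM = mx (off (zS N sd) (wS N κ sd)) i j
  pre_eq : σ.rvar rT0 = pre (wS N κ sd) (j + 1)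
  q_eq : σ.rvar rQ = ∑ l ∈ Finset.Ioc i j, wS N κ sd l * mx (off (zS N sd) (wS N κ sd)) i l
  mt_eq : ∀ l, i ≤ l → l < j → σ.rarr aMT (4 * (i * (n + 1) + l) + (2 * sd + κ)) =
    mx (off (zS N sd) (wS N κ sd)) i (l + 1)
  qt_eq : ∀ l, i ≤ l → l < j → σ.rarr aQT (4 * (i * (n + 1) + l) + (2 * sd + κ)) =
    ∑ l ∈ Finset.Ioc i l, wS N κ sd l * mx (off (zS N sd) (wS N κ sd)) i l
  frame : ∀ x, (∀ j, j < n → x ≠ 4 * (i * (n + 1) + j) + (2 * sd + κ)) →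
    σ.rarr aMT x = σ₀.rarr aMT x ∧ σ.rarr aQT x = σ₀.rarr aQT x

theorem run_cmdRowInit (N : PathNetwork n) {σ : State} (h : Sides N σ) {sd κ i : ℕ}
    (hsd : sd < 2) (hκ : κ < 2) (hi : 1 ≤ i) (hin : i ≤ n) (hvsd : σ.nvar vSd = sd)
    (hvg : σ.nvar vG = 2 * sd + κ) (hvi : σ.nvar vI = i)
    (hacc : σ.rvar rAcc = pre (wS N κ sd) i) :
    Run W cmdRowInit σ fun τ t => RowInv N τ sd κ i i τ ∧
      τ.rvar rAcc = pre (wS N κ sd) (i + 1) ∧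
      τ.rarr aPre = Function.update (σ.rarr aPre) (4 * i + (2 * sd + κ)) (pre (wS N κ sd) i) ∧
      t ≤ 100 := by
  simp [cmdRowInit, hvi, hvg, hvsd, hacc, h.w_eq sd hsd κ hκ i hi hin]
  refine ⟨⟨fun hlt => ?_, ?_, ?_, fun l h1 h2 => by omega, fun l h1 h2 => by omega,
    fun x _ => ⟨rfl, rfl⟩⟩, ?_⟩
  · simp [mx_of_le, off, h.z_eq sd hsd (i + 1) (by omega) (by omega), pre_succ _ hi]
  · simp [pre_succ _ hi]
  · simp
  · rw [pre_succ _ hi]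

theorem run_cmdRowLoop (N : PathNetwork n) {σ : State} (hW : n + 1 ≤ W) (h : Sides N σ)
    {sd κ i : ℕ} (hsd : sd < 2) (hκ : κ < 2) (hi : 1 ≤ i) (hin : i ≤ n) (hvsd : σ.nvar vSd = sd)
    (hvg : σ.nvar vG = 2 * sd + κ) (hvi : σ.nvar vI = i) (hI : RowInv N σ sd κ i i σ) :
    Run W cmdRowLoop σ fun τ t => RowInv N σ sd κ i n τ ∧ t ≤ 110 * (n + 1) := by
  have hn := h.n_eq
  refine Run.forUp i n (RowInv N σ sd κ i) (fun k _ => 100 * (n - k)) (by decide) (by simp [hvi])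
    hin (by omega) ⟨hI.m_eq, hI.pre_eq, hI.q_eq, hI.mt_eq, hI.qt_eq, hI.frame⟩ ?_ ?_ ?_
  · intro τ hA
    have := hA.nvar vN (by decide)
    simpa [hn] using this
  · rintro k τ hA hk h1 h2 hinv
    have hS : Sides N τ := h.of_agree hA (by decide) (by decide) (by decide) (by decide) (by decide)
    have e1 : τ.nvar vN = n := hS.n_eq
    have e2 : τ.nvar vSd = sd := by rw [hA.nvar vSd (by decide), hvsd]
    have e3 : τ.nvar vG = 2 * sd + κ := by rw [hA.nvar vG (by decide), hvg]
    have e4 : τ.nvar vI = i := by rw [hA.nvar vI (by decide), hvi]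
    have hz := hS.z_eq sd hsd (k + 1) (by omega) (by omega)
    have hw := hS.w_eq sd hsd κ hκ (k + 1) (by omega) (by omega)
    have hA' : zS N sd (k + 1) - pre (wS N κ sd) (k + 1) =
      off (zS N sd) (wS N κ sd) (k + 1) := rfl
    have hmx := mx_succ (off (zS N sd) (wS N κ sd)) h1
    have hm := hinv.m_eq (by omega)
    have hIoc : Finset.Ioc i (k + 1) = insert (k + 1) (Finset.Ioc i k) := by
      ext; simp only [Finset.mem_Ioc, Finset.mem_insert]; omega
    -- the memory after one column, with the new running maximum
    have key : ∀ ρ : State, ρ.rarr aMT = Function.update (τ.rarr aMT)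
          (4 * (i * (n + 1) + k) + (2 * sd + κ)) (mx (off (zS N sd) (wS N κ sd)) i (k + 1)) →
        ρ.rarr aQT = Function.update (τ.rarr aQT)
          (4 * (i * (n + 1) + k) + (2 * sd + κ)) (τ.rvar rQ) →
        ρ.rvar rM = mx (off (zS N sd) (wS N κ sd)) i (k + 1) →
        ρ.rvar rT0 = pre (wS N κ sd) (k + 1) + wS N κ sd (k + 1) →
        ρ.rvar rQ = τ.rvar rQ + wS N κ sd (k + 1) * mx (off (zS N sd) (wS N κ sd)) i (k + 1) →
        RowInv N σ sd κ i (k + 1) ρ := by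
      intro ρ g1 g2 g3 g4 g5
      refine ⟨fun _ => g3, by rw [g4, ← pre_succ _ (show 1 ≤ k + 1 by omega)], ?_, ?_, ?_, ?_⟩
      · rw [g5, hinv.q_eq, hIoc, Finset.sum_insert (by simp), add_comm]
      · intro j h3 h4
        rw [g1, Function.update_apply]
        split_ifs with hj
        · rw [show j = k by omega]
        · exact hinv.mt_eq j h3 (by
            by_contra hc
            exact hj (by rw [show j = k by omega]))
      · intro j h3 h4
        rw [g2, Function.update_apply]
        split_ifs with hj
        · rw [show j = k by omega, hinv.q_eq]
        · exact hinv.qt_eq j h3 (by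
            by_contra hc
            exact hj (by rw [show j = k by omega]))
      · intro x hx'
        rw [g1, g2, Function.update_of_ne (hx' k h2), Function.update_of_ne (hx' k h2)]
        exact hinv.frame x hx'
    simp [e1, e2, e3, e4, hk, hz, hw, hinv.pre_eq, hA', hm]
    refine ⟨fun hlt => ⟨?_, by omega⟩, fun hle => ⟨?_, by omega⟩⟩
    · refine key _ ?_ ?_ ?_ ?_ ?_ <;> simp [hmx, max_eq_right hlt.le]
    · refine key _ ?_ ?_ ?_ ?_ ?_ <;> simp [hmx, max_eq_left hle, hm]
  · rintro τ t hA - hinv ht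
    exact ⟨hinv, by simp at ht ⊢; omega⟩

/-- Row `i` is computed, and the other rows are left intact. -/
theorem run_cmdRow (N : PathNetwork n) {σ : State} (hW : n + 1 ≤ W) (h : Sides N σ) {sd κ i : ℕ}
    (hsd : sd < 2) (hκ : κ < 2) (hi : 1 ≤ i) (hin : i ≤ n) (hvsd : σ.nvar vSd = sd)
    (hvg : σ.nvar vG = 2 * sd + κ) (hvi : σ.nvar vI = i)
    (hacc : σ.rvar rAcc = pre (wS N κ sd) i) :
    Run W (.block [cmdRowInit, cmdRowLoop, cmdRowEnd]) σ fun τ t =>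
      τ.rvar rAcc = pre (wS N κ sd) (i + 1) ∧ RowOk N τ sd κ i ∧
      (∀ sd' < 2, ∀ κ' < 2, ∀ i', RowOk N σ sd' κ' i' → ¬ (sd' = sd ∧ κ' = κ ∧ i' = i) →
        RowOk N τ sd' κ' i') ∧ t ≤ 300 * (n + 1) := by
  refine Run.seq (run_cmdRowInit N h hsd hκ hi hin hvsd hvg hvi hacc) ?_
  rintro τ1 t1 hA1 ⟨hI1, hacc1, hpre1, ht1⟩
  have hS1 : Sides N τ1 :=
    h.of_agree hA1 (by decide) (by decide) (by decide) (by decide) (by decide)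
  refine Run.seq (run_cmdRowLoop N hW hS1 hsd hκ hi hin (by rw [hA1.nvar _ (by decide), hvsd])
    (by rw [hA1.nvar _ (by decide), hvg]) (by rw [hA1.nvar _ (by decide), hvi])
    ⟨hI1.m_eq, hI1.pre_eq, hI1.q_eq, hI1.mt_eq, hI1.qt_eq, fun _ _ => ⟨rfl, rfl⟩⟩) ?_
  rintro τ2 t2 hA2 ⟨hI2, ht2⟩
  have hS2 : Sides N τ2 :=
    hS1.of_agree hA2 (by decide) (by decide) (by decide) (by decide) (by decide)
  have e2 : τ2.nvar vSd = sd := by rw [hA2.nvar _ (by decide), hA1.nvar _ (by decide), hvsd]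
  have e3 : τ2.nvar vG = 2 * sd + κ := by
    rw [hA2.nvar _ (by decide), hA1.nvar _ (by decide), hvg]
  have e4 : τ2.nvar vI = i := by rw [hA2.nvar _ (by decide), hA1.nvar _ (by decide), hvi]
  have e5 : τ2.rvar rAcc = pre (wS N κ sd) (i + 1) := by rw [hA2.rvar _ (by decide), hacc1]
  have e6 : τ2.rarr aPre = Function.update (σ.rarr aPre) (4 * i + (2 * sd + κ))
      (pre (wS N κ sd) i) := by rw [hA2.rarr _ (by decide), hpre1]
  have e7 : τ2.rarr aF = σ.rarr aF := by rw [hA2.rarr _ (by decide), hA1.rarr _ (by decide)]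
  have e8 : τ1.rarr aMT = σ.rarr aMT := by rw [hA1.rarr _ (by decide)]
  have e9 : τ1.rarr aQT = σ.rarr aQT := by rw [hA1.rarr _ (by decide)]
  simp [cmdRowEnd, e2, e3, e4, e5]
  refine ⟨⟨?_, ?_, ?_, ?_⟩, ?_, by omega⟩
  · simp [e6]
  · simpa using hI2.mt_eq
  · simpa using hI2.qt_eq
  · simp [costS, cost, hI2.q_eq, hI2.pre_eq, hS2.z_eq sd hsd i hi hin, pre_add_Ioc _ hin]
    ring
  · intro sd' hsd' κ' hκ' i' hok hne
    have hne' : ∀ j', j' < n → ∀ j, j < n → 4 * (i' * (n + 1) + j') + (2 * sd' + κ') ≠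
        4 * (i * (n + 1) + j) + (2 * sd + κ) := by
      intro j' h1 j h2 heq
      obtain ⟨h3, -, h4⟩ := tableIndex_inj (by omega) (by omega) (by omega) (by omega) heq
      exact hne (by omega) (by omega) h3
    have hne'' : 4 * i' + (2 * sd' + κ') ≠ 4 * i + (2 * sd + κ) := by omega
    refine ⟨?_, ?_, ?_, ?_⟩
    · simp [e6, Function.update_of_ne hne'', hok.pre_eq]
    · intro j h1 h2
      have := (hI2.frame _ (hne' j h2)).1
      simp [this, e8, hok.mt_eq j h1 h2]
    · intro j h1 h2
      have := (hI2.frame _ (hne' j h2)).2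
      simp [this, e9, hok.qt_eq j h1 h2]
    · simp [e7, Function.update_of_ne hne'', hok.cost_eq]

/-- The memory after the preparation. -/
structure Prepared (N : PathNetwork n) (σ : State) : Prop extends Sides N σ where
  big_eq : σ.nvar vBig = 2 ^ σ.nvar vLg
  big_gt : 2 * (n + 1) ^ 2 < σ.nvar vBig
  big_le : σ.nvar vBig ≤ 4 * (n + 1) ^ 2
  row : ∀ sd < 2, ∀ κ < 2, ∀ i, 1 ≤ i → i ≤ n → RowOk N σ sd κ i

theorem RowOk.of_eq {N : PathNetwork n} {σ τ : State} {sd κ i : ℕ} (h : RowOk N σ sd κ i)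
    (h1 : τ.rarr aPre = σ.rarr aPre) (h2 : τ.rarr aMT = σ.rarr aMT)
    (h3 : τ.rarr aQT = σ.rarr aQT) (h4 : τ.rarr aF = σ.rarr aF) : RowOk N τ sd κ i :=
  ⟨by rw [h1, h.pre_eq], by rw [h2]; exact h.mt_eq, by rw [h3]; exact h.qt_eq,
    by rw [h4, h.cost_eq]⟩

/-- All rows up to row `i` (exclusive) of the given side and kind are correct, and so are the
tables of the preceding sides and kinds. -/
def RowsOk (N : PathNetwork n) (sd κ i : ℕ) (σ : State) : Prop :=
  ∀ sd' < 2, ∀ κ' < 2, ∀ i', 1 ≤ i' → i' ≤ n →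
    2 * sd' + κ' < 2 * sd + κ ∨ (sd' = sd ∧ κ' = κ ∧ i' < i) → RowOk N σ sd' κ' i'

theorem RowsOk.of_eq {N : PathNetwork n} {σ τ : State} {sd κ i : ℕ} (h : RowsOk N sd κ i σ)
    (h1 : τ.rarr aPre = σ.rarr aPre) (h2 : τ.rarr aMT = σ.rarr aMT)
    (h3 : τ.rarr aQT = σ.rarr aQT) (h4 : τ.rarr aF = σ.rarr aF) : RowsOk N sd κ i τ :=
  fun sd' a κ' b i' c d e => (h sd' a κ' b i' c d e).of_eq h1 h2 h3 h4

theorem run_cmdTables (N : PathNetwork n) {σ : State} (hW : n + 4 ≤ W) (h : Sides N σ) :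
    Run W cmdTables σ fun τ t => (∀ sd < 2, ∀ κ < 2, ∀ i, 1 ≤ i → i ≤ n → RowOk N τ sd κ i) ∧
      t ≤ 3000 * (n + 1) ^ 2 := by
  refine Run.forUp 0 2 (fun sd τ => RowsOk N sd 0 1 τ) (fun sd _ => (2 - sd) * (1400 * (n + 1) ^ 2))
    (by decide) (by simp) (by omega) (by omega) ?_ (fun τ _ => by simp) ?_ ?_
  · intro sd' _ κ' _ i' _ _ hlt; omega
  · rintro sd τ hA hsd - hsd2 hI
    have hS : Sides N τ := h.of_agree hA (by decide) (by decide) (by decide) (by decide) (by decide)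
    refine Run.forUp 0 2 (fun κ τ => RowsOk N sd κ 1 τ)
      (fun κ _ => (2 - κ) * (600 * (n + 1) ^ 2)) (by decide) (by simp) (by omega) (by omega) ?_
      (fun τ _ => by simp) ?_ ?_
    · exact hI.of_eq rfl rfl rfl rfl
    · rintro κ τ1 hA1 hκ - hκ2 hI1
      have hS1 : Sides N τ1 :=
        hS.of_agree hA1 (by decide) (by decide) (by decide) (by decide) (by decide)
      have e1 : τ1.nvar vSd = sd := by rw [hA1.nvar _ (by decide), hsd]
      simp only [Cmd.block, run_seq, run_setN, run_setR, NExp.eval, RExp.eval, NExp.cost, RExp.cost]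
      refine ⟨by omega, ?_⟩
      refine Run.forUp 1 (n + 1) (fun i τ => RowsOk N sd κ i τ ∧
          τ.rvar rAcc = pre (wS N κ sd) i) (fun i _ => (n + 1 - i) * (400 * (n + 1)))
        (by decide) (by simp) (by omega) (by omega) ?_ ?_ ?_ ?_
      · exact ⟨hI1.of_eq rfl rfl rfl rfl, by simp [pre_one]⟩
      · intro τ2 hA2
        have := hA2.nvar vN (by decide)
        simp [hS1.n_eq] at this
        simp [this]
      · rintro i τ2 hA2 hi h1 h2 ⟨hI2, hacc⟩
        have hS2 : Sides N τ2 :=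
          Sides.of_agree (σ := (τ1.setN vG (2 * τ1.nvar vSd + τ1.nvar vK)).setR rAcc ((0 : ℕ) : ℝ))
            ⟨⟨by simp [hS1.n_eq], hS1.lo_eq, hS1.hi_eq⟩, hS1.z_eq, hS1.w_eq⟩
            hA2 (by decide) (by decide) (by decide) (by decide) (by decide)
        refine (run_cmdRow N (by omega) hS2 hsd2 hκ2 h1 (by omega)
          (by rw [hA2.nvar _ (by decide)]; simpa using e1)
          (by rw [hA2.nvar _ (by decide)]; simp [e1, hκ]) hi hacc).mono ?_
        rintro τ3 t3 hA3 ⟨hacc3, hok, hpres, ht3⟩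
        refine ⟨⟨?_, by simp [hacc3]⟩, ?_⟩
        · refine RowsOk.of_eq (σ := τ3) ?_ rfl rfl rfl rfl
          intro sd' h3 κ' h4 i' h5 h6 h7
          by_cases hc : sd' = sd ∧ κ' = κ ∧ i' = i
          · obtain ⟨rfl, rfl, rfl⟩ := hc
            exact hok
          · exact hpres sd' h3 κ' h4 i' (hI2 sd' h3 κ' h4 i' h5 h6 (by omega)) hc
        · obtain ⟨m, hm⟩ : ∃ m, n + 1 - i = m + 1 := ⟨n - i, by omega⟩
          rw [show n + 1 - (i + 1) = m by omega, hm, add_mul]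
          simp; omega
      · rintro τ2 t2 hA2 - ⟨hI2, -⟩ ht2
        refine ⟨?_, ?_⟩
        · intro sd' h3 κ' h4 i' h5 h6 h7
          exact (hI2 sd' h3 κ' h4 i' h5 h6 (by omega)).of_eq rfl rfl rfl rfl
        · obtain ⟨m, hm⟩ : ∃ m, 2 - κ = m + 1 := ⟨1 - κ, by omega⟩
          rw [show 2 - (κ + 1) = m by omega, hm, add_mul]
          simp at ht2 ⊢
          nlinarith
    · rintro τ1 t1 hA1 - hI1 ht1
      refine ⟨?_, ?_⟩
      · intro sd' h3 κ' h4 i' h5 h6 h7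
        exact (hI1 sd' h3 κ' h4 i' h5 h6 (by omega)).of_eq rfl rfl rfl rfl
      · obtain ⟨m, hm⟩ : ∃ m, 2 - sd = m + 1 := ⟨1 - sd, by omega⟩
        rw [show 2 - (sd + 1) = m by omega, hm, add_mul]
        simp at ht1 ⊢
        nlinarith
  · rintro τ t hA - hI ht
    refine ⟨fun sd h1 κ h2 i h3 h4 => hI sd h1 κ h2 i h3 h4 (by omega), ?_⟩
    simp at ht
    nlinarith

/-! ### Correctness: the records behind the boundary vertex -/

/-- The number `p` of the entries of `V` among the first `len` that are at most `t`. -/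
def IsRank (V : ℕ → ℝ) (len : ℕ) (t : ℝ) (p : ℕ) : Prop :=
  p ≤ len ∧ ∀ l < len, V l ≤ t ↔ l < p

/-- Index `m` is a strict record of `A` behind `b`. -/
def IsRecord (A : ℕ → ℝ) (b m : ℕ) : Prop := b < m ∧ ∀ l, b < l → l < m → A l < A m

/-- The records of `A` among the indices in `(b, k)` have been found. The sums `rT0` and `rT1` of
all weights, and of all weights times running maxima, are not yet stored behind the partial sums,
hence the case distinctions in `excess_eq`. -/
structure RecInv (A v : ℕ → ℝ) (b k : ℕ) (σ : State) : Prop where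
  len_le : σ.nvar vLen + (b + 1) ≤ k
  len_pos : b + 1 < k → 0 < σ.nvar vLen
  cur_eq : b + 1 < k → σ.rvar rM = mx A b (k - 1) ∧ σ.rarr aV (σ.nvar vLen - 1) = σ.rvar rM
  strict : ∀ l l', l < l' → l' < σ.nvar vLen → σ.rarr aV l < σ.rarr aV l'
  sound : ∀ l < σ.nvar vLen, ∃ m, IsRecord A b m ∧ m < k ∧ A m = σ.rarr aV l
  complete : ∀ m, IsRecord A b m → m < k → ∃ l < σ.nvar vLen, σ.rarr aV l = A m
  t0_eq : σ.rvar rT0 = ∑ j ∈ Finset.Ico (b + 1) k, v j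
  excess_eq : ∀ t p, IsRank (σ.rarr aV) (σ.nvar vLen) t p →
    ∑ j ∈ Finset.Ico (b + 1) k, v j * max 0 (mx A b j - t) =
      (σ.rvar rT1 - if p < σ.nvar vLen then σ.rarr aT1 p else σ.rvar rT1) -
      t * (σ.rvar rT0 - if p < σ.nvar vLen then σ.rarr aT0 p else σ.rvar rT0)

/-- The records behind the boundary vertex are listed, with the partial sums of the weights and of
the weights times the running maxima up to each record; the last entries of these are the totals.
The excess over `t` comes from the vertices from the first record above `t` on. -/
structure Records (n : ℕ) (A v : ℕ → ℝ) (b : ℕ) (σ : State) : Prop where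
  len_le : σ.nvar vLen ≤ n
  strict : ∀ l l', l < l' → l' < σ.nvar vLen → σ.rarr aV l < σ.rarr aV l'
  sound : ∀ l < σ.nvar vLen, ∃ m, IsRecord A b m ∧ m ≤ n ∧ A m = σ.rarr aV l
  complete : ∀ m, IsRecord A b m → m ≤ n → ∃ l < σ.nvar vLen, σ.rarr aV l = A m
  t0_eq : σ.rvar rT0 = ∑ j ∈ Finset.Ioc b n, v j
  excess_eq : ∀ t p, IsRank (σ.rarr aV) (σ.nvar vLen) t p →
    excess n A v b t =
      (σ.rarr aT1 (σ.nvar vLen) - σ.rarr aT1 p) - t * (σ.rarr aT0 (σ.nvar vLen) - σ.rarr aT0 p)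

/-- An index that is not a record extends the current cluster. -/
theorem RecInv.extend {A v : ℕ → ℝ} {b k : ℕ} {σ τ : State} (h : RecInv A v b k σ)
    (hbk : b + 1 < k) (hle : A k ≤ σ.rvar rM) (h1 : τ.nvar vLen = σ.nvar vLen)
    (h2 : τ.rvar rM = σ.rvar rM) (h3 : τ.rarr aV = σ.rarr aV) (h4 : τ.rarr aT0 = σ.rarr aT0)
    (h5 : τ.rarr aT1 = σ.rarr aT1) (h6 : τ.rvar rT1 = σ.rvar rT1 + v k * σ.rvar rM)
    (h7 : τ.rvar rT0 = σ.rvar rT0 + v k) : RecInv A v b (k + 1) τ := by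
  obtain ⟨hc1, hc2⟩ := h.cur_eq hbk
  have hlen := h.len_pos hbk
  have hmx : mx A b k = σ.rvar rM := by
    obtain ⟨m, rfl⟩ : ∃ m, k = m + 1 := ⟨k - 1, by omega⟩
    rw [mx_succ A (by omega), max_eq_left]
    · rw [hc1, Nat.add_sub_cancel]
    · rw [Nat.add_sub_cancel] at hc1
      rw [← hc1]; exact hle
  constructor
  · rw [h1]; have := h.len_le; omega
  · intro _; rw [h1]; exact hlen
  · intro _; rw [h1, h2, h3, Nat.add_sub_cancel, hmx]; exact ⟨rfl, hc2⟩
  · rw [h1, h3]; exact h.strict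
  · rw [h1, h3]
    intro l hl
    obtain ⟨m, g1, g2, g3⟩ := h.sound l hl
    exact ⟨m, g1, by omega, g3⟩
  · rw [h1, h3]
    intro m hm hmk
    rcases Nat.lt_or_ge m k with hlt | hge
    · exact h.complete m hm hlt
    · exfalso
      obtain rfl : m = k := by omega
      obtain ⟨l, g1, g2, g3, -⟩ := exists_mx A (show b < m - 1 by omega)
      have := hm.2 l g1 (by omega)
      rw [g3, ← hc1] at this
      linarith
  · rw [h7, h.t0_eq, Finset.sum_Ico_succ_top (by omega)]
  · rw [h1, h3, h4, h5, h6, h7]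
    intro t p hp
    rw [Finset.sum_Ico_succ_top (by omega), h.excess_eq t p hp, hmx]
    have hlast := hp.2 (σ.nvar vLen - 1) (by omega)
    rw [hc2] at hlast
    split_ifs with hlt
    · rw [max_eq_right]
      · ring
      · by_contra hc
        have := hlast.1 (by linarith)
        omega
    · rw [max_eq_left]
      · ring
      · have := hlast.2 (by omega)
        linarith

/-- A new record opens a new cluster. -/
theorem RecInv.new {A v : ℕ → ℝ} {b k : ℕ} {σ τ : State} (h : RecInv A v b k σ)
    (hbk : b + 1 ≤ k) (hlt : b + 1 < k → σ.rvar rM < A k) (h1 : τ.nvar vLen = σ.nvar vLen + 1)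
    (h2 : τ.rvar rM = A k) (h3 : τ.rarr aV = Function.update (σ.rarr aV) (σ.nvar vLen) (A k))
    (h4 : τ.rarr aT0 = Function.update (σ.rarr aT0) (σ.nvar vLen) (σ.rvar rT0))
    (h5 : τ.rarr aT1 = Function.update (σ.rarr aT1) (σ.nvar vLen) (σ.rvar rT1))
    (h6 : τ.rvar rT1 = σ.rvar rT1 + v k * A k)
    (h7 : τ.rvar rT0 = σ.rvar rT0 + v k) : RecInv A v b (k + 1) τ := by
  have hmx : mx A b k = A k := by
    rcases hbk.eq_or_lt with he | hlt'
    · rw [← he, mx_succ A le_rfl, mx_of_le A le_rfl, max_self]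
    · have := (h.cur_eq hlt').1
      obtain ⟨m, rfl⟩ : ∃ m, k = m + 1 := ⟨k - 1, by omega⟩
      rw [Nat.add_sub_cancel] at this
      rw [mx_succ A (by omega), max_eq_right]
      rw [← this]; exact (hlt hlt').le
  have hrec : IsRecord A b k := by
    refine ⟨by omega, fun l g1 g2 => ?_⟩
    have := hlt (by omega)
    rw [(h.cur_eq (by omega)).1] at this
    exact (le_mx A g1 (by omega)).trans_lt this
  have hVlt : ∀ l < σ.nvar vLen, σ.rarr aV l < A k := by
    intro l hl
    have hbk' : b + 1 < k := by have := h.len_le; omega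
    have g := (h.cur_eq hbk').2
    have g' := hlt hbk'
    rcases Nat.lt_or_ge l (σ.nvar vLen - 1) with hl' | hl'
    · have := h.strict l _ hl' (by omega)
      linarith
    · rw [show l = σ.nvar vLen - 1 by omega]; linarith
  have hV : ∀ l < σ.nvar vLen, τ.rarr aV l = σ.rarr aV l := fun l hl => by
    rw [h3, Function.update_of_ne (by omega)]
  have hVn : τ.rarr aV (σ.nvar vLen) = A k := by rw [h3, Function.update_self]
  constructor
  · rw [h1]; have := h.len_le; omega
  · intro _; rw [h1]; omega
  · intro _; rw [h1, h2, Nat.add_sub_cancel, Nat.add_sub_cancel, hmx, hVn]; exact ⟨rfl, rfl⟩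
  · rw [h1]
    intro l l' g1 g2
    rcases Nat.lt_or_ge l' (σ.nvar vLen) with hl | hl
    · rw [hV l (by omega), hV l' hl]; exact h.strict l l' g1 hl
    · rw [show l' = σ.nvar vLen by omega, hVn, hV l (by omega)]
      exact hVlt l (by omega)
  · rw [h1]
    intro l hl
    rcases Nat.lt_or_ge l (σ.nvar vLen) with hl | hl
    · rw [hV l hl]
      obtain ⟨m, g1, g2, g3⟩ := h.sound l hl
      exact ⟨m, g1, by omega, g3⟩
    · rw [show l = σ.nvar vLen by omega, hVn]
      exact ⟨k, hrec, by omega, rfl⟩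
  · rw [h1]
    intro m hm hmk
    rcases Nat.lt_or_ge m k with hlt | hge
    · obtain ⟨l, g1, g2⟩ := h.complete m hm hlt
      exact ⟨l, by omega, by rw [hV l g1, g2]⟩
    · exact ⟨σ.nvar vLen, by omega, by rw [hVn, show m = k by omega]⟩
  · rw [h7, h.t0_eq, Finset.sum_Ico_succ_top (by omega)]
  · rw [h1]
    intro t p hp
    rw [Finset.sum_Ico_succ_top (by omega), hmx]
    have hlast := hp.2 (σ.nvar vLen) (by omega)
    rw [hVn] at hlast
    have hp' := hp.1
    have hIH : ∀ q, q ≤ σ.nvar vLen → (∀ l < σ.nvar vLen, l < q ↔ l < p) →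
        IsRank (σ.rarr aV) (σ.nvar vLen) t q := by
      intro q hq hq'
      refine ⟨hq, fun l hl => ?_⟩
      rw [← hV l hl, hp.2 l (by omega), hq' l hl]
    rcases Nat.lt_or_ge (σ.nvar vLen) p with hc | hc
    · -- the new record is at most `t`, hence so are all records
      have := h.excess_eq t (σ.nvar vLen) (hIH _ le_rfl fun l hl => by omega)
      rw [if_neg (lt_irrefl _), if_neg (lt_irrefl _)] at this
      rw [this, if_neg (by omega), if_neg (by omega), max_eq_left (by linarith [hlast.2 hc])]
      ring
    · have ht : t < A k := not_le.1 fun hle => absurd (hlast.1 hle) (by omega)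
      have := h.excess_eq t p (hIH p hc fun l hl => Iff.rfl)
      rw [this, if_pos (show p < σ.nvar vLen + 1 by omega),
        if_pos (show p < σ.nvar vLen + 1 by omega), max_eq_right (by linarith), h4, h5, h6, h7]
      rcases hc.lt_or_eq with hc' | rfl
      · rw [if_pos hc', if_pos hc', Function.update_of_ne (by omega),
          Function.update_of_ne (by omega)]
        ring
      · rw [if_neg (lt_irrefl _), if_neg (lt_irrefl _), Function.update_self,
          Function.update_self]
        ring

theorem run_cmdRecords (N : PathNetwork n) {σ : State} (hW : n + 1 ≤ W) (h : Sides N σ)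
    {sd κ b : ℕ} (hsd : sd < 2) (hκ : κ < 2) (hb : 1 ≤ b) (hbn : b ≤ n) (hvsd : σ.nvar vSd = sd)
    (hvκ : σ.nvar vK = κ) (hvb : σ.nvar vBb = b) {A : ℕ → ℝ}
    (hA : ∀ k, b < k → k ≤ n →
      A k = zS N sd k - (σ.rvar rBase + ∑ j ∈ Finset.Ico (b + 1) k, wS N (1 - κ) sd j)) :
    Run W cmdRecords σ fun τ t => Records n A (wS N (1 - κ) sd) b τ ∧ t ≤ 200 * (n + 1) := by
  set v := wS N (1 - κ) sd with hv
  simp only [cmdRecords, Cmd.block, run_seq, run_setN, run_setR, NExp.eval, RExp.eval, NExp.cost,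
    RExp.cost]
  refine ⟨by omega, ?_⟩
  refine Run.forUp (b + 1) (n + 1) (RecInv A v b) (fun k _ => 120 * (n + 1 - k)) (by decide)
    (by simp [hvb]) (by omega) (by omega) ?_ ?_ ?_ ?_
  · constructor <;> simp [IsRank]
    · intro m hm; have := hm.1; omega
  · intro τ hA
    have := hA.nvar vN (by decide)
    simp [h.n_eq] at this
    simp [this]
  · rintro k τ hAg hk h1 h2 hinv
    have hS : Sides N τ :=
      Sides.of_agree (σ := ((σ.setN vLen 0).setR rT0 ((0 : ℕ) : ℝ)).setR rT1 ((0 : ℕ) : ℝ))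
        ⟨⟨by simp [h.n_eq], h.lo_eq, h.hi_eq⟩, h.z_eq, h.w_eq⟩ hAg
        (by decide) (by decide) (by decide) (by decide) (by decide)
    have e1 : τ.nvar vSd = sd := by rw [hAg.nvar _ (by decide)]; simpa using hvsd
    have e2 : τ.nvar vK = κ := by rw [hAg.nvar _ (by decide)]; simpa using hvκ
    have e3 : τ.rvar rBase = σ.rvar rBase := by rw [hAg.rvar _ (by decide)]; simp
    have hz := hS.z_eq sd hsd k (by omega) (by omega)
    have hw := hS.w_eq sd hsd (1 - κ) (by omega) k (by omega) (by omega)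
    have hAk : zS N sd k - (σ.rvar rBase + ∑ j ∈ Finset.Ico (b + 1) k, v j) = A k :=
      (hA k (by omega) (by omega)).symm
    have hlen := hinv.len_le
    simp [e1, e2, e3, hk, hz, hw, ← hv, hinv.t0_eq, hAk]
    refine ⟨fun hc => ⟨by omega, ?_, by omega⟩, fun h0 hle => ⟨?_, by omega⟩⟩
    · refine hinv.new h1 (fun hbk => hc (by have := hinv.len_pos hbk; omega)) ?_ ?_ ?_ ?_ ?_ ?_ ?_
        <;> simp [hinv.t0_eq]
    · have : b + 1 < k := by
        by_contra hc
        omega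
      refine hinv.extend this hle ?_ ?_ ?_ ?_ ?_ ?_ ?_ <;> simp [hinv.t0_eq]
  · rintro τ t hAg - hinv ht
    have hI : Finset.Ioc b n = Finset.Ico (b + 1) (n + 1) := by
      ext; simp only [Finset.mem_Ioc, Finset.mem_Ico]; omega
    simp only [run_storeR, NExp.eval, RExp.eval, NExp.cost, RExp.cost]
    simp at ht
    refine ⟨?_, by simp; omega⟩
    have hlen := hinv.len_le
    constructor
    · simp; omega
    · simpa using hinv.strict
    · intro l hl
      obtain ⟨m, g1, g2, g3⟩ := hinv.sound l (by simpa using hl)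
      exact ⟨m, g1, by omega, by simpa using g3⟩
    · intro m g1 g2
      simpa using hinv.complete m g1 (by omega)
    · simpa [hI] using hinv.t0_eq
    · intro t p hp
      have hp' : IsRank (τ.rarr aV) (τ.nvar vLen) t p := by simpa using hp
      rw [excess, hI, hinv.excess_eq t p hp']
      simp [Function.update_apply]
      split_ifs with g1 g2 g3
      · omega
      · rfl
      · rw [hinv.t0_eq]
      · exact absurd hp'.1 (by omega)

/-! ### Correctness: the data of a side and its events -/

theorem Prepared.of_agree {N : PathNetwork n} {σ τ : State} {c : Cmd} (h : Prepared N σ)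
    (hA : Agree c σ τ) (h1 : ∀ x ∈ [vN, vLg, vBig], x ∉ c.modNVar)
    (h2 : ∀ x ∈ [aLo, aHi, aZ, aW, aPre, aMT, aQT, aF], x ∉ c.modRArr) : Prepared N τ := by
  have hS : Sides N τ := h.toSides.of_agree hA (h1 _ (by simp)) (h2 _ (by simp)) (h2 _ (by simp))
    (h2 _ (by simp)) (h2 _ (by simp))
  refine ⟨hS, ?_, ?_, ?_, ?_⟩
  · rw [hA.nvar _ (h1 vBig (by simp)), hA.nvar _ (h1 vLg (by simp)), h.big_eq]
  · rw [hA.nvar _ (h1 vBig (by simp))]; exact h.big_gt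
  · rw [hA.nvar _ (h1 vBig (by simp))]; exact h.big_le
  · intro sd a κ b' i c' d
    exact (h.row sd a κ b' i c' d).of_eq (hA.rarr _ (h2 aPre (by simp)))
      (hA.rarr _ (h2 aMT (by simp))) (hA.rarr _ (h2 aQT (by simp))) (hA.rarr _ (h2 aF (by simp)))

theorem Records.of_eq {A v : ℕ → ℝ} {b : ℕ} {σ τ : State} (h : Records n A v b σ)
    (h1 : τ.nvar vLen = σ.nvar vLen) (h2 : τ.rarr aV = σ.rarr aV) (h3 : τ.rarr aT0 = σ.rarr aT0)
    (h4 : τ.rarr aT1 = σ.rarr aT1) (h5 : τ.rvar rT0 = σ.rvar rT0) : Records n A v b τ := by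
  constructor
  · rw [h1]; exact h.len_le
  · rw [h1, h2]; exact h.strict
  · rw [h1, h2]; exact h.sound
  · rw [h1, h2]; exact h.complete
  · rw [h5]; exact h.t0_eq
  · rw [h1, h2, h3, h4]; exact h.excess_eq

/-- The aggregate time at vertex `i` in terms of the data kept in the working arrays. -/
def PhiOk (N : PathNetwork n) (T sd b i : ℕ) (σ : State) : Prop :=
  σ.rarr aM i = mx (offS N T sd b) i (mir n sd b) ∧
  ∀ δ, phiS N T sd b i δ = σ.rarr aC i + δ * σ.rarr aM i +
    excess n (offS N T sd b) (wS N (1 - kap T sd) sd) (mir n sd b) (σ.rarr aM i + δ) +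
    (σ.rarr aU i + δ) * (σ.rarr aU i + δ) / 2 - σ.rarr aD i * (σ.rarr aU i + δ)

/-- The working arrays hold the data of side `sd` for the boundary vertex `v_b`. -/
structure Loaded (N : PathNetwork n) (T sd b : ℕ) (σ : State) : Prop where
  bb_eq : σ.nvar vBb = mir n sd b
  records : Records n (offS N T sd b) (wS N (1 - kap T sd) sd) (mir n sd b) σ
  phi : ∀ i, 1 ≤ i → i < mir n sd b → PhiOk N T sd b i σ

theorem Loaded.of_agree {N : PathNetwork n} {T sd b : ℕ} {σ τ : State} {c : Cmd}
    (h : Loaded N T sd b σ) (hA : Agree c σ τ) (h1 : ∀ x ∈ [vBb, vLen], x ∉ c.modNVar)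
    (h2 : rT0 ∉ c.modRVar) (h3 : ∀ x ∈ [aV, aT0, aT1, aM, aC, aD, aU], x ∉ c.modRArr) :
    Loaded N T sd b τ := by
  refine ⟨?_, h.records.of_eq (hA.nvar _ (h1 vLen (by simp))) (hA.rarr _ (h3 aV (by simp)))
    (hA.rarr _ (h3 aT0 (by simp))) (hA.rarr _ (h3 aT1 (by simp))) (hA.rvar _ h2), ?_⟩
  · rw [hA.nvar _ (h1 vBb (by simp)), h.bb_eq]
  · intro i g1 g2
    rw [PhiOk, hA.rarr _ (h3 aM (by simp)), hA.rarr _ (h3 aC (by simp)),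
      hA.rarr _ (h3 aD (by simp)), hA.rarr _ (h3 aU (by simp))]
    exact h.phi i g1 g2

theorem kap_lt (T sd : ℕ) : kap T sd < 2 := by unfold kap; split_ifs <;> omega

theorem run_cmdLoadInit (N : PathNetwork n) {σ : State} (hW : n + 4 ≤ W) (h : Prepared N σ)
    {T sd b : ℕ} (hsd : sd < 2) (hb : 1 ≤ b ∧ b ≤ n) (hvT : σ.nvar vT = T)
    (hvsd : σ.nvar vSd = sd) (hvb : σ.nvar vB = b) :
    Run W cmdLoadInit σ fun τ t => τ.nvar vBb = mir n sd b ∧ τ.nvar vK = kap T sd ∧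
      τ.nvar vG = 2 * sd + kap T sd ∧
      τ.rvar rBase = pre (wS N (kap T sd) sd) (mir n sd b) + N.lo b ∧ t ≤ 60 := by
  have hm := mir_mem (sd := sd) hb.1 hb.2
  have h0 := (h.row sd hsd _ (kap_lt T sd) _ hm.1 hm.2).pre_eq
  have hbb : ∀ x, x = mir n sd b ↔ x = if sd < 1 then b else n + 1 - b := by
    intro x; unfold mir; split_ifs <;> omega
  have hκ : ∀ x, x = kap T sd ↔ x = if sd = T then 1 else 0 := fun x => Iff.rfl
  obtain ⟨m, hm'⟩ : ∃ m, m = mir n sd b := ⟨_, rfl⟩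
  obtain ⟨κ, hκ'⟩ : ∃ κ, κ = kap T sd := ⟨_, rfl⟩
  rw [← hm', ← hκ'] at h0 ⊢
  rw [hbb] at hm'
  rw [hκ] at hκ'
  -- the four cases are the outcomes of the two tests of the program
  by_cases hs : sd = 0 <;> by_cases hT : sd = T
  · rw [if_pos (by omega)] at hm'
    rw [if_pos hT] at hκ'
    subst hm' hκ' hs hT
    simp at h0
    simp [cmdLoadInit, hvT, hvsd, hvb, h.n_eq, h.lo_eq, h0]
    omega
  · rw [if_pos (by omega)] at hm'
    rw [if_neg hT] at hκ'
    subst hm' hκ' hs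
    simp at h0
    simp [cmdLoadInit, hvT, hvsd, hvb, h.n_eq, h.lo_eq, h0]
    omega
  · rw [if_neg (by omega)] at hm'
    rw [if_pos hT] at hκ'
    obtain rfl : sd = 1 := by omega
    subst hm' hκ' hT
    simp at h0
    simp [cmdLoadInit, hvT, hvsd, hvb, h.n_eq, h.lo_eq, h0]
    omega
  · rw [if_neg (by omega)] at hm'
    rw [if_neg hT] at hκ'
    obtain rfl : sd = 1 := by omega
    subst hm' hκ'
    simp at h0
    simp [cmdLoadInit, hvT, hvsd, hvb, h.n_eq, h.lo_eq, h0]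
    omega

theorem run_cmdLoadArrays (N : PathNetwork n) {σ : State} (hW : n + 4 ≤ W) (h : Prepared N σ)
    {T sd b : ℕ} (hsd : sd < 2) (hb : 1 ≤ b ∧ b ≤ n)
    (hvsd : σ.nvar vSd = sd) (hvb : σ.nvar vB = b) (hvbb : σ.nvar vBb = mir n sd b)
    (hvκ : σ.nvar vK = kap T sd) (hvg : σ.nvar vG = 2 * sd + kap T sd)
    (hbase : σ.rvar rBase = pre (wS N (kap T sd) sd) (mir n sd b) + N.lo b)
    (hrec : Records n (offS N T sd b) (wS N (1 - kap T sd) sd) (mir n sd b) σ) :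
    Run W cmdLoadArrays σ fun τ t => Loaded N T sd b τ ∧ t ≤ 110 * (n + 1) := by
  have hm := mir_mem (sd := sd) hb.1 hb.2
  have hκ := kap_lt T sd
  refine Run.forUp 1 (mir n sd b) (fun k τ => ∀ i, 1 ≤ i → i < k → PhiOk N T sd b i τ)
    (fun k _ => 100 * (mir n sd b - k)) (by decide) (by simp) hm.1 (by omega)
    (fun i h1 h2 => by omega) ?_ ?_ ?_
  · intro τ hA
    simpa [hvbb] using hA.nvar vBb (by decide)
  · intro k τ hA hk h1 h2 hI
    have hP : Prepared N τ := h.of_agree hA (by decide) (by decide)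
    have e1 : τ.nvar vSd = sd := by rw [hA.nvar _ (by decide), hvsd]
    have e2 : τ.nvar vB = b := by rw [hA.nvar _ (by decide), hvb]
    have e3 : τ.nvar vBb = mir n sd b := by rw [hA.nvar _ (by decide), hvbb]
    have e4 : τ.nvar vK = kap T sd := by rw [hA.nvar _ (by decide), hvκ]
    have e5 : τ.nvar vG = 2 * sd + kap T sd := by rw [hA.nvar _ (by decide), hvg]
    have e6 : τ.rvar rBase = pre (wS N (kap T sd) sd) (mir n sd b) + N.lo b := by
      rw [hA.rvar _ (by decide), hbase]
    have e7 : τ.rvar rT0 = ∑ j ∈ Finset.Ioc (mir n sd b) n, wS N (1 - kap T sd) sd j := by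
      rw [hA.rvar _ (by decide), hrec.t0_eq]
    have hrow := hP.row sd hsd _ hκ k h1 (by omega)
    have hmt := hrow.mt_eq (mir n sd b - 1) (by omega) (by omega)
    have hqt := hrow.qt_eq (mir n sd b - 1) (by omega) (by omega)
    rw [Nat.sub_add_cancel hm.1] at hmt
    have hpre := (hP.row sd hsd _ hκ (k + 1) (by omega) (by omega)).pre_eq
    have hF := (hP.row (1 - sd) (by omega) _ hκ (n + 1 - k) (by omega) (by omega)).cost_eq
    have hz := hP.z_eq sd hsd k h1 (by omega)
    have hlo := hP.lo_eq
    have hn := hP.n_eq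
    simp only [Cmd.block, run_seq, run_storeR, NExp.eval, RExp.eval, NExp.cost, RExp.cost]
    refine ⟨?_, by simp; omega⟩
    intro i g1 g2
    rcases Nat.lt_or_ge i k with hlt | hge
    · obtain ⟨g3, g4⟩ := hI i g1 hlt
      have hne : i ≠ k := by omega
      constructor
      · simp [hk, hne, g3]
      · intro δ
        rw [g4 δ]
        simp [hk, hne]
    · obtain rfl : i = k := by omega
      constructor
      · simp [hk, hmt, e3, e5, hn, offS, mixS, mx_mixw_of_le h2 le_rfl]
      · intro δ
        rw [phiS, mixS, cost_mixw hm.1 hm.2 h2]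
        simp [hk, hmt, hqt, hpre, hF, hz, hlo, hn, e1, e2, e3, e4, e5, e6, e7, offS, mixS]
        ring
  · intro τ t hA hk hI ht
    refine ⟨⟨?_, ?_, hI⟩, by simp at ht; omega⟩
    · rw [hA.nvar _ (by decide), hvbb]
    · exact hrec.of_eq (hA.nvar _ (by decide)) (hA.rarr _ (by decide)) (hA.rarr _ (by decide))
        (hA.rarr _ (by decide)) (hA.rvar _ (by decide))

theorem run_cmdLoad (N : PathNetwork n) {σ : State} (hW : n + 4 ≤ W) (h : Prepared N σ)
    {T sd b : ℕ} (hsd : sd < 2) (hb : 1 ≤ b ∧ b ≤ n) (hvT : σ.nvar vT = T)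
    (hvsd : σ.nvar vSd = sd) (hvb : σ.nvar vB = b) :
    Run W cmdLoad σ fun τ t => Loaded N T sd b τ ∧ t ≤ 400 * (n + 1) := by
  have hm := mir_mem (sd := sd) hb.1 hb.2
  refine Run.seq (run_cmdLoadInit N hW h hsd hb hvT hvsd hvb) ?_
  rintro τ t hA ⟨h1, h2, h3, h4, ht⟩
  have hP : Prepared N τ := h.of_agree hA (by decide) (by decide)
  refine Run.seq (run_cmdRecords N (by omega) hP.toSides hsd (kap_lt T sd) hm.1 hm.2
    (by rw [hA.nvar _ (by decide), hvsd]) h2 h1 (A := offS N T sd b) ?_) ?_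
  · intro k g1 g2
    obtain ⟨m, rfl⟩ : ∃ m, k = m + 1 := ⟨k - 1, by omega⟩
    have hI : Finset.Ioc (mir n sd b) m = Finset.Ico (mir n sd b + 1) (m + 1) := by
      ext; simp only [Finset.mem_Ioc, Finset.mem_Ico]; omega
    rw [offS, off, mixS, pre_mixw_of_gt hm.1 (by omega), h4, hI]
  · rintro τ' t' hA' ⟨hrec, ht'⟩
    have hP' : Prepared N τ' := hP.of_agree hA' (by decide) (by decide)
    refine (run_cmdLoadArrays N hW hP' hsd hb
      (by rw [hA'.nvar _ (by decide), hA.nvar _ (by decide), hvsd])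
      (by rw [hA'.nvar _ (by decide), hA.nvar _ (by decide), hvb])
      (by rw [hA'.nvar _ (by decide), h1]) (by rw [hA'.nvar _ (by decide), h2])
      (by rw [hA'.nvar _ (by decide), h3]) (by rw [hA'.rvar _ (by decide), h4]) hrec).mono ?_
    rintro τ'' t'' - ⟨hL, ht''⟩
    exact ⟨hL, by omega⟩

/-- The pointer, which is not below the number of records up to `t`, moves down to it. The steps are
paid for by the decrease of the pointer. -/
theorem run_cmdDown {σ : State} {x : RExp} {V : ℕ → ℝ} {len : ℕ} {t : ℝ}
    (hx : ∀ τ, Agree (cmdDown x) σ τ → x.eval τ = t) (hV : σ.rarr aV = V)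
    (hs : ∀ l l', l < l' → l' < len → V l < V l') (hp : σ.nvar vP ≤ len) (hW : len ≤ W)
    (hab : ∀ l < len, σ.nvar vP ≤ l → t < V l) :
    Run W (cmdDown x) σ fun τ s => IsRank V len t (τ.nvar vP) ∧
      s + (x.cost + 13) * τ.nvar vP ≤ (x.cost + 13) * σ.nvar vP + (x.cost + 9) := by
  have hsub : ∀ τ, Agree (.setN vP (!ₙ vP -ₙ #ₙ 1)) σ τ → Agree (cmdDown x) σ τ := fun τ hA =>
    hA.of_subset (List.Subset.refl _) (List.Subset.refl _) (List.Subset.refl _) (List.Subset.refl _)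
  refine Run.loop (fun τ => τ.nvar vP ≤ len ∧ ∀ l < len, τ.nvar vP ≤ l → t < V l)
    (fun τ => (x.cost + 13) * τ.nvar vP) ⟨hp, hab⟩ ?_ ?_
  · rintro τ hA ⟨h1, h2⟩ hb
    have e1 : τ.rarr aV = V := by rw [hA.rarr _ (by simp [Cmd.modRArr]), hV]
    simp only [BExp.eval, NExp.eval, RExp.eval, hx τ (hsub τ hA), e1] at hb
    obtain ⟨q, hq⟩ : ∃ q, τ.nvar vP = q + 1 := ⟨τ.nvar vP - 1, by omega⟩
    simp [hq] at hb
    simp [hq]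
    refine ⟨by omega, ⟨by omega, fun l h3 h4 => ?_⟩, ?_⟩
    · rcases h4.eq_or_lt with rfl | h4
      · exact hb
      · exact h2 l h3 (by omega)
    · rw [mul_add]; omega
  · rintro τ s hA ⟨h1, h2⟩ hb hs'
    have e1 : τ.rarr aV = V := by rw [hA.rarr _ (by simp [Cmd.modRArr]), hV]
    simp only [BExp.eval, NExp.eval, RExp.eval, hx τ (hsub τ hA), e1, not_and, not_lt] at hb
    refine ⟨⟨h1, fun l hl => ⟨fun hle => ?_, fun hlt => ?_⟩⟩, by simp at hs'; omega⟩
    · by_contra hc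
      linarith [h2 l hl (by omega)]
    · have := hb (by omega)
      rcases Nat.lt_or_ge l (τ.nvar vP - 1) with h3 | h3
      · linarith [hs l _ h3 (by omega)]
      · rwa [show l = τ.nvar vP - 1 by omega]

/-- The records from place `p` on are appended, reduced by `M`, as long as they exceed `M` by at
most `D`. -/
theorem run_cmdAppend {σ : State} {V : ℕ → ℝ} {len p q : ℕ} {M D : ℝ} (hV : σ.rarr aV = V)
    (hM : σ.rarr aM (σ.nvar vI) = M) (hD : σ.rvar rD = D) (hlen : σ.nvar vLen = len)
    (hL : σ.nvar vL = p) (hq : σ.nvar vQ = q) (hp : p ≤ len) (hlW : len ≤ W)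
    (hW : ∀ L ≤ len, (∀ l, p ≤ l → l < L → V l - M ≤ D) → q + (L - p) ≤ W) :
    Run W cmdAppend σ fun τ t => ∃ L, p ≤ L ∧ L ≤ len ∧ (∀ l, p ≤ l → l < L → V l - M ≤ D) ∧
      (L < len → D < V L - M) ∧ τ.nvar vQ = q + (L - p) ∧
      (∀ r ≤ q, τ.rarr aEv r = σ.rarr aEv r) ∧
      (∀ l, p ≤ l → l < L → τ.rarr aEv (q + 1 + (l - p)) = V l - M) ∧ t ≤ 27 * (L - p) + 12 := by
  refine Run.loop (fun τ => p ≤ τ.nvar vL ∧ τ.nvar vL ≤ len ∧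
      (∀ l, p ≤ l → l < τ.nvar vL → V l - M ≤ D) ∧ τ.nvar vQ = q + (τ.nvar vL - p) ∧
      (∀ r ≤ q, τ.rarr aEv r = σ.rarr aEv r) ∧
      (∀ l, p ≤ l → l < τ.nvar vL → τ.rarr aEv (q + 1 + (l - p)) = V l - M))
    (fun τ => 27 * (len - τ.nvar vL)) ?_ ?_ ?_
  · rw [hL, hq]
    exact ⟨le_rfl, hp, fun l h1 h2 => by omega, by omega, fun _ _ => rfl,
      fun l h1 h2 => by omega⟩
  · rintro τ hA ⟨h1, h2, h3, h4, h5, h6⟩ hb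
    have e1 : τ.rarr aV = V := by rw [hA.rarr _ (by decide), hV]
    have e2 : τ.rarr aM (τ.nvar vI) = M := by
      rw [hA.rarr _ (by decide), hA.nvar _ (by decide), hM]
    have e3 : τ.rvar rD = D := by rw [hA.rvar _ (by decide), hD]
    have e4 : τ.nvar vLen = len := by rw [hA.nvar _ (by decide), hlen]
    simp only [BExp.eval, NExp.eval, RExp.eval, e1, e2, e3, e4, not_lt] at hb
    have h3' : ∀ l, p ≤ l → l < τ.nvar vL + 1 → V l - M ≤ D := fun l g1 g2 => by
      rcases Nat.lt_or_ge l (τ.nvar vL) with g | g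
      · exact h3 l g1 g
      · rw [show l = τ.nvar vL by omega]; exact hb.2
    have hw := hW (τ.nvar vL + 1) (by omega) h3'
    have e5 : τ.nvar vQ + 1 = q + 1 + (τ.nvar vL - p) := by omega
    simp [e1, e2]
    refine ⟨by omega, by omega, ⟨by omega, by omega, fun l g1 g2 => by
      have := h3' l g1 (by omega); linarith, by omega, fun r hr => ?_, fun l g1 g2 => ?_⟩, by omega⟩
    · rw [Function.update_of_ne (by omega), h5 r hr]
    · rcases g2.lt_or_eq with g | rfl
      · rw [Function.update_of_ne (by omega), h6 l g1 (by omega)]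
      · rw [← e5, Function.update_self]
  · rintro τ t hA ⟨h1, h2, h3, h4, h5, h6⟩ hb ht
    have e1 : τ.rarr aV = V := by rw [hA.rarr _ (by decide), hV]
    have e2 : τ.rarr aM (τ.nvar vI) = M := by
      rw [hA.rarr _ (by decide), hA.nvar _ (by decide), hM]
    have e3 : τ.rvar rD = D := by rw [hA.rvar _ (by decide), hD]
    have e4 : τ.nvar vLen = len := by rw [hA.nvar _ (by decide), hlen]
    simp only [BExp.eval, NExp.eval, RExp.eval, e1, e2, e3, e4, not_and, not_not] at hb
    simp [hL] at ht
    exact ⟨τ.nvar vL, h1, h2, h3, hb, h4, h5, h6, by omega⟩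

/-- A record that exceeds the lead of `i` by at most the range of the weight of the boundary vertex
belongs to an event. -/
theorem Records.exists_event {N : PathNetwork n} {T sd b i l : ℕ} {σ : State} {v : ℕ → ℝ}
    (h : Records n (offS N T sd b) v (mir n sd b) σ) (hi : 1 ≤ i) (hib : i < mir n sd b)
    (hl : l < σ.nvar vLen) (h1 : mx (offS N T sd b) i (mir n sd b) < σ.rarr aV l)
    (h2 : σ.rarr aV l - mx (offS N T sd b) i (mir n sd b) ≤ N.hi b - N.lo b) :
    ∃ m, (i, m) ∈ evS N T sd b ∧ offS N T sd b m = σ.rarr aV l := by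
  obtain ⟨m, ⟨g1, g2⟩, g3, g4⟩ := h.sound l hl
  refine ⟨m, mem_evS.2 ⟨⟨hi, hib, g1, g3, g2⟩, ?_, ?_⟩, g4⟩ <;>
    simp only [evVal, g4] <;> linarith

open Classical in
/-- Records at distinct places are distinct. -/
theorem Records.card_image {A v : ℕ → ℝ} {b p L : ℕ} {σ : State} (h : Records n A v b σ)
    (hL : L ≤ σ.nvar vLen) : ((Finset.Ico p L).image (σ.rarr aV)).card = L - p := by
  rw [Finset.card_image_of_injOn, Nat.card_Ico]
  intro a ha c hc hac
  simp only [Finset.coe_Ico, Set.mem_Ico] at ha hc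
  rcases lt_trichotomy a c with g | g | g
  · exact absurd hac (h.strict a c g (by omega)).ne
  · exact g
  · exact absurd hac (h.strict c a g (by omega)).ne'

/-- The events of a row of the table of events are at least as many as the records that trigger
them. -/
theorem Records.le_card {N : PathNetwork n} {T sd b i p L : ℕ} {σ : State} {v : ℕ → ℝ}
    (h : Records n (offS N T sd b) v (mir n sd b) σ) (hi : 1 ≤ i) (hib : i < mir n sd b)
    (hL : L ≤ σ.nvar vLen)
    (hl : ∀ l, p ≤ l → l < L → mx (offS N T sd b) i (mir n sd b) < σ.rarr aV l ∧
      σ.rarr aV l - mx (offS N T sd b) i (mir n sd b) ≤ N.hi b - N.lo b) :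
    L - p ≤ ((evS N T sd b).filter (fun q => q.1 = i)).card := by
  classical
  rw [← h.card_image hL]
  refine le_trans (Finset.card_le_card ?_)
    (Finset.card_image_le (f := fun q : ℕ × ℕ => offS N T sd b q.2))
  intro y hy
  obtain ⟨l, hl', rfl⟩ := Finset.mem_image.1 hy
  rw [Finset.mem_Ico] at hl'
  obtain ⟨g1, g2⟩ := hl l hl'.1 hl'.2
  obtain ⟨m, g3, g4⟩ := h.exists_event hi hib (by omega) g1 g2
  exact Finset.mem_image.2 ⟨(i, m), Finset.mem_filter.2 ⟨g3, rfl⟩, g4⟩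

/-- The events of the vertices before `k` have been listed behind the first `q₀` entries, which
are those of `σ₀`. -/
structure EventsInv (N : PathNetwork n) (T sd b : ℕ) (σ₀ : State) (q₀ k : ℕ) (σ : State) :
    Prop where
  p_le : σ.nvar vP ≤ σ.nvar vLen
  lt_of_le : ∀ l < σ.nvar vLen, σ.nvar vP ≤ l → ∀ i, k ≤ i → i < mir n sd b →
    mx (offS N T sd b) i (mir n sd b) < σ.rarr aV l
  q_ge : q₀ ≤ σ.nvar vQ
  q_le : σ.nvar vQ ≤ q₀ + ((evS N T sd b).filter (fun q => q.1 < k)).card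
  old_eq : ∀ r ≤ q₀, σ.rarr aEv r = σ₀.rarr aEv r
  sound : ∀ r, q₀ < r → r ≤ σ.nvar vQ → ∃ q ∈ evS N T sd b, σ.rarr aEv r = evVal N T sd b q
  complete : ∀ q ∈ evS N T sd b, q.1 < k → ∃ r, q₀ < r ∧ r ≤ σ.nvar vQ ∧
    σ.rarr aEv r = evVal N T sd b q

/-- The lead `mx i b` decreases in `i`, so that the pointer to the first record above it only moves
down, and the time is linear in the numbers of vertices and of events. -/
theorem run_cmdEvents (N : PathNetwork n) {σ : State} {T sd b q₀ : ℕ} (hP : Prepared N σ)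
    (hL : Loaded N T sd b σ) (hb : 1 ≤ b ∧ b ≤ n) (hvb : σ.nvar vB = b) (hq : σ.nvar vQ = q₀)
    (hW : q₀ + (evS N T sd b).card ≤ W) (hnW : n ≤ W) :
    Run W cmdEvents σ fun τ t => q₀ ≤ τ.nvar vQ ∧ τ.nvar vQ ≤ q₀ + (evS N T sd b).card ∧
      (∀ r ≤ q₀, τ.rarr aEv r = σ.rarr aEv r) ∧
      (∀ r, q₀ < r → r ≤ τ.nvar vQ → ∃ q ∈ evS N T sd b, τ.rarr aEv r = evVal N T sd b q) ∧
      (∀ q ∈ evS N T sd b, ∃ r, q₀ < r ∧ r ≤ τ.nvar vQ ∧ τ.rarr aEv r = evVal N T sd b q) ∧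
      t ≤ 100 * (n + 1 + (evS N T sd b).card) := by
  have hm := mir_mem (sd := sd) hb.1 hb.2
  have hlen := hL.records.len_le
  have hcard : ∀ k, ((evS N T sd b).filter (fun q => q.1 < k)).card ≤ (evS N T sd b).card :=
    fun k => Finset.card_le_card (Finset.filter_subset _ _)
  refine Run.seq (R := fun τ t => τ.rvar rD = N.hi b - N.lo b ∧ τ.nvar vP = τ.nvar vLen ∧ t ≤ 20)
    (by simp [hvb, hP.lo_eq, hP.hi_eq]; omega) ?_
  rintro σ' t' hA' ⟨hD, hp0, ht'⟩
  replace hL : Loaded N T sd b σ' := hL.of_agree hA' (by decide) (by decide) (by decide)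
  have hlen := hL.records.len_le
  replace hq : σ'.nvar vQ = q₀ := by rw [hA'.nvar _ (by decide), hq]
  rw [← hA'.rarr aEv (by decide)]
  refine Run.forUp 1 (mir n sd b) (EventsInv N T sd b σ' q₀)
    -- the terms pay for the vertices left, the steps of the pointer, and the events to be appended
    (fun k τ => 60 * (mir n sd b - k) + 20 * τ.nvar vP +
      27 * (q₀ + (evS N T sd b).card - τ.nvar vQ)) (by decide) (by simp) hm.1 (by omega) ?_ ?_ ?_ ?_
  · constructor <;> simp [hq, hp0]
    · intro l h1 h2; omega
    · intro r h1 h2; omega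
    · intro i m h1 h2; have := (mem_evS.1 h1).1.1; omega
  · intro τ hA
    simpa [hL.bb_eq] using hA.nvar vBb (by decide)
  · intro k τ hA hk h1 h2 hI
    have hL' : Loaded N T sd b τ := hL.of_agree hA (by decide) (by decide) (by decide)
    have hlen' := hL'.records.len_le
    have hM := (hL'.phi k h1 h2).1
    have hDτ : τ.rvar rD = N.hi b - N.lo b := by rw [hA.rvar _ (by decide), hD]
    set M := mx (offS N T sd b) k (mir n sd b) with hMdef
    refine Run.seq (run_cmdDown (t := M) ?_ rfl hL'.records.strict hI.p_le (by omega)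
      fun l g1 g2 => hI.lt_of_le l g1 g2 k le_rfl h2) ?_
    · intro τ' hA''
      simp only [RExp.eval, NExp.eval]
      rw [hA''.nvar _ (by decide), hA''.rarr _ (by decide), hk, hM]
    rintro τ₁ t₁ hA₁ ⟨hr, ht₁⟩
    have hle := hr.1
    simp only [Cmd.block, run_seq, run_setN, NExp.eval, NExp.cost]
    refine ⟨by omega, ?_⟩
    have hlen₁ : τ₁.nvar vLen = τ.nvar vLen := hA₁.nvar _ (by decide)
    have hQ₁ : τ₁.nvar vQ = τ.nvar vQ := hA₁.nvar _ (by decide)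
    have hV₁ : τ₁.rarr aV = τ.rarr aV := hA₁.rarr _ (by decide)
    have hE₁ : τ₁.rarr aEv = τ.rarr aEv := hA₁.rarr _ (by decide)
    have hadd : ((evS N T sd b).filter (fun q => q.1 < k)).card +
        ((evS N T sd b).filter (fun q => q.1 = k)).card ≤
        ((evS N T sd b).filter (fun q => q.1 < k + 1)).card := by
      rw [← Finset.card_union_of_disjoint]
      · refine Finset.card_le_card fun q hq => ?_
        simp only [Finset.mem_union, Finset.mem_filter] at hq ⊢
        rcases hq with hq | hq
        · exact ⟨hq.1, by omega⟩
        · exact ⟨hq.1, by omega⟩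
      · rw [Finset.disjoint_left]
        intro q hq
        simp only [Finset.mem_filter] at hq ⊢
        omega
    have hk1 := hcard (k + 1)
    have hqle := hI.q_le
    have hqge := hI.q_ge
    have hgt : ∀ l < τ.nvar vLen, τ₁.nvar vP ≤ l → M < τ.rarr aV l := fun l g1 g2 => by
      by_contra hc
      have := (hr.2 l g1).1 (not_lt.1 hc)
      omega
    have hcnt : ∀ L ≤ τ.nvar vLen, (∀ l, τ₁.nvar vP ≤ l → l < L →
        τ.rarr aV l - M ≤ N.hi b - N.lo b) →
        L - τ₁.nvar vP ≤ ((evS N T sd b).filter (fun q => q.1 = k)).card := fun L g1 g2 =>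
      hL'.records.le_card h1 h2 g1 fun l g3 g4 => ⟨hgt l (by omega) g3, g2 l g3 g4⟩
    refine (run_cmdAppend (V := τ.rarr aV) (M := M) (D := N.hi b - N.lo b) (q := τ.nvar vQ)
      (p := τ₁.nvar vP) (len := τ.nvar vLen) (by simpa using hV₁) ?_ ?_ (by simpa using hlen₁)
      (by simp) (by simpa using hQ₁) hle (by omega) ?_).mono ?_
    · have e1 : τ₁.rarr aM = τ.rarr aM := hA₁.rarr _ (by decide)
      have e2 : τ₁.nvar vI = k := by rw [hA₁.nvar _ (by decide), hk]
      simpa [e1, e2] using hM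
    · have := hA₁.rvar rD (by decide)
      rw [hDτ] at this
      simpa using this
    · intro L g1 g2
      have := hcnt L g1 g2
      omega
    · rintro τ₂ t₂ hA₂ ⟨L, g1, g2, g3, g4, g5, g6, g7, g8⟩
      have hV₂ : τ₂.rarr aV = τ.rarr aV := by rw [hA₂.rarr _ (by decide)]; simpa using hV₁
      have hlen₂ : τ₂.nvar vLen = τ.nvar vLen := by
        rw [hA₂.nvar _ (by decide)]; simpa using hlen₁
      have hp₂ : τ₂.nvar vP = τ₁.nvar vP := by rw [hA₂.nvar _ (by decide)]; simp
      have hQ₂ := hcnt L g2 g3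
      have hEq : ∀ r ≤ τ.nvar vQ, τ₂.rarr aEv r = τ.rarr aEv r := fun r hr => by
        rw [g6 r hr]; simp [hE₁]
      simp at ht₁
      refine ⟨?_, by simp; omega⟩
      constructor
      · simp; omega
      · intro l c1 c2 i c3 c4
        simp at c1 c2 ⊢
        rw [hV₂]
        exact lt_of_le_of_lt (mx_anti _ (by omega) c4) (hgt l (by omega) (by omega))
      · simp; omega
      · rw [nvar_setN, if_neg (by decide)]; omega
      · intro r hr
        have : (τ₂.setN vI (k + 1)).rarr aEv r = τ₂.rarr aEv r := rfl
        rw [this, hEq r (by omega), hI.old_eq r hr]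
      · intro r c1 c2
        simp at c2 ⊢
        rcases Nat.lt_or_ge (τ.nvar vQ) r with c3 | c3
        · obtain ⟨l, c4⟩ : ∃ l, r = τ.nvar vQ + 1 + (l - τ₁.nvar vP) ∧ τ₁.nvar vP ≤ l ∧ l < L :=
            ⟨τ₁.nvar vP + (r - τ.nvar vQ - 1), by omega, by omega, by omega⟩
          obtain ⟨m, c5, c6⟩ := hL'.records.exists_event h1 h2 (show l < τ.nvar vLen by omega)
            (hgt l (by omega) c4.2.1) (g3 l c4.2.1 c4.2.2)
          refine ⟨k, m, c5, ?_⟩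
          rw [c4.1, g7 l c4.2.1 c4.2.2, evVal, c6]
        · obtain ⟨⟨i, m⟩, c4, c5⟩ := hI.sound r c1 c3
          exact ⟨i, m, c4, by rw [hEq r c3, c5]⟩
      · rintro ⟨i, m⟩ c1 c2
        simp at c2 ⊢
        rcases Nat.lt_or_ge i k with c3 | c3
        · obtain ⟨r, c4, c5, c6⟩ := hI.complete _ c1 c3
          exact ⟨r, c4, by omega, by rw [hEq r c5, c6]⟩
        · obtain rfl : i = k := by omega
          obtain ⟨⟨-, -, c4, c5, c6⟩, c7, c8⟩ := mem_evS.1 c1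
          obtain ⟨l, c9, c10⟩ := hL'.records.complete m ⟨c4, c6⟩ c5
          simp only [evVal, ← c10, ← hMdef] at c7 c8
          have d1 : τ₁.nvar vP ≤ l := by
            by_contra hc
            have := (hr.2 l c9).2 (by omega)
            linarith
          have d2 : l < L := by
            by_contra hc
            have d3 := g4 (by omega)
            have : τ.rarr aV L ≤ τ.rarr aV l := by
              rcases Nat.lt_or_ge L l with d4 | d4
              · exact (hL'.records.strict L l d4 c9).le
              · rw [show l = L by omega]
            linarith
          refine ⟨τ.nvar vQ + 1 + (l - τ₁.nvar vP), by omega, by omega, ?_⟩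
          rw [g7 l d1 d2, evVal, ← c10]
  · intro τ t hA hk hI ht
    have := hcard (mir n sd b)
    have h2 := hI.q_le
    simp [hp0] at ht
    refine ⟨hI.q_ge, by omega, hI.old_eq, hI.sound, fun q hq => ?_, by omega⟩
    exact hI.complete q hq (mem_evS.1 hq).1.2.1

/-! ### Correctness: merge sort -/

/-- `E` is increasing on every block `(s * m, s * (m + 1)]`, up to the index `q`. -/
def BlockSorted (E : ℕ → ℝ) (s q : ℕ) : Prop :=
  ∀ m a a', s * m < a → a ≤ a' → a' ≤ s * m + s → a' ≤ q → E a ≤ E a'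

/-- `E` and `F` take the same values on `[a, c)`. -/
def SameValues (E F : ℕ → ℝ) (a c : ℕ) : Prop :=
  (∀ r, a ≤ r → r < c → ∃ r', a ≤ r' ∧ r' < c ∧ E r' = F r) ∧
  ∀ r, a ≤ r → r < c → ∃ r', a ≤ r' ∧ r' < c ∧ F r' = E r

theorem SameValues.trans {E F G : ℕ → ℝ} {a c : ℕ} (h : SameValues E F a c)
    (h' : SameValues F G a c) : SameValues E G a c := by
  constructor
  · intro r h1 h2
    obtain ⟨r', h3, h4, h5⟩ := h'.1 r h1 h2
    obtain ⟨r'', h6, h7, h8⟩ := h.1 r' h3 h4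
    exact ⟨r'', h6, h7, h8.trans h5⟩
  · intro r h1 h2
    obtain ⟨r', h3, h4, h5⟩ := h.2 r h1 h2
    obtain ⟨r'', h6, h7, h8⟩ := h'.2 r' h3 h4
    exact ⟨r'', h6, h7, h8.trans h5⟩

/-- The entries of `E` in `[st, i)` and `[mid, j)` have been merged into `σ`'s auxiliary array, from
`st` up to `p`; below `st` that array is `F`. -/
structure MergeInv (E F : ℕ → ℝ) (st mid fin p : ℕ) (σ : State) : Prop where
  i_ge : st ≤ σ.nvar vI
  i_le : σ.nvar vI ≤ mid
  j_ge : mid ≤ σ.nvar vJ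
  j_le : σ.nvar vJ ≤ fin
  count : σ.nvar vI + σ.nvar vJ = p + mid
  old_eq : ∀ r < st, σ.rarr aTmp r = F r
  sorted : ∀ r r', st ≤ r → r ≤ r' → r' < p → σ.rarr aTmp r ≤ σ.rarr aTmp r'
  le_i : σ.nvar vI < mid → ∀ r, st ≤ r → r < p → σ.rarr aTmp r ≤ E (σ.nvar vI)
  le_j : σ.nvar vJ < fin → ∀ r, st ≤ r → r < p → σ.rarr aTmp r ≤ E (σ.nvar vJ)
  sound : ∀ r, st ≤ r → r < p → ∃ r', st ≤ r' ∧ r' < fin ∧ E r' = σ.rarr aTmp r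
  complete_i : ∀ r, st ≤ r → r < σ.nvar vI → ∃ r', st ≤ r' ∧ r' < p ∧ σ.rarr aTmp r' = E r
  complete_j : ∀ r, mid ≤ r → r < σ.nvar vJ → ∃ r', st ≤ r' ∧ r' < p ∧ σ.rarr aTmp r' = E r

/-- The next element of one of the two blocks, which is the least one left, is appended. -/
theorem MergeInv.append {E F : ℕ → ℝ} {st mid fin p x : ℕ} {σ τ : State}
    (h : MergeInv E F st mid fin p σ) (hE1 : ∀ a a', st ≤ a → a ≤ a' → a' < mid → E a ≤ E a')
    (hE2 : ∀ a a', mid ≤ a → a ≤ a' → a' < fin → E a ≤ E a') (hmid : mid ≤ fin)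
    (hT : τ.rarr aTmp = Function.update (σ.rarr aTmp) p (E x))
    (hx : (x = σ.nvar vI ∧ σ.nvar vI < mid ∧ (σ.nvar vJ < fin → E x ≤ E (σ.nvar vJ)) ∧
        τ.nvar vI = σ.nvar vI + 1 ∧ τ.nvar vJ = σ.nvar vJ) ∨
      (x = σ.nvar vJ ∧ σ.nvar vJ < fin ∧ (σ.nvar vI < mid → E x ≤ E (σ.nvar vI)) ∧
        τ.nvar vI = σ.nvar vI ∧ τ.nvar vJ = σ.nvar vJ + 1)) :
    MergeInv E F st mid fin (p + 1) τ := by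
  obtain ⟨h1, h2, h3, h4, h5, h6, h7, h8, h9, h10, h11, h12⟩ := h
  have hstp : st ≤ p := by omega
  have hTp : τ.rarr aTmp p = E x := by rw [hT, Function.update_self]
  have hTr : ∀ r, r ≠ p → τ.rarr aTmp r = σ.rarr aTmp r := fun r hr => by
    rw [hT, Function.update_of_ne hr]
  have hTx : ∀ r, st ≤ r → r < p → σ.rarr aTmp r ≤ E x := by
    intro r c1 c2
    rcases hx with ⟨rfl, g, -⟩ | ⟨rfl, g, -⟩
    · exact h8 g r c1 c2
    · exact h9 g r c1 c2
  have hlt : ∀ P : ℕ → Prop, P p → (∀ r, st ≤ r → r < p → P r) →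
      ∀ r, st ≤ r → r < p + 1 → P r := by
    intro P c1 c2 r c3 c4
    rcases Nat.lt_or_ge r p with c5 | c5
    · exact c2 r c3 c5
    · rwa [show r = p by omega]
  have hcomp : ∀ y, (∃ r', st ≤ r' ∧ r' < p ∧ σ.rarr aTmp r' = y) →
      ∃ r', st ≤ r' ∧ r' < p + 1 ∧ τ.rarr aTmp r' = y := by
    rintro y ⟨r', c1, c2, c3⟩
    exact ⟨r', c1, by omega, by rw [hTr r' (by omega), c3]⟩
  have hxi : τ.nvar vI < mid → E x ≤ E (τ.nvar vI) := by
    rcases hx with ⟨rfl, g1, g2, g3, g4⟩ | ⟨rfl, g1, g2, g3, g4⟩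
    · intro c; exact hE1 _ _ h1 (by omega) c
    · rw [g3]; exact g2
  have hxj : τ.nvar vJ < fin → E x ≤ E (τ.nvar vJ) := by
    rcases hx with ⟨rfl, g1, g2, g3, g4⟩ | ⟨rfl, g1, g2, g3, g4⟩
    · rw [g4]; exact g2
    · intro c; exact hE2 _ _ h3 (by omega) c
  constructor
  · omega
  · omega
  · omega
  · omega
  · omega
  · intro r hr; rw [hTr r (by omega), h6 r hr]
  · intro r r' c1 c2 c3
    rcases Nat.lt_or_ge r' p with c4 | c4
    · rw [hTr r (by omega), hTr r' (by omega)]; exact h7 r r' c1 c2 c4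
    · rw [show r' = p by omega, hTp]
      rcases Nat.lt_or_ge r p with c5 | c5
      · rw [hTr r (by omega)]; exact hTx r c1 c5
      · rw [show r = p by omega, hTp]
  · intro c
    refine hlt _ (by rw [hTp]; exact hxi c) fun r c1 c2 => ?_
    rw [hTr r (by omega)]
    exact (hTx r c1 c2).trans (hxi c)
  · intro c
    refine hlt _ (by rw [hTp]; exact hxj c) fun r c1 c2 => ?_
    rw [hTr r (by omega)]
    exact (hTx r c1 c2).trans (hxj c)
  · refine hlt _ ⟨x, by omega, by omega, hTp.symm⟩ fun r c1 c2 => ?_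
    rw [hTr r (by omega)]
    exact h10 r c1 c2
  · intro r c1 c2
    by_cases c3 : r < σ.nvar vI
    · exact hcomp _ (h11 r c1 c3)
    · exact ⟨p, hstp, by omega, by rw [hTp, show r = x by omega]⟩
  · intro r c1 c2
    by_cases c3 : r < σ.nvar vJ
    · exact hcomp _ (h12 r c1 c3)
    · exact ⟨p, hstp, by omega, by rw [hTp, show r = x by omega]⟩

theorem run_cmdMergeBlocks {σ : State} {E : ℕ → ℝ} {st mid fin : ℕ} (hE : σ.rarr aEv = E)
    (hst : σ.nvar vSt = st) (hmid : σ.nvar vMid = mid) (hfin : σ.nvar vEnd = fin)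
    (hi : σ.nvar vI = st) (hj : σ.nvar vJ = mid) (h1 : st ≤ mid) (h2 : mid ≤ fin) (hW : fin ≤ W)
    (hE1 : ∀ a a', st ≤ a → a ≤ a' → a' < mid → E a ≤ E a')
    (hE2 : ∀ a a', mid ≤ a → a ≤ a' → a' < fin → E a ≤ E a') :
    Run W cmdMergeBlocks σ fun τ t => (∀ r < st, τ.rarr aTmp r = σ.rarr aTmp r) ∧
      (∀ r r', st ≤ r → r ≤ r' → r' < fin → τ.rarr aTmp r ≤ τ.rarr aTmp r') ∧
      SameValues E (τ.rarr aTmp) st fin ∧ t ≤ 30 * (fin - st) + 5 := by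
  refine Run.forUp st fin (MergeInv E (σ.rarr aTmp) st mid fin) (fun k _ => 30 * (fin - k))
    (by decide) (by simp [hst]) (by omega) hW ?_ ?_ ?_ ?_
  · constructor <;> simp [hi, hj, h1, h2] <;> intros <;> omega
  · intro τ hA; simpa [hfin] using hA.nvar vEnd (by decide)
  · intro k τ hA hk hk1 hk2 hI
    have e1 : τ.rarr aEv = E := by rw [hA.rarr _ (by decide), hE]
    have e2 : τ.nvar vMid = mid := by rw [hA.nvar _ (by decide), hmid]
    have e3 : τ.nvar vEnd = fin := by rw [hA.nvar _ (by decide), hfin]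
    obtain ⟨c1, c2, c3, c4, c5, -⟩ := id hI
    rw [run_branch]
    constructor
    · intro hb
      simp only [BExp.eval, NExp.eval, RExp.eval, e1, e2, e3, not_and, not_lt] at hb
      simp [e1, hk]
      refine ⟨by omega, ?_, by omega⟩
      exact hI.append hE1 hE2 h2 (by simp) (Or.inl ⟨rfl, hb.1, hb.2, by simp, by simp⟩)
    · intro hb
      simp only [BExp.eval, NExp.eval, RExp.eval, e1, e2, e3, not_and, Classical.not_imp,
        not_not] at hb
      simp [e1, hk]
      refine ⟨by omega, ?_, by omega⟩
      refine hI.append hE1 hE2 h2 (by simp)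
        (Or.inr ⟨rfl, ?_, fun c => (hb c).2.le, by simp, by simp⟩)
      by_cases c : τ.nvar vI < mid
      · exact (hb c).1
      · omega
  · intro τ t hA hk hI ht
    obtain ⟨c1, c2, c3, c4, c5, c6, c7, c8, c9, c10, c11, c12⟩ := hI
    refine ⟨c6, c7, ⟨c10, fun r g1 g2 => ?_⟩, by simp at ht; omega⟩
    rcases Nat.lt_or_ge r mid with g | g
    · exact c11 r g1 (by omega)
    · exact c12 r g (by omega)

theorem run_cmdBlockBounds {σ : State} {st q s : ℕ} (hst : σ.nvar vSt = st) (hq : σ.nvar vQ = q)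
    (hs : σ.nvar vS = s) (h : st ≤ q) (hW : q + 1 + s ≤ W) :
    Run W cmdBlockBounds σ fun τ t => τ.nvar vMid = min (st + s) (q + 1) ∧
      τ.nvar vEnd = min (st + 2 * s) (q + 1) ∧ τ.nvar vI = st ∧
      τ.nvar vJ = min (st + s) (q + 1) ∧ t ≤ 40 := by
  simp [cmdBlockBounds, hst, hq, hs]
  omega

/-- The blocks before `st` have been merged. -/
structure MergedTo (E : ℕ → ℝ) (s q st : ℕ) (σ : State) : Prop where
  st_eq : (∃ m, st = 2 * s * m + 1) ∨ st = q + 1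
  st_le : st ≤ q + 1
  sorted : ∀ m a a', 2 * s * m < a → a ≤ a' → a' ≤ 2 * s * m + 2 * s → a' < st →
    σ.rarr aTmp a ≤ σ.rarr aTmp a'
  same : SameValues E (σ.rarr aTmp) 1 st

theorem run_cmdMergeAll {σ : State} {E : ℕ → ℝ} {q s : ℕ} (hE : σ.rarr aEv = E)
    (hst : σ.nvar vSt = 1) (hq : σ.nvar vQ = q) (hs : σ.nvar vS = s) (hs1 : 1 ≤ s)
    (hW : q + 1 + s ≤ W) (hB : BlockSorted E s q) :
    Run W cmdMergeAll σ fun τ t => BlockSorted (τ.rarr aTmp) (2 * s) q ∧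
      SameValues E (τ.rarr aTmp) 1 (q + 1) ∧ t ≤ 100 * (q + 1) := by
  refine Run.loop (fun τ => MergedTo E s q (τ.nvar vSt) τ) (fun τ => 90 * (q + 1 - τ.nvar vSt))
    ?_ ?_ ?_
  · rw [hst]
    refine ⟨Or.inl ⟨0, by simp⟩, by omega, fun m a a' h1 h2 h3 h4 => by omega, ?_⟩
    constructor <;> intros <;> omega
  · intro τ hA hI hb
    have e1 : τ.rarr aEv = E := by rw [hA.rarr _ (by decide), hE]
    have e2 : τ.nvar vQ = q := by rw [hA.nvar _ (by decide), hq]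
    have e3 : τ.nvar vS = s := by rw [hA.nvar _ (by decide), hs]
    simp only [BExp.eval, NExp.eval, e2, not_lt] at hb
    obtain ⟨h1, h2, h3, h4⟩ := hI
    obtain ⟨st, hst'⟩ : ∃ st, τ.nvar vSt = st := ⟨_, rfl⟩
    rw [hst'] at hb h1 h2 h3 h4
    obtain ⟨m, hm⟩ : ∃ m, st = 2 * s * m + 1 := h1.resolve_right (by omega)
    refine Run.seq (run_cmdBlockBounds hst' e2 e3 hb hW) ?_
    rintro τ₁ t₁ hA₁ ⟨g1, g2, g3, g4, ht₁⟩
    have f1 : 2 * s * m = s * (2 * m) := by ring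
    have f2 : s * (2 * m + 1) = s * (2 * m) + s := by ring
    refine Run.seq (run_cmdMergeBlocks (E := E) (by rw [hA₁.rarr _ (by decide), e1])
      (by rw [hA₁.nvar _ (by decide), hst']) g1 g2 g3 g4 (by omega) (by omega) (by omega)
      (fun a a' c1 c2 c3 => hB (2 * m) a a' (by omega) c2 (by omega) (by omega))
      (fun a a' c1 c2 c3 => hB (2 * m + 1) a a' (by omega) c2 (by omega) (by omega))) ?_
    rintro τ₂ t₂ hA₂ ⟨k1, k2, k3, ht₂⟩
    rw [hA₁.rarr aTmp (by decide)] at k1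
    have e4 : τ₂.nvar vEnd = min (st + 2 * s) (q + 1) := by rw [hA₂.nvar _ (by decide), g2]
    simp only [run_setN, NExp.eval, e4, nvar_setN, if_pos, BExp.cost, NExp.cost, hst']
    refine ⟨by omega, ?_, by omega⟩
    constructor
    · rcases Nat.lt_or_ge q (st + 2 * s) with c | c
      · exact Or.inr (by omega)
      · refine Or.inl ⟨m + 1, ?_⟩
        rw [min_eq_left (by omega), hm]
        ring
    · omega
    · intro m' a a' c1 c2 c3 c4
      rw [rarr_setN]
      rcases lt_trichotomy m' m with c | c | c
      · have : 2 * s * (m' + 1) ≤ 2 * s * m := Nat.mul_le_mul_left _ c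
        rw [mul_add] at this
        rw [k1 a (by omega), k1 a' (by omega)]
        exact h3 m' a a' c1 c2 c3 (by omega)
      · subst c
        exact k2 a a' (by omega) c2 c4
      · have : 2 * s * (m + 1) ≤ 2 * s * m' := Nat.mul_le_mul_left _ c
        rw [mul_add] at this
        omega
    · rw [rarr_setN]
      constructor
      · intro r c1 c2
        rcases Nat.lt_or_ge r st with c | c
        · rw [k1 r c]
          obtain ⟨r', d1, d2, d3⟩ := h4.1 r c1 c
          exact ⟨r', d1, by omega, d3⟩
        · obtain ⟨r', d1, d2, d3⟩ := k3.1 r c c2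
          exact ⟨r', by omega, d2, d3⟩
      · intro r c1 c2
        rcases Nat.lt_or_ge r st with c | c
        · obtain ⟨r', d1, d2, d3⟩ := h4.2 r c1 c
          exact ⟨r', d1, by omega, by rw [k1 r' d2, d3]⟩
        · obtain ⟨r', d1, d2, d3⟩ := k3.2 r c c2
          exact ⟨r', by omega, d2, d3⟩
  · intro τ t hA hI hb ht
    have e2 : τ.nvar vQ = q := by rw [hA.nvar _ (by decide), hq]
    simp only [BExp.eval, NExp.eval, e2, not_not] at hb
    obtain ⟨h1, h2, h3, h4⟩ := hI
    have h5 : τ.nvar vSt = q + 1 := by omega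
    rw [h5] at h3 h4
    simp [hst] at ht
    exact ⟨fun m a a' c1 c2 c3 c4 => h3 m a a' c1 c2 c3 (by omega), h4, by omega⟩

theorem run_cmdCopy {σ : State} {q : ℕ} (hq : σ.nvar vQ = q) (hW : q + 1 ≤ W) :
    Run W cmdCopy σ fun τ t => (∀ r, 1 ≤ r → r ≤ q → τ.rarr aEv r = σ.rarr aTmp r) ∧
      t ≤ 20 * (q + 1) := by
  refine Run.forUp 1 (q + 1) (fun k τ => ∀ r, 1 ≤ r → r < k → τ.rarr aEv r = σ.rarr aTmp r)
    (fun k _ => 15 * (q + 1 - k)) (by decide) (by simp) (by omega) hW ?_ ?_ ?_ ?_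
  · intro r h1 h2; omega
  · intro τ hA; simpa [hq] using hA.nvar vQ (by decide)
  · intro k τ hA hk h1 h2 hI
    have e1 : τ.rarr aTmp = σ.rarr aTmp := hA.rarr _ (by decide)
    simp [hk, e1]
    refine ⟨fun r g1 g2 => ?_, by omega⟩
    rcases g2.lt_or_eq with g | rfl
    · rw [Function.update_of_ne (by omega), hI r g1 (by omega)]
    · rw [Function.update_self]
  · intro τ t hA hk hI ht
    simp at ht
    exact ⟨fun r g1 g2 => hI r g1 (by omega), by omega⟩

theorem run_cmdMerge {σ : State} {q s : ℕ} (hq : σ.nvar vQ = q) (hs : σ.nvar vS = s) (hs1 : 1 ≤ s)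
    (hW : q + 1 + s ≤ W) (hB : BlockSorted (σ.rarr aEv) s q) :
    Run W cmdMerge σ fun τ t => BlockSorted (τ.rarr aEv) (2 * s) q ∧
      SameValues (σ.rarr aEv) (τ.rarr aEv) 1 (q + 1) ∧ t ≤ 150 * (q + 1) := by
  rw [cmdMerge, run_seq, run_setN]
  refine ⟨by simp; omega, ?_⟩
  refine Run.seq (run_cmdMergeAll (E := σ.rarr aEv) rfl (by simp) (by simpa using hq)
    (by simpa using hs) hs1 hW hB) ?_
  rintro τ t hA ⟨h1, h2, ht⟩
  refine (run_cmdCopy (q := q) (by rw [hA.nvar _ (by decide)]; simpa using hq) (by omega)).mono ?_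
  rintro τ' t' hA' ⟨h3, ht'⟩
  refine ⟨fun m a a' c1 c2 c3 c4 => ?_, ⟨?_, ?_⟩, by simp; omega⟩
  · rw [h3 a (by omega) (by omega), h3 a' (by omega) c4]
    exact h1 m a a' c1 c2 c3 c4
  · intro r c1 c2
    rw [h3 r c1 (by omega)]
    exact h2.1 r c1 c2
  · intro r c1 c2
    obtain ⟨r', d1, d2, d3⟩ := h2.2 r c1 c2
    exact ⟨r', d1, d2, by rw [h3 r' d1 (by omega), d3]⟩

/-- After `Lg` rounds the blocks have length `2 ^ Lg`, which exceeds the length `q` of the list. -/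
theorem run_cmdSort {σ : State} {q Lg : ℕ} (hq : σ.nvar vQ = q) (hLg : σ.nvar vLg = Lg)
    (hlt : q < 2 ^ Lg) (hW : q + 1 + 2 ^ Lg ≤ W) :
    Run W cmdSort σ fun τ t =>
      (∀ a a', 1 ≤ a → a ≤ a' → a' ≤ q → τ.rarr aEv a ≤ τ.rarr aEv a') ∧
      SameValues (σ.rarr aEv) (τ.rarr aEv) 1 (q + 1) ∧ t ≤ 200 * ((q + 1) * (Lg + 1)) := by
  have hLW : Lg < 2 ^ Lg := Nat.lt_two_pow_self
  rw [cmdSort, run_seq, run_setN]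
  refine ⟨by simp; omega, ?_⟩
  refine Run.forUp 0 Lg (fun k τ => τ.nvar vS = 2 ^ k ∧ BlockSorted (τ.rarr aEv) (2 ^ k) q ∧
      SameValues (σ.rarr aEv) (τ.rarr aEv) 1 (q + 1)) (fun k _ => 165 * ((q + 1) * (Lg - k)))
      (by decide) (by simp) (by omega) (by omega) ?_ ?_ ?_ ?_
  · refine ⟨by simp, fun m a a' c1 c2 c3 c4 => ?_, ⟨fun r c1 c2 => ⟨r, c1, c2, rfl⟩,
      fun r c1 c2 => ⟨r, c1, c2, rfl⟩⟩⟩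
    rw [show a = a' by omega]
  · intro τ hA
    simpa [hLg] using hA.nvar vLg (by decide)
  · rintro k τ hA hk - hk2 ⟨h1, h2, h3⟩
    have hpow : 2 ^ (k + 1) ≤ 2 ^ Lg := Nat.pow_le_pow_right (by omega) hk2
    rw [pow_succ] at hpow
    have hpos : 1 ≤ 2 ^ k := Nat.one_le_two_pow
    refine Run.seq (run_cmdMerge (by rw [hA.nvar _ (by decide)]; simpa using hq) h1 hpos
      (by omega) h2) ?_
    rintro τ' t' hA' ⟨g1, g2, ht'⟩
    have e1 : τ'.nvar vS = 2 ^ k := by rw [hA'.nvar _ (by decide), h1]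
    obtain ⟨d, hd⟩ : ∃ d, Lg - k = d + 1 := ⟨Lg - k - 1, by omega⟩
    have hd' : Lg - (k + 1) = d := by omega
    simp [e1, hd, hd']
    refine ⟨by omega, ⟨by ring, ?_, h3.trans g2⟩, ?_⟩
    · rwa [pow_succ, mul_comm]
    · rw [mul_add]; omega
  · rintro τ t hA hk ⟨h1, h2, h3⟩ ht
    refine ⟨fun a a' c1 c2 c3 => h2 0 a a' (by omega) c2 (by omega) c3, h3, ?_⟩
    simp at ht ⊢
    rw [mul_add]
    omega

/-! ### Correctness: the best vertices of a side -/

/-- `i` is the first index in `[lo, hi]` at which `f` attains its minimum over `[lo, hi]`. -/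
structure IsFirstMin (f : ℕ → ℝ) (lo hi i : ℕ) : Prop where
  ge : lo ≤ i
  le : i ≤ hi
  min : ∀ j, lo ≤ j → j ≤ hi → f i ≤ f j
  first : ∀ j, lo ≤ j → j < i → f i < f j

theorem IsFirstMin.self (f : ℕ → ℝ) (a : ℕ) : IsFirstMin f a a a :=
  ⟨le_rfl, le_rfl, fun j h1 h2 => by rw [show j = a by omega], fun j h1 h2 => by omega⟩

theorem IsFirstMin.succ_of_lt {f : ℕ → ℝ} {a c i : ℕ} (h : IsFirstMin f a c i)
    (hlt : f (c + 1) < f i) : IsFirstMin f a (c + 1) (c + 1) := by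
  have hall : ∀ j, a ≤ j → j ≤ c → f (c + 1) < f j := fun j h1 h2 => hlt.trans_le (h.min j h1 h2)
  refine ⟨by have := h.ge; have := h.le; omega, le_rfl, fun j h1 h2 => ?_,
    fun j h1 h2 => hall j h1 (by omega)⟩
  rcases h2.eq_or_lt with rfl | h3
  · exact le_rfl
  · exact (hall j h1 (by omega)).le

theorem IsFirstMin.succ_of_le {f : ℕ → ℝ} {a c i : ℕ} (h : IsFirstMin f a c i)
    (hle : f i ≤ f (c + 1)) : IsFirstMin f a (c + 1) i := by
  refine ⟨h.ge, h.le.trans (by omega), fun j h1 h2 => ?_, h.first⟩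
  rcases h2.eq_or_lt with rfl | h3
  · exact hle
  · exact h.min j h1 (by omega)

theorem exists_isFirstMin (f : ℕ → ℝ) {a c : ℕ} (h : a ≤ c) : ∃ i, IsFirstMin f a c i := by
  induction c, h using Nat.le_induction with
  | base => exact ⟨a, .self f a⟩
  | succ c h ih =>
    obtain ⟨i, hi⟩ := ih
    rcases lt_or_ge (f (c + 1)) (f i) with hlt | hle
    · exact ⟨_, hi.succ_of_lt hlt⟩
    · exact ⟨_, hi.succ_of_le hle⟩

/-- It suffices to search an interval that contains the first minimum. -/
theorem IsFirstMin.extend {f : ℕ → ℝ} {a c a' c' i i' : ℕ} (h : IsFirstMin f a c i)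
    (h' : IsFirstMin f a' c' i') (ha : a ≤ a') (hc : c' ≤ c) (h1 : a' ≤ i) (h2 : i ≤ c') :
    IsFirstMin f a c i' := by
  have : i' = i := by
    rcases lt_trichotomy i' i with g | g | g
    · have g1 := h.first i' (ha.trans h'.ge) g
      have g2 := h'.min i h1 h2
      linarith
    · exact g
    · have g1 := h'.first i h1 g
      have g2 := h.min i' (ha.trans h'.ge) (h'.le.trans hc)
      linarith
  rwa [this]

/-- The best vertex moves towards the boundary vertex as that gets heavier. -/
theorem isFirstMin_phiS_mono (N : PathNetwork n) {T sd b i i' : ℕ} (hb : 1 ≤ b ∧ b ≤ n)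
    {δ δ' : ℝ} (hδ : δ ≤ δ') (hm : 1 < mir n sd b)
    (h : IsFirstMin (fun i => phiS N T sd b i δ) 1 (mir n sd b - 1) i)
    (h' : IsFirstMin (fun i => phiS N T sd b i δ') 1 (mir n sd b - 1) i') : i ≤ i' := by
  by_contra hc
  have h1 := h.first i' h'.ge (by omega)
  have h2 := h'.min i h.ge h.le
  have h3 := phiS_sub_le N (T := T) (sd := sd) hb h'.ge (show i' ≤ i by omega)
    (by have := h.le; omega) hδ
  linarith

/-- The pointer moves up past all records up to `t`. It may still be too high afterwards; a scan,
which comes next, lowers it to the right place. -/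
theorem run_cmdUp {σ : State} {V : ℕ → ℝ} {len p : ℕ} {t : ℝ}
    (ht : σ.rarr aM (σ.nvar vCol) + σ.rarr aEv (σ.nvar vR) = t) (hV : σ.rarr aV = V)
    (hlen : σ.nvar vLen = len) (hp : σ.nvar vP = p) (hle : p ≤ len) (hW : len ≤ W) :
    Run W cmdUp σ fun τ s => p ≤ τ.nvar vP ∧ τ.nvar vP ≤ len ∧
      (∀ l, p ≤ l → l < τ.nvar vP → V l ≤ t) ∧ (τ.nvar vP < len → t < V (τ.nvar vP)) ∧
      s ≤ 17 * (τ.nvar vP - p) + 13 := by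
  refine Run.loop (fun τ => p ≤ τ.nvar vP ∧ τ.nvar vP ≤ len ∧
      (∀ l, p ≤ l → l < τ.nvar vP → V l ≤ t)) (fun τ => 17 * (len - τ.nvar vP)) ?_ ?_ ?_
  · rw [hp]; exact ⟨le_rfl, hle, fun l h1 h2 => by omega⟩
  · rintro τ hA ⟨h1, h2, h3⟩ hb
    have e1 : τ.rarr aM (τ.nvar vCol) + τ.rarr aEv (τ.nvar vR) = t := by
      rw [hA.rarr _ (by decide), hA.nvar _ (by decide), hA.rarr _ (by decide),
        hA.nvar _ (by decide), ht]
    have e2 : τ.rarr aV = V := by rw [hA.rarr _ (by decide), hV]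
    have e3 : τ.nvar vLen = len := by rw [hA.nvar _ (by decide), hlen]
    simp only [BExp.eval, NExp.eval, RExp.eval, e1, e2, e3, not_lt] at hb
    simp
    refine ⟨by omega, ⟨by omega, by omega, fun l g1 g2 => ?_⟩, by omega⟩
    rcases g2.lt_or_eq with g | rfl
    · exact h3 l g1 (by omega)
    · exact hb.2
  · rintro τ s hA ⟨h1, h2, h3⟩ hb hs
    have e1 : τ.rarr aM (τ.nvar vCol) + τ.rarr aEv (τ.nvar vR) = t := by
      rw [hA.rarr _ (by decide), hA.nvar _ (by decide), hA.rarr _ (by decide),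
        hA.nvar _ (by decide), ht]
    have e2 : τ.rarr aV = V := by rw [hA.rarr _ (by decide), hV]
    have e3 : τ.nvar vLen = len := by rw [hA.nvar _ (by decide), hlen]
    simp only [BExp.eval, NExp.eval, RExp.eval, e1, e2, e3, not_and, not_not] at hb
    simp [hp] at hs
    exact ⟨h1, h2, h3, hb, by omega⟩

/-- The evaluated expression is the aggregate time. -/
theorem eval_expPhi {N : PathNetwork n} {T sd b i p : ℕ} {δ : ℝ} {σ : State}
    (hL : Loaded N T sd b σ) (hi : 1 ≤ i) (hib : i < mir n sd b) (hc : σ.nvar vC = i)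
    (hδ : σ.rarr aEv (σ.nvar vR) = δ) (hp : σ.nvar vP = p)
    (hr : IsRank (σ.rarr aV) (σ.nvar vLen) (mx (offS N T sd b) i (mir n sd b) + δ) p) :
    expPhi.eval σ = phiS N T sd b i δ := by
  obtain ⟨h1, h2⟩ := hL.phi i hi hib
  rw [h2, h1, hL.records.excess_eq _ p hr]
  simp [expPhi, hc, hδ, hp, h1]

/-- The best vertex among `col, …, c - 1` has been found, and the pointer is at least at the number
of records up to the lead of vertex `c`. -/
structure ScanInv (N : PathNetwork n) (T sd b : ℕ) (δ : ℝ) (col c : ℕ) (σ : State) : Prop where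
  p_le : σ.nvar vP ≤ σ.nvar vLen
  lt_of_le : ∀ l < σ.nvar vLen, σ.nvar vP ≤ l → ∀ i, c ≤ i → i < mir n sd b →
    mx (offS N T sd b) i (mir n sd b) + δ < σ.rarr aV l
  start : c = col → σ.nvar vBi = 0
  isFirstMin : col < c → IsFirstMin (fun i => phiS N T sd b i δ) col (c - 1) (σ.nvar vBi)
  value : col < c → σ.rvar rBv = phiS N T sd b (σ.nvar vBi) δ
  rank : col < c → IsRank (σ.rarr aV) (σ.nvar vLen)
    (mx (offS N T sd b) (c - 1) (mir n sd b) + δ) (σ.nvar vP)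

/-- Along a scan the lead decreases, so that the pointer only moves down, paid for by its decrease.
-/
theorem run_cmdScan (N : PathNetwork n) {σ : State} {T sd b col hc : ℕ} {δ : ℝ}
    (hL : Loaded N T sd b σ) (hb : 1 ≤ b ∧ b ≤ n) (h1 : 1 ≤ col) (h2 : col ≤ hc)
    (h3 : hc < mir n sd b) (hcol : σ.nvar vCol = col) (hhc : σ.nvar vHc = hc)
    (hδ : σ.rarr aEv (σ.nvar vR) = δ) (hW : n ≤ W) (hp : σ.nvar vP ≤ σ.nvar vLen)
    (hlt : ∀ l < σ.nvar vLen, σ.nvar vP ≤ l →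
      mx (offS N T sd b) col (mir n sd b) + δ < σ.rarr aV l) :
    Run W cmdScan σ fun τ t => IsFirstMin (fun i => phiS N T sd b i δ) col hc (τ.nvar vBi) ∧
      τ.rvar rBv = phiS N T sd b (τ.nvar vBi) δ ∧
      IsRank (σ.rarr aV) (σ.nvar vLen) (mx (offS N T sd b) hc (mir n sd b) + δ) (τ.nvar vP) ∧
      t + 20 * τ.nvar vP ≤ 120 * (hc - col) + 20 * σ.nvar vP + 140 := by
  have hm := mir_mem (sd := sd) hb.1 hb.2
  have hlen := hL.records.len_le
  rw [cmdScan, run_seq, run_setN]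
  refine ⟨by simp, ?_⟩
  refine Run.forUp col (hc + 1) (ScanInv N T sd b δ col)
    (fun c τ => 120 * (hc + 1 - c) + 20 * τ.nvar vP) (by decide) (by simpa using hcol) (by omega)
    (by omega) ?_ ?_ ?_ ?_
  · constructor <;> simp [hp]
    intro l g1 g2 i g3 g4
    exact lt_of_le_of_lt (by linarith [mx_anti (offS N T sd b) g3 g4]) (hlt l g1 g2)
  · intro τ hA
    simpa [hhc] using hA.nvar vHc (by decide)
  · intro c τ hA hk hc1 hc2 hI
    have hL' : Loaded N T sd b τ := hL.of_agree (τ := τ) (c := cmdScan)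
      ⟨fun x hx => by
          rw [hA.nvar x (fun h => hx (by simp [cmdScan, Cmd.modNVar, h])), nvar_setN, if_neg]
          rintro rfl; exact hx (by decide),
        fun x hx => hA.rvar x hx, fun x hx => hA.narr x hx, fun x hx => hA.rarr x hx⟩
      (by decide) (by decide) (by decide)
    have hδ' : τ.rarr aEv (τ.nvar vR) = δ := by
      rw [hA.rarr _ (by decide), hA.nvar _ (by decide)]; simpa using hδ
    have hM := (hL'.phi c (by omega) (by omega)).1
    have hlen' := hL'.records.len_le
    refine Run.seq (run_cmdDown (t := mx (offS N T sd b) c (mir n sd b) + δ) ?_ rfl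
      hL'.records.strict hI.p_le (by omega)
      fun l g1 g2 => hI.lt_of_le l g1 g2 c le_rfl (by omega)) ?_
    · intro τ' hA'
      simp only [RExp.eval, NExp.eval]
      rw [hA'.nvar _ (by decide), hA'.nvar _ (by decide), hA'.rarr _ (by decide),
        hA'.rarr _ (by decide), hk, hM, hδ']
    rintro τ₁ t₁ hA₁ ⟨hr, ht₁⟩
    have hL₁ : Loaded N T sd b τ₁ := hL'.of_agree hA₁ (by decide) (by decide) (by decide)
    have hlen₁ : τ₁.nvar vLen = τ.nvar vLen := hA₁.nvar _ (by decide)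
    have hV₁ : τ₁.rarr aV = τ.rarr aV := hA₁.rarr _ (by decide)
    have hc₁ : τ₁.nvar vC = c := by rw [hA₁.nvar _ (by decide), hk]
    have hBi₁ : τ₁.nvar vBi = τ.nvar vBi := hA₁.nvar _ (by decide)
    have hBv₁ : τ₁.rvar rBv = τ.rvar rBv := hA₁.rvar _ (by decide)
    have hphi : expPhi.eval τ₁ = phiS N T sd b c δ := by
      refine eval_expPhi hL₁ (by omega) (by omega) hc₁ ?_ rfl (by rwa [hV₁, hlen₁])
      rw [hA₁.rarr _ (by decide), hA₁.nvar _ (by decide), hδ']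
    have hle := hr.1
    have hrest : ∀ l < τ.nvar vLen, τ₁.nvar vP ≤ l → ∀ i, c + 1 ≤ i → i < mir n sd b →
        mx (offS N T sd b) i (mir n sd b) + δ < τ.rarr aV l := by
      intro l g1 g2 i g3 g4
      have g5 : ¬ τ.rarr aV l ≤ mx (offS N T sd b) c (mir n sd b) + δ := fun h => by
        have := (hr.2 l g1).1 h; omega
      linarith [mx_anti (offS N T sd b) (show c ≤ i by omega) g4]
    have hcost : expPhi.cost = 50 := rfl
    rw [run_seq, run_setR, hphi, hcost, run_branch]
    simp only [RExp.cost, NExp.cost] at ht₁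
    constructor
    · intro hbr
      simp [hBi₁, hBv₁] at hbr
      simp [hc₁]
      refine ⟨by omega, ?_, by omega⟩
      constructor
      · simpa [hlen₁] using hle
      · simpa [hlen₁, hV₁] using hrest
      · intro h; omega
      · intro _
        simp
        rcases hc1.eq_or_lt with rfl | hlt'
        · exact .self _ _
        · have g1 := hI.isFirstMin hlt'
          have g2 := hI.value hlt'
          obtain ⟨d, rfl⟩ : ∃ d, c = d + 1 := ⟨c - 1, by omega⟩
          refine IsFirstMin.succ_of_lt g1 ?_
          have := hbr (by have := g1.ge; omega)
          rwa [g2] at this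
      · intro _; simp
      · intro _; simpa [hlen₁, hV₁] using hr
    · intro hbr
      simp [hBi₁, hBv₁] at hbr
      have hlt' : col < c := by
        rcases hc1.eq_or_lt with h | h
        · exact absurd (hI.start h.symm) (by omega)
        · exact h
      simp
      refine ⟨?_, by omega⟩
      have g1 := hI.isFirstMin hlt'
      have g2 := hI.value hlt'
      constructor
      · simpa [hlen₁] using hle
      · simpa [hlen₁, hV₁] using hrest
      · intro h; omega
      · intro _
        simp [hBi₁]
        obtain ⟨d, rfl⟩ : ∃ d, c = d + 1 := ⟨c - 1, by omega⟩
        refine IsFirstMin.succ_of_le g1 ?_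
        have := hbr.2
        rwa [g2] at this
      · intro _; simpa [hBi₁, hBv₁] using g2
      · intro _; simpa [hlen₁, hV₁] using hr
  · intro τ t hA hk hI ht
    have hlen₁ : τ.nvar vLen = σ.nvar vLen := by rw [hA.nvar _ (by decide)]; simp
    have hV₁ : τ.rarr aV = σ.rarr aV := by rw [hA.rarr _ (by decide)]; simp
    refine ⟨hI.isFirstMin (by omega), hI.value (by omega), ?_, ?_⟩
    · have := hI.rank (by omega)
      rwa [hlen₁, hV₁] at this
    · simp at ht ⊢
      omega

/-- The list of events is sorted, lies in the admissible range, and contains all events of the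
side. -/
structure EventList (N : PathNetwork n) (T sd b q : ℕ) (E : ℕ → ℝ) : Prop where
  sorted : ∀ a a', 1 ≤ a → a ≤ a' → a' ≤ q → E a ≤ E a'
  pos : ∀ a, 1 ≤ a → a ≤ q → 0 < E a
  le : ∀ a, 1 ≤ a → a ≤ q → E a ≤ N.hi b - N.lo b
  complete : ∀ e ∈ evS N T sd b, ∃ a, 1 ≤ a ∧ a ≤ q ∧ E a = evVal N T sd b e

/-- The records that the lead of `col` passes between the events `a` and `r` are counted by the
events in between, because each of them then triggers an event of `col`. -/
theorem EventList.count {N : PathNetwork n} {T sd b q col a r p p' : ℕ} {E v : ℕ → ℝ}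
    {σ : State} (hE : EventList N T sd b q E)
    (h : Records n (offS N T sd b) v (mir n sd b) σ) (hc : 1 ≤ col) (hcb : col < mir n sd b)
    (ha : 1 ≤ a) (har : a < r) (hr : r ≤ q) (hp' : p' ≤ σ.nvar vLen)
    (h1 : ∀ l < σ.nvar vLen, p ≤ l → mx (offS N T sd b) col (mir n sd b) + E a < σ.rarr aV l)
    (h2 : ∀ l, p ≤ l → l < p' → σ.rarr aV l ≤ mx (offS N T sd b) col (mir n sd b) + E r) :
    p' - p ≤ r - a := by
  classical
  rw [← h.card_image hp', ← Nat.card_Ioc]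
  refine le_trans (Finset.card_le_card ?_)
    (Finset.card_image_le (f := fun j => mx (offS N T sd b) col (mir n sd b) + E j))
  intro y hy
  obtain ⟨l, hl, rfl⟩ := Finset.mem_image.1 hy
  rw [Finset.mem_Ico] at hl
  have g1 := h1 l (by omega) hl.1
  have g2 := h2 l hl.1 hl.2
  have g3 := hE.pos a ha (by omega)
  have g4 := hE.le r (by omega) hr
  obtain ⟨m, g5, g6⟩ := h.exists_event hc hcb (show l < σ.nvar vLen by omega) (by linarith)
    (by linarith)
  obtain ⟨j, g7, g8, g9⟩ := hE.complete _ g5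
  simp only [evVal, g6] at g9
  have g10 : a < j := by
    by_contra hlt
    have := hE.sorted j a g7 (by omega) (by omega)
    linarith
  rcases Nat.lt_or_ge r j with g | g
  · have := hE.sorted r j (by omega) g.le g8
    exact Finset.mem_image.2 ⟨r, Finset.mem_Ioc.2 ⟨har, le_rfl⟩, by linarith⟩
  · exact Finset.mem_image.2 ⟨j, Finset.mem_Ioc.2 ⟨g10, g⟩, by linarith⟩

/-- The best vertex before the boundary vertex, for the event `r`, has been found. -/
structure Best (N : PathNetwork n) (T sd b : ℕ) (E : ℕ → ℝ) (r : ℕ) (σ : State) : Prop where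
  isFirstMin : IsFirstMin (fun i => phiS N T sd b i (E r)) 1 (mir n sd b - 1) (σ.narr aOpt r)
  value : σ.rarr aVal r = phiS N T sd b (σ.narr aOpt r) (E r)

theorem Best.of_eq {N : PathNetwork n} {T sd b r : ℕ} {E : ℕ → ℝ} {σ τ : State}
    (h : Best N T sd b E r σ) (h1 : τ.narr aOpt r = σ.narr aOpt r)
    (h2 : τ.rarr aVal r = σ.rarr aVal r) : Best N T sd b E r τ := by
  constructor
  · rw [h1]; exact h.isFirstMin
  · rw [h1, h2]; exact h.value

/-- The best vertex for the event `r` lies between those for the neighbouring events that have been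
treated, `col` and, if there is a next one, that of `r + s`. The time is linear in the length of
this interval, in `s`, and in the decrease of the pointer, which has moved up by at most `2 s`
before. -/
theorem run_cmdLevelRow (N : PathNetwork n) {σ : State} {T sd b q s r col : ℕ} {E : ℕ → ℝ}
    (hL : Loaded N T sd b σ) (hb : 1 ≤ b ∧ b ≤ n) (hm : 1 < mir n sd b)
    (hE : EventList N T sd b q E) (hev : σ.rarr aEv = E) (hq : σ.nvar vQ = q)
    (hs : σ.nvar vS = s) (hvr : σ.nvar vR = r) (hr1 : 1 ≤ r) (hrq : r ≤ q)
    (hcol : σ.nvar vCol = col) (hc1 : 1 ≤ col) (hcb : col < mir n sd b)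
    (hW : n ≤ W) (hW' : q + 2 * s ≤ W) (hp : σ.nvar vP ≤ σ.nvar vLen)
    (hopt : ∀ i, IsFirstMin (fun i => phiS N T sd b i (E r)) 1 (mir n sd b - 1) i → col ≤ i)
    (hbest : r + s ≤ q → Best N T sd b E (r + s) σ)
    (hup : ∀ p' ≤ σ.nvar vLen, (∀ l, σ.nvar vP ≤ l → l < p' →
      σ.rarr aV l ≤ mx (offS N T sd b) col (mir n sd b) + E r) → p' - σ.nvar vP ≤ 2 * s) :
    Run W cmdLevelRow σ fun τ t => τ.nvar vR = r + 2 * s ∧ Best N T sd b E r τ ∧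
      (∀ r' ≠ r, τ.narr aOpt r' = σ.narr aOpt r' ∧ τ.rarr aVal r' = σ.rarr aVal r') ∧
      col ≤ τ.nvar vCol ∧ τ.nvar vCol < mir n sd b ∧
      (r + s ≤ q → τ.nvar vCol = σ.narr aOpt (r + s)) ∧
      IsRank (σ.rarr aV) (σ.nvar vLen) (mx (offS N T sd b) (τ.nvar vCol) (mir n sd b) + E r)
        (τ.nvar vP) ∧
      t + 20 * τ.nvar vP + 120 * col ≤ 120 * τ.nvar vCol + 20 * σ.nvar vP + 74 * s + 300 := by
  have hbm := mir_mem (sd := sd) hb.1 hb.2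
  have hlen := hL.records.len_le
  obtain ⟨i₀, hi₀⟩ := exists_isFirstMin (fun i => phiS N T sd b i (E r))
    (show 1 ≤ mir n sd b - 1 by omega)
  refine Run.seq (R := fun τ t => i₀ ≤ τ.nvar vHc ∧ τ.nvar vHc < mir n sd b ∧
      (r + s ≤ q → τ.nvar vHc = σ.narr aOpt (r + s)) ∧ t ≤ 20) ?_ ?_
  · simp [hq, hvr, hs, hL.bb_eq]
    constructor
    · intro hlt
      have := hi₀.le
      exact ⟨by omega, by omega, by omega, fun h => by omega⟩
    · intro hle
      have hB := (hbest hle).isFirstMin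
      have g1 := hB.le
      have := isFirstMin_phiS_mono N hb (hE.sorted r (r + s) hr1 (by omega) hle) hm hi₀ hB
      exact ⟨by omega, by omega, by omega⟩
  rintro τ₁ t₁ hA₁ ⟨h1, h2, h3, ht₁⟩
  have hL₁ : Loaded N T sd b τ₁ := hL.of_agree hA₁ (by decide) (by decide) (by decide)
  have hcol₁ : τ₁.nvar vCol = col := by rw [hA₁.nvar _ (by decide), hcol]
  have hR₁ : τ₁.nvar vR = r := by rw [hA₁.nvar _ (by decide), hvr]
  have hev₁ : τ₁.rarr aEv = E := by rw [hA₁.rarr _ (by decide), hev]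
  have hV₁ : τ₁.rarr aV = σ.rarr aV := hA₁.rarr _ (by decide)
  have hlen₁ : τ₁.nvar vLen = σ.nvar vLen := hA₁.nvar _ (by decide)
  have hP₁ : τ₁.nvar vP = σ.nvar vP := hA₁.nvar _ (by decide)
  have hM := (hL₁.phi col hc1 hcb).1
  refine Run.seq (run_cmdUp (t := mx (offS N T sd b) col (mir n sd b) + E r)
    (by rw [hcol₁, hR₁, hev₁, hM]) hV₁ hlen₁ hP₁ hp (by omega)) ?_
  rintro τ₂ t₂ hA₂ ⟨g1, g2, g3, g4, ht₂⟩
  have hcnt := hup _ g2 g3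
  have hL₂ : Loaded N T sd b τ₂ := hL₁.of_agree hA₂ (by decide) (by decide) (by decide)
  have hV₂ : τ₂.rarr aV = σ.rarr aV := by rw [hA₂.rarr _ (by decide), hV₁]
  have hlen₂ : τ₂.nvar vLen = σ.nvar vLen := by rw [hA₂.nvar _ (by decide), hlen₁]
  have hHc₂ : τ₂.nvar vHc = τ₁.nvar vHc := hA₂.nvar _ (by decide)
  have hi₀c := hopt i₀ hi₀
  refine Run.seq (run_cmdScan N (δ := E r) hL₂ hb hc1 (hi₀c.trans h1) h2
    (by rw [hA₂.nvar _ (by decide), hcol₁]) hHc₂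
    (by rw [hA₂.rarr _ (by decide), hA₂.nvar _ (by decide), hev₁, hR₁]) hW (by omega) ?_) ?_
  · intro l c1 c2
    rw [hlen₂] at c1
    rw [hV₂]
    have c3 := g4 (by omega)
    rcases c2.lt_or_eq with c4 | c4
    · have := hL.records.strict _ l c4 c1
      linarith
    · rwa [← c4]
  rintro τ₃ t₃ hA₃ ⟨k1, k2, k3, ht₃⟩
  rw [hV₂, hlen₂] at k3
  have hHc₃ : τ₃.nvar vHc = τ₁.nvar vHc := by rw [hA₃.nvar _ (by decide), hHc₂]
  have hR₃ : τ₃.nvar vR = r := by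
    rw [hA₃.nvar _ (by decide), hA₂.nvar _ (by decide), hR₁]
  have hS₃ : τ₃.nvar vS = s := by
    rw [hA₃.nvar _ (by decide), hA₂.nvar _ (by decide), hA₁.nvar _ (by decide), hs]
  have hO₃ : τ₃.narr aOpt = σ.narr aOpt := by
    rw [hA₃.narr _ (by decide), hA₂.narr _ (by decide), hA₁.narr _ (by decide)]
  have hVal₃ : τ₃.rarr aVal = σ.rarr aVal := by
    rw [hA₃.rarr _ (by decide), hA₂.rarr _ (by decide), hA₁.rarr _ (by decide)]
  have hfin := hi₀.extend k1 hc1 (by omega) hi₀c h1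
  have hle := k1.le
  simp only [Cmd.block, run_seq, run_storeN, run_storeR, run_setN]
  simp [hR₃, hS₃, hHc₃, hO₃, hVal₃]
  refine ⟨by omega, by omega, by omega, ⟨by simpa using hfin, by simpa using k2⟩, ?_, by omega,
    h2, h3, k3, by omega⟩
  intro r' hr'
  simp [hr']

/-- The best vertices are known for the multiples of `2 s`, and for those of `s` before the current
event. -/
structure LevelInv (N : PathNetwork n) (T sd b : ℕ) (E : ℕ → ℝ) (q s m : ℕ) (σ : State) :
    Prop where
  r_eq : σ.nvar vR = 2 * s * m + s
  col_ge : 1 ≤ σ.nvar vCol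
  col_lt : σ.nvar vCol < mir n sd b
  start : m = 0 → σ.nvar vCol = 1 ∧ σ.nvar vP = σ.nvar vLen
  col_eq : 0 < m → 2 * s * m ≤ q → σ.nvar vCol = σ.narr aOpt (2 * s * m)
  rank : ∀ m', m = m' + 1 → IsRank (σ.rarr aV) (σ.nvar vLen)
    (mx (offS N T sd b) (σ.nvar vCol) (mir n sd b) + E (2 * s * m' + s)) (σ.nvar vP)
  best : ∀ j, 1 ≤ s * j → s * j ≤ q → (2 ∣ j ∨ j < 2 * m + 1) → Best N T sd b E (s * j) σ

/-- Within a round the searched intervals overlap in end points only, and the way of the pointer up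
is bounded by the number of events, so that the round takes linear time. -/
theorem run_cmdLevel (N : PathNetwork n) {σ : State} {T sd b q s : ℕ} {E : ℕ → ℝ}
    (hL : Loaded N T sd b σ) (hb : 1 ≤ b ∧ b ≤ n) (hm : 1 < mir n sd b)
    (hE : EventList N T sd b q E) (hev : σ.rarr aEv = E) (hq : σ.nvar vQ = q)
    (hs : σ.nvar vS = s) (hs1 : 1 ≤ s) (hW : n ≤ W) (hW' : q + 2 * s ≤ W)
    (hbest : ∀ j, 1 ≤ 2 * s * j → 2 * s * j ≤ q → Best N T sd b E (2 * s * j) σ) :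
    Run W cmdLevel σ fun τ t =>
      (∀ j, 1 ≤ s * j → s * j ≤ q → Best N T sd b E (s * j) τ) ∧ t ≤ 1000 * (q + n + 1) := by
  have hbm := mir_mem (sd := sd) hb.1 hb.2
  refine Run.seq (R := fun τ t => τ.nvar vR = s ∧ τ.nvar vCol = 1 ∧ τ.nvar vP = τ.nvar vLen ∧
    t ≤ 20) ?_ ?_
  · have := hL.records.len_le
    simp [hs]
    omega
  rintro σ₁ t₁ hA₁ ⟨h1, h2, h3, ht₁⟩
  have hL₁ : Loaded N T sd b σ₁ := hL.of_agree hA₁ (by decide) (by decide) (by decide)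
  have hev₁ : σ₁.rarr aEv = E := by rw [hA₁.rarr _ (by decide), hev]
  have hq₁ : σ₁.nvar vQ = q := by rw [hA₁.nvar _ (by decide), hq]
  have hs₁ : σ₁.nvar vS = s := by rw [hA₁.nvar _ (by decide), hs]
  have hlen := hL₁.records.len_le
  refine Run.loop (fun τ => ∃ m, LevelInv N T sd b E q s m τ)
    -- the terms pay for the events left, the steps of the pointer, and the vertices left
    (fun τ => 400 * (if τ.nvar vR ≤ q then q + 2 * s - τ.nvar vR else 0) + 20 * τ.nvar vP +
      120 * (mir n sd b - τ.nvar vCol)) ?_ ?_ ?_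
  · refine ⟨0, by simpa using h1, by omega, by omega, fun _ => ⟨h2, h3⟩, by omega,
      fun m' h => by omega, fun j g1 g2 g3 => ?_⟩
    obtain ⟨i, rfl⟩ : 2 ∣ j := by
      rcases g3 with g3 | g3
      · exact g3
      · obtain rfl : j = 0 := by omega
        exact dvd_zero 2
    have e : s * (2 * i) = 2 * s * i := by ring
    rw [e] at g1 g2 ⊢
    exact (hbest i g1 g2).of_eq (by rw [hA₁.narr _ (by decide)]) (by rw [hA₁.rarr _ (by decide)])
  · rintro τ hA ⟨m, hI⟩ hbt
    have hL' : Loaded N T sd b τ := hL₁.of_agree hA (by decide) (by decide) (by decide)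
    have hev' : τ.rarr aEv = E := by rw [hA.rarr _ (by decide), hev₁]
    have hq' : τ.nvar vQ = q := by rw [hA.nvar _ (by decide), hq₁]
    have hs' : τ.nvar vS = s := by rw [hA.nvar _ (by decide), hs₁]
    simp only [BExp.eval, NExp.eval, hq', hI.r_eq, not_lt] at hbt
    have e1 : 2 * s * m + s + s = s * (2 * (m + 1)) := by ring
    have e2 : 2 * s * m = s * (2 * m) := by ring
    have e3 : 2 * s * m + s = s * (2 * m + 1) := by ring
    have hbr : 2 * s * m + s + s ≤ q → Best N T sd b E (2 * s * m + s + s) τ := fun h => by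
      rw [e1] at h ⊢
      exact hI.best _ (by omega) h (Or.inl (dvd_mul_right _ _))
    have hp : τ.nvar vP ≤ τ.nvar vLen := by
      rcases Nat.eq_zero_or_pos m with h0 | h0
      · rw [(hI.start h0).2]
      · exact (hI.rank (m - 1) (by omega)).1
    refine (run_cmdLevelRow N hL' hb hm hE hev' hq' hs' hI.r_eq (by omega) hbt rfl hI.col_ge
      hI.col_lt hW hW' hp ?_ hbr ?_).mono ?_
    · intro i hi
      rcases Nat.eq_zero_or_pos m with h0 | h0
      · rw [(hI.start h0).1]; exact hi.ge
      · have hpos : 1 ≤ s * (2 * m) := Nat.one_le_iff_ne_zero.2 (by positivity)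
        have hB := hI.best (2 * m) hpos (by omega) (Or.inl (dvd_mul_right _ _))
        rw [← e2] at hB hpos
        rw [hI.col_eq h0 (by omega)]
        exact isFirstMin_phiS_mono N hb (hE.sorted _ _ hpos (by omega) hbt) hm hB.isFirstMin hi
    · intro p' g1 g2
      rcases Nat.eq_zero_or_pos m with h0 | h0
      · rw [(hI.start h0).2]; omega
      · obtain ⟨m', rfl⟩ : ∃ m', m = m' + 1 := ⟨m - 1, by omega⟩
        have hr := hI.rank m' rfl
        have e4 : 2 * s * (m' + 1) = 2 * s * m' + 2 * s := by ring
        refine (hE.count hL'.records hI.col_ge hI.col_lt (a := 2 * s * m' + s)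
          (r := 2 * s * (m' + 1) + s) (by omega) (by omega) hbt g1 ?_ g2).trans (by omega)
        intro l c1 c2
        by_contra hc
        have := (hr.2 l c1).1 (not_lt.1 hc)
        omega
    · rintro τ' t' hA' ⟨c1, c2, c3, c4, c5, c6, c7, ht'⟩
      have hlen' : τ'.nvar vLen = τ.nvar vLen := hA'.nvar _ (by decide)
      have hV' : τ'.rarr aV = τ.rarr aV := hA'.rarr _ (by decide)
      have e4 : 2 * s * (m + 1) = 2 * s * m + 2 * s := by ring
      have hcg := hI.col_ge
      refine ⟨⟨m + 1, by omega, by omega, c5, by omega, fun _ g => ?_, fun m' g => ?_,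
        fun j g1 g2 g3 => ?_⟩, ?_⟩
      · rw [c6 (by omega), (c3 _ (by omega)).1]
        congr 1; omega
      · obtain rfl : m' = m := by omega
        rw [hlen', hV']; exact c7
      · by_cases hj : j = 2 * m + 1
        · rw [hj, ← e3]; exact c2
        · have hne : s * j ≠ 2 * s * m + s := by
            rw [e3]
            intro h
            exact hj (Nat.eq_of_mul_eq_mul_left hs1 h)
          exact (hI.best j g1 g2 (by omega)).of_eq (c3 _ hne).1 (c3 _ hne).2
      · simp only [BExp.cost, NExp.cost, hI.r_eq, c1]
        rw [if_pos hbt]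
        split_ifs <;> omega
  · rintro τ t hA ⟨m, hI⟩ hbt ht
    have hq' : τ.nvar vQ = q := by rw [hA.nvar _ (by decide), hq₁]
    simp only [BExp.eval, NExp.eval, hq', hI.r_eq, not_not] at hbt
    have e3 : 2 * s * m + s = s * (2 * m + 1) := by ring
    refine ⟨fun j g1 g2 => hI.best j g1 g2 (Or.inr ?_), ?_⟩
    · rw [e3] at hbt
      exact lt_of_mul_lt_mul_left (g2.trans_lt hbt) (Nat.zero_le s)
    · simp only [BExp.cost, NExp.cost, h1, h2, h3] at ht
      split_ifs at ht <;> omega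

/-- At the start the stride exceeds the number of events, so that nothing has to be known; after
`Lg` halvings it is `1`, so that all events have been treated. -/
theorem run_cmdMinima (N : PathNetwork n) {σ : State} {T sd b q : ℕ} {E : ℕ → ℝ}
    (hP : Prepared N σ) (hL : Loaded N T sd b σ) (hb : 1 ≤ b ∧ b ≤ n) (hm : 1 < mir n sd b)
    (hE : EventList N T sd b q E) (hev : σ.rarr aEv = E) (hq : σ.nvar vQ = q)
    (hqle : q < σ.nvar vBig) (hW : n ≤ W) (hW' : q + 2 * σ.nvar vBig ≤ W) :
    Run W cmdMinima σ fun τ t => (∀ r, 1 ≤ r → r ≤ q → Best N T sd b E r τ) ∧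
      t ≤ 1100 * ((q + n + 1) * (σ.nvar vLg + 1)) := by
  obtain ⟨Lg, hLg⟩ : ∃ Lg, σ.nvar vLg = Lg := ⟨_, rfl⟩
  have hbig : σ.nvar vBig = 2 ^ Lg := by rw [hP.big_eq, hLg]
  have hLW : Lg < 2 ^ Lg := Nat.lt_two_pow_self
  rw [hbig] at hW' hqle
  rw [cmdMinima, run_seq, run_setN]
  refine ⟨by simp [hbig]; omega, ?_⟩
  refine Run.forUp 0 Lg (fun k τ => τ.nvar vS = 2 ^ (Lg - k) ∧
      ∀ j, 1 ≤ 2 ^ (Lg - k) * j → 2 ^ (Lg - k) * j ≤ q → Best N T sd b E (2 ^ (Lg - k) * j) τ)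
      (fun k _ => 1050 * ((q + n + 1) * (Lg - k)))
      (by decide) (by simp) (by omega) (by omega) ?_ ?_ ?_ ?_
  · refine ⟨by simp [hbig], fun j g1 g2 => ?_⟩
    rw [Nat.sub_zero] at g1 g2
    have hj : 1 ≤ j := by
      by_contra hj
      obtain rfl : j = 0 := by omega
      simp at g1
    have := Nat.mul_le_mul_left (2 ^ Lg) hj
    omega
  · intro τ hA
    simpa [hLg] using hA.nvar vLg (by decide)
  · rintro k τ hA hk - hk2 ⟨g1, g2⟩
    obtain ⟨d, hd⟩ : ∃ d, Lg - k = d + 1 := ⟨Lg - k - 1, by omega⟩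
    have hd' : Lg - (k + 1) = d := by omega
    rw [hd] at g1 g2
    have hpow : 2 ^ (d + 1) ≤ 2 ^ Lg := Nat.pow_le_pow_right (by omega) (by omega)
    have hpos : 1 ≤ 2 ^ d := Nat.one_le_two_pow
    rw [pow_succ] at hpow
    have hdiv : 2 ^ (d + 1) / 2 = 2 ^ d := by rw [pow_succ]; omega
    have hL' : Loaded N T sd b τ := hL.of_agree (c := cmdMinima) (τ := τ)
      ⟨fun x hx => by
          rw [hA.nvar x (fun h => hx (by simp [cmdMinima, Cmd.modNVar, h])), nvar_setN, if_neg]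
          rintro rfl; exact hx (by decide),
        fun x hx => hA.rvar x hx, fun x hx => hA.narr x hx, fun x hx => hA.rarr x hx⟩
      (by decide) (by decide) (by decide)
    have hev' : τ.rarr aEv = E := by rw [hA.rarr _ (by decide)]; simpa using hev
    have hq' : τ.nvar vQ = q := by rw [hA.nvar _ (by decide)]; simpa using hq
    rw [run_seq, run_setN]
    simp only [NExp.eval, g1, hdiv]
    refine ⟨by omega, ?_⟩
    have hL'' : Loaded N T sd b (τ.setN vS (2 ^ d)) := ⟨by simpa using hL'.bb_eq,
      hL'.records.of_eq (by simp) rfl rfl rfl rfl, hL'.phi⟩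
    have e : 2 ^ (d + 1) = 2 * 2 ^ d := by rw [pow_succ, mul_comm]
    refine (run_cmdLevel N (s := 2 ^ d) hL'' hb hm hE (by simpa using hev') (by simpa using hq')
      (by simp) hpos hW (by omega) ?_).mono ?_
    · rw [← e]
      intro j c1 c2
      exact (g2 j c1 c2).of_eq rfl rfl
    · rintro τ' t' hA' ⟨c1, ht'⟩
      have e1 : τ'.nvar vS = 2 ^ d := by rw [hA'.nvar _ (by decide)]; simp
      rw [hd, hd']
      refine ⟨⟨by simp [e1], fun j c2 c3 => (c1 j c2 c3).of_eq rfl rfl⟩, ?_⟩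
      simp only [NExp.cost]
      rw [mul_add]
      omega
  · rintro τ t hA hk ⟨g1, g2⟩ ht
    rw [Nat.sub_self, pow_zero] at g2
    refine ⟨fun r c1 c2 => by simpa using g2 r (by omega) (by omega), ?_⟩
    simp at ht ⊢
    rw [hLg, mul_add]
    omega

/-! ### Correctness: the scenarios with a given type and boundary vertex -/

/-- The vertex kept for event `r` is at least as good as the boundary vertex and all vertices on the
sides before `sd₀`. -/
structure Candidate (N : PathNetwork n) (T b : ℕ) (E : ℕ → ℝ) (sd₀ r : ℕ) (σ : State) : Prop where
  idx_ge : 1 ≤ σ.narr aIdx r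
  idx_le : σ.narr aIdx r ≤ n
  value : σ.rarr aBest r =
    N.cap * N.Phi (scen N T b (N.lo b + E r)) (N.pos (σ.narr aIdx r))
  le_boundary : σ.rarr aBest r ≤ phiB N T b
  le_side : ∀ sd < sd₀, ∀ i, 1 ≤ i → i < mir n sd b → σ.rarr aBest r ≤ phiS N T sd b i (E r)

theorem Candidate.of_eq {N : PathNetwork n} {T b sd₀ r : ℕ} {E : ℕ → ℝ} {σ τ : State}
    (h : Candidate N T b E sd₀ r σ) (h1 : τ.narr aIdx r = σ.narr aIdx r)
    (h2 : τ.rarr aBest r = σ.rarr aBest r) : Candidate N T b E sd₀ r τ := by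
  constructor
  · rw [h1]; exact h.idx_ge
  · rw [h1]; exact h.idx_le
  · rw [h1, h2]; exact h.value
  · rw [h2]; exact h.le_boundary
  · rw [h2]; exact h.le_side

/-- After both sides have been treated, the vertex kept is at least as good as every vertex. -/
theorem Candidate.isSink {N : PathNetwork n} {T b r : ℕ} {E : ℕ → ℝ} {σ : State}
    (h : Candidate N T b E 2 r σ) (hT : T < 2) (hb : 1 ≤ b ∧ b ≤ n) (hE : 0 ≤ E r) :
    N.IsSink (scen N T b (N.lo b + E r)) (N.pos (σ.narr aIdx r)) := by
  refine isSink_of_forall_vertex N (fun i h1 h2 => scen_nonneg N hb (by linarith) h1 h2)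
    h.idx_ge h.idx_le fun j h1 h2 => ?_
  rw [← h.value]
  rcases lt_trichotomy j b with g | rfl | g
  · rw [← mir_zero n j, cap_mul_Phi_side N hT (by norm_num) hb h1 (by rwa [mir_zero])]
    exact h.le_side 0 (by norm_num) j h1 (by rwa [mir_zero])
  · rw [cap_mul_Phi_boundary N hT hb]
    exact h.le_boundary
  · have e : mir n 1 (n + 1 - j) = j := by rw [mir_one]; omega
    have e' : n + 1 - j < mir n 1 b := by rw [mir_one]; omega
    have g1 : 1 ≤ n + 1 - j := by omega
    have := cap_mul_Phi_side N hT (show 1 < 2 by norm_num) hb g1 e' (E r)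
    rw [e] at this
    rw [this]
    exact h.le_side 1 (by norm_num) _ g1 e'

theorem run_cmdInitBest (N : PathNetwork n) {σ : State} {T b q : ℕ} {E : ℕ → ℝ}
    (hP : Prepared N σ) (hT : T < 2) (hb : 1 ≤ b ∧ b ≤ n) (hvT : σ.nvar vT = T)
    (hvb : σ.nvar vB = b) (hq : σ.nvar vQ = q) (hW : q + 1 ≤ W) (hnW : n ≤ W) :
    Run W cmdInitBest σ fun τ t => (∀ r, 1 ≤ r → r ≤ q → Candidate N T b E 0 r τ) ∧
      t ≤ 60 * (q + 1) := by
  refine Run.forUp 1 (q + 1) (fun k τ => ∀ r, 1 ≤ r → r < k → Candidate N T b E 0 r τ)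
    (fun k _ => 50 * (q + 1 - k)) (by decide) (by simp) (by omega) hW
    (fun r h1 h2 => by omega) ?_ ?_ ?_
  · intro τ hA
    simpa [hq] using hA.nvar vQ (by decide)
  · intro k τ hA hk h1 h2 hI
    have hP' : Prepared N τ := hP.of_agree hA (by decide) (by decide)
    have e1 : τ.nvar vT = T := by rw [hA.nvar _ (by decide), hvT]
    have e2 : τ.nvar vB = b := by rw [hA.nvar _ (by decide), hvb]
    have hk0 : T = 1 - kap T 0 := by unfold kap; split_ifs <;> omega
    have hk1 : 1 - T = 1 - kap T 1 := by unfold kap; split_ifs <;> omega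
    have f0 := (hP'.row 0 (by norm_num) T hT b hb.1 hb.2).cost_eq
    have f1 := (hP'.row 1 (by norm_num) (1 - T) (by omega) (n + 1 - b) (by omega)
      (by omega)).cost_eq
    rw [mul_zero, zero_add] at f0
    simp [e1, e2, hk, hP'.n_eq]
    rw [mul_one] at f1
    refine ⟨by omega, fun r g1 g2 => ?_, by omega⟩
    rcases g2.lt_or_eq with g | rfl
    · refine (hI r g1 (by omega)).of_eq ?_ ?_
      · simp [show r ≠ k by omega]
      · simp [show r ≠ k by omega]
    · have hv : costS N T 0 b + costS N (1 - T) 1 (n + 1 - b) = phiB N T b := by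
        rw [phiB, ← hk0, ← hk1]
      constructor <;> simp [f0, f1, hv, hb, cap_mul_Phi_boundary N hT hb]
  · intro τ t hA hk hI ht
    simp at ht
    exact ⟨fun r g1 g2 => hI r g1 (by omega), by omega⟩

theorem run_cmdImprove (N : PathNetwork n) {σ : State} {T sd b q : ℕ} {E : ℕ → ℝ}
    (hT : T < 2) (hsd : sd < 2) (hb : 1 ≤ b ∧ b ≤ n) (hm : 1 < mir n sd b) (hn : σ.nvar vN = n)
    (hvsd : σ.nvar vSd = sd) (hq : σ.nvar vQ = q) (hW : q + 1 ≤ W) (hnW : n ≤ W)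
    (hB : ∀ r, 1 ≤ r → r ≤ q → Best N T sd b E r σ)
    (hC : ∀ r, 1 ≤ r → r ≤ q → Candidate N T b E sd r σ) :
    Run W cmdImprove σ fun τ t => (∀ r, 1 ≤ r → r ≤ q → Candidate N T b E (sd + 1) r τ) ∧
      t ≤ 60 * (q + 1) := by
  have hbm := mir_mem (sd := sd) hb.1 hb.2
  refine Run.forUp 1 (q + 1) (fun k τ => (∀ r, 1 ≤ r → r < k → Candidate N T b E (sd + 1) r τ) ∧
      ∀ r, k ≤ r → r ≤ q → Candidate N T b E sd r τ)
    (fun k _ => 50 * (q + 1 - k)) (by decide) (by simp) (by omega) hW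
    ⟨fun r h1 h2 => by omega, fun r h1 h2 => (hC r h1 h2).of_eq rfl rfl⟩ ?_ ?_ ?_
  · intro τ hA
    simpa [hq] using hA.nvar vQ (by decide)
  · rintro k τ hA hk h1 h2 ⟨hI, hI'⟩
    have e1 : τ.nvar vN = n := by rw [hA.nvar _ (by decide), hn]
    have e2 : τ.nvar vSd = sd := by rw [hA.nvar _ (by decide), hvsd]
    have e3 : τ.narr aOpt = σ.narr aOpt := hA.narr _ (by decide)
    have e4 : τ.rarr aVal = σ.rarr aVal := hA.rarr _ (by decide)
    obtain ⟨hB1, hB2⟩ := hB k h1 (by omega)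
    have hle := hB1.le
    have hge := hB1.ge
    have hval : σ.rarr aVal k = N.cap * N.Phi (scen N T b (N.lo b + E k))
        (N.pos (mir n sd (σ.narr aOpt k))) := by
      rw [cap_mul_Phi_side N hT hsd hb hge (by omega), hB2]
    have hmm := mir_mem (n := n) (sd := sd) hge (by omega)
    have hCk := hI' k le_rfl (by omega)
    have hnew : ∀ τ' : State, σ.rarr aVal k < τ.rarr aBest k →
        τ'.narr aIdx = Function.update (τ.narr aIdx) k (mir n sd (σ.narr aOpt k)) →
        τ'.rarr aBest = Function.update (τ.rarr aBest) k (σ.rarr aVal k) →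
        (∀ r, 1 ≤ r → r < k + 1 → Candidate N T b E (sd + 1) r τ') ∧
          ∀ r, k + 1 ≤ r → r ≤ q → Candidate N T b E sd r τ' := by
      intro τ' hlt g1 g2
      refine ⟨fun r g3 g4 => ?_, fun r g3 g4 => ?_⟩
      · rcases Nat.lt_or_ge r k with g | g
        · refine (hI r g3 g).of_eq ?_ ?_
          · rw [g1, Function.update_of_ne (by omega)]
          · rw [g2, Function.update_of_ne (by omega)]
        · obtain rfl : r = k := by omega
          have c1 : τ'.narr aIdx r = mir n sd (σ.narr aOpt r) := by
            rw [g1, Function.update_self]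
          have c2 : τ'.rarr aBest r = σ.rarr aVal r := by rw [g2, Function.update_self]
          constructor
          · rw [c1]; exact hmm.1
          · rw [c1]; exact hmm.2
          · rw [c1, c2]; exact hval
          · rw [c2]; exact hlt.le.trans hCk.le_boundary
          · rw [c2]
            intro sd' hsd' i g5 g6
            rcases Nat.lt_or_ge sd' sd with g7 | g7
            · exact hlt.le.trans (hCk.le_side sd' g7 i g5 g6)
            · obtain rfl : sd' = sd := by omega
              rw [hB2]
              exact hB1.min i g5 (by omega)
      · refine (hI' r (by omega) g4).of_eq ?_ ?_
        · rw [g1, Function.update_of_ne (by omega)]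
        · rw [g2, Function.update_of_ne (by omega)]
    rw [run_branch]
    simp only [BExp.eval, NExp.eval, RExp.eval, hk, e4]
    constructor
    · intro hlt
      rw [run_seq, run_storeR, run_branch]
      constructor
      · intro hs
        simp [e2] at hs
        subst hs
        simp [hk, e3, e4]
        refine ⟨by omega, ?_, by omega⟩
        have := hnew (((τ.putR aBest k (σ.rarr aVal k)).putN aIdx k
          (σ.narr aOpt k)).setN vR (k + 1)) hlt (by simp [mir_zero]) (by simp)
        exact ⟨fun r g1 g2 => this.1 r g1 (by omega), this.2⟩
      · intro hs
        simp [e2] at hs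
        obtain rfl : sd = 1 := by omega
        simp [hk, e1, e3, e4]
        refine ⟨by omega, ?_, by omega⟩
        have := hnew (((τ.putR aBest k (σ.rarr aVal k)).putN aIdx k
          (n + 1 - σ.narr aOpt k)).setN vR (k + 1)) hlt (by simp [mir_one]) (by simp)
        exact ⟨fun r g1 g2 => this.1 r g1 (by omega), this.2⟩
    · intro hge'
      rw [run_nop]
      refine ⟨⟨fun r g3 g4 => ?_, fun r g3 g4 => (hI' r (by omega) g4).of_eq rfl rfl⟩,
        by simp; omega⟩
      rcases Nat.lt_or_ge r k with g | g
      · exact (hI r g3 g).of_eq rfl rfl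
      · obtain rfl : r = k := by omega
        refine Candidate.of_eq ⟨hCk.idx_ge, hCk.idx_le, hCk.value, hCk.le_boundary, ?_⟩
          (σ := τ) rfl rfl
        intro sd' hsd' i g5 g6
        rcases Nat.lt_or_ge sd' sd with g7 | g7
        · exact hCk.le_side sd' g7 i g5 g6
        · obtain rfl : sd' = sd := by omega
          have := hB1.min i g5 (by omega)
          rw [← hB2] at this
          exact (not_lt.1 hge').trans this
  · rintro τ t hA hk ⟨hI, -⟩ ht
    simp at ht
    exact ⟨fun r g1 g2 => hI r g1 (by omega), by omega⟩

theorem run_cmdCollect (N : PathNetwork n) {σ : State} {T b : ℕ} (hP : Prepared N σ)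
    (hb : 1 ≤ b ∧ b ≤ n) (hvT : σ.nvar vT = T) (hvb : σ.nvar vB = b) (hW : n + 4 ≤ W)
    (hW' : (evS N T 0 b).card + (evS N T 1 b).card ≤ W) :
    Run W cmdCollect σ fun τ t => τ.nvar vQ ≤ (evS N T 0 b).card + (evS N T 1 b).card ∧
      (∀ r, 1 ≤ r → r ≤ τ.nvar vQ → ∃ sd < 2, ∃ e ∈ evS N T sd b,
        τ.rarr aEv r = evVal N T sd b e) ∧
      (∀ sd < 2, ∀ e ∈ evS N T sd b, ∃ r, 1 ≤ r ∧ r ≤ τ.nvar vQ ∧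
        τ.rarr aEv r = evVal N T sd b e) ∧
      t ≤ 1100 * (n + 1 + (evS N T 0 b).card + (evS N T 1 b).card) := by
  obtain ⟨m, hm⟩ : ∃ m, m = (evS N T 0 b).card + (evS N T 1 b).card := ⟨_, rfl⟩
  have hsum : ∀ k ≤ 2, ∑ sd ∈ Finset.range k, (evS N T sd b).card ≤ m := by
    intro k hk
    refine (Finset.sum_le_sum_of_subset (Finset.range_mono hk)).trans ?_
    rw [Finset.sum_range_succ, Finset.sum_range_one, hm]
  rw [cmdCollect, run_seq, run_setN]
  refine ⟨by simp, ?_⟩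
  refine Run.forUp 0 2 (fun k τ =>
      τ.nvar vQ ≤ ∑ sd ∈ Finset.range k, (evS N T sd b).card ∧
      (∀ r, 1 ≤ r → r ≤ τ.nvar vQ → ∃ sd < 2, ∃ e ∈ evS N T sd b,
        τ.rarr aEv r = evVal N T sd b e) ∧
      (∀ sd < k, ∀ e ∈ evS N T sd b, ∃ r, 1 ≤ r ∧ r ≤ τ.nvar vQ ∧
        τ.rarr aEv r = evVal N T sd b e))
      (fun k _ => 520 * (n + 1 + m) * (2 - k)) (by decide) (by simp) (by omega) (by omega)
      ?_ (fun τ _ => by simp) ?_ ?_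
  · simp
    intro r h1 h2
    omega
  · rintro k τ hA hk - hk2 ⟨h1, h2, h3⟩
    have hP' : Prepared N τ := by
      refine hP.of_agree (c := cmdCollect) ⟨fun x hx => ?_, fun x hx => hA.rvar x hx,
        fun x hx => hA.narr x hx, fun x hx => hA.rarr x hx⟩ (by decide) (by decide)
      rw [hA.nvar x (fun h => hx (by simp [cmdCollect, Cmd.modNVar, h])), nvar_setN, if_neg]
      rintro rfl; exact hx (by decide)
    refine Run.seq (run_cmdLoad N hW hP' (T := T) (sd := k) (b := b) hk2 hb
      (by rw [hA.nvar _ (by decide)]; simpa using hvT) hk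
      (by rw [hA.nvar _ (by decide)]; simpa using hvb)) ?_
    rintro τ₁ t₁ hA₁ ⟨hL₁, ht₁⟩
    have hP₁ : Prepared N τ₁ := hP'.of_agree hA₁ (by decide) (by decide)
    have hq₁ : τ₁.nvar vQ = τ.nvar vQ := hA₁.nvar _ (by decide)
    have hE₁ : τ₁.rarr aEv = τ.rarr aEv := hA₁.rarr _ (by decide)
    have hs := hsum (k + 1) hk2
    rw [Finset.sum_range_succ] at hs
    refine (run_cmdEvents N hP₁ hL₁ hb
      (by rw [hA₁.nvar _ (by decide), hA.nvar _ (by decide)]; simpa using hvb) hq₁ (by omega)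
      (by omega)).mono ?_
    rintro τ₂ t₂ hA₂ ⟨g1, g2, g3, g4, g5, ht₂⟩
    rw [hE₁] at g3
    refine ⟨⟨?_, fun r c1 c2 => ?_, fun sd c1 e he => ?_⟩, ?_⟩
    · rw [nvar_setN, if_neg (by decide), Finset.sum_range_succ]; omega
    · rw [nvar_setN, if_neg (by decide)] at c2
      rw [rarr_setN]
      rcases Nat.lt_or_ge (τ.nvar vQ) r with c | c
      · exact ⟨k, hk2, g4 r c c2⟩
      · rw [g3 r c]; exact h2 r c1 c
    · rw [nvar_setN, if_neg (by decide), rarr_setN]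
      rcases Nat.lt_or_ge sd k with c | c
      · obtain ⟨r, d1, d2, d3⟩ := h3 sd c e he
        exact ⟨r, d1, by omega, by rw [g3 r d2, d3]⟩
      · obtain rfl : sd = k := by omega
        obtain ⟨r, d1, d2, d3⟩ := g5 e he
        exact ⟨r, by omega, d2, d3⟩
    · obtain ⟨d, hd⟩ : ∃ d, 2 - k = d + 1 := ⟨2 - k - 1, by omega⟩
      have hd' : 2 - (k + 1) = d := by omega
      simp only [NExp.cost]
      rw [hd, hd', Nat.mul_succ]
      omega
  · rintro τ t hA hk ⟨h1, h2, h3⟩ ht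
    have := hsum 2 le_rfl
    refine ⟨by omega, h2, h3, ?_⟩
    simp at ht ⊢
    omega

/-- A side without vertices before the boundary vertex is skipped. -/
theorem run_cmdSearch (N : PathNetwork n) {σ : State} {T b q : ℕ} {E : ℕ → ℝ} (hT : T < 2)
    (hP : Prepared N σ) (hb : 1 ≤ b ∧ b ≤ n) (hvT : σ.nvar vT = T) (hvb : σ.nvar vB = b)
    (hE : ∀ sd < 2, EventList N T sd b q E) (hev : σ.rarr aEv = E) (hq : σ.nvar vQ = q)
    (hqle : q ≤ 2 * (n + 1) ^ 2) (hW : 20 * (n + 1) ^ 2 ≤ W)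
    (hC : ∀ r, 1 ≤ r → r ≤ q → Candidate N T b E 0 r σ) :
    Run W cmdSearch σ fun τ t => (∀ r, 1 ≤ r → r ≤ q → Candidate N T b E 2 r τ) ∧
      t ≤ 4000 * ((q + n + 1) * (σ.nvar vLg + 1)) := by
  obtain ⟨Lg, hLg⟩ : ∃ Lg, σ.nvar vLg = Lg := ⟨_, rfl⟩
  have hbg := hP.big_gt
  have hbl := hP.big_le
  have hnn : n + 1 ≤ (n + 1) ^ 2 := by nlinarith
  rw [hLg]
  obtain ⟨X, hX⟩ : ∃ X, X = (q + n + 1) * (Lg + 1) := ⟨_, rfl⟩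
  have hX' : q + n + 1 ≤ X := by rw [hX]; exact Nat.le_mul_of_pos_right _ (by omega)
  rw [← hX]
  refine Run.forUp 0 2 (fun k τ => ∀ r, 1 ≤ r → r ≤ q → Candidate N T b E k r τ)
    (fun k _ => 1900 * X * (2 - k)) (by decide) (by simp) (by omega)
    (by omega) (fun r h1 h2 => (hC r h1 h2).of_eq rfl rfl) (fun τ _ => by simp) ?_ ?_
  · rintro k τ hA hk - hk2 hI
    have hP' : Prepared N τ := hP.of_agree hA (by decide) (by decide)
    have hbm := mir_mem (sd := k) hb.1 hb.2
    obtain ⟨d, hd⟩ : ∃ d, 2 - k = d + 1 := ⟨2 - k - 1, by omega⟩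
    have hd' : 2 - (k + 1) = d := by omega
    refine Run.seq (run_cmdLoad N (by omega) hP' (T := T) (sd := k) (b := b) hk2 hb
      (by rw [hA.nvar _ (by decide), hvT]) hk (by rw [hA.nvar _ (by decide), hvb])) ?_
    rintro τ₁ t₁ hA₁ ⟨hL₁, ht₁⟩
    have hP₁ : Prepared N τ₁ := hP'.of_agree hA₁ (by decide) (by decide)
    have hC₁ : ∀ r, 1 ≤ r → r ≤ q → Candidate N T b E k r τ₁ := fun r c1 c2 =>
      (hI r c1 c2).of_eq (by rw [hA₁.narr _ (by decide)]) (by rw [hA₁.rarr _ (by decide)])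
    have hq₁ : τ₁.nvar vQ = q := by rw [hA₁.nvar _ (by decide), hA.nvar _ (by decide), hq]
    have hLg₁ : τ₁.nvar vLg = Lg := by rw [hA₁.nvar _ (by decide), hA.nvar _ (by decide), hLg]
    have hbig₁ : τ₁.nvar vBig = σ.nvar vBig := by
      rw [hA₁.nvar _ (by decide), hA.nvar _ (by decide)]
    have hev₁ : τ₁.rarr aEv = E := by rw [hA₁.rarr _ (by decide), hA.rarr _ (by decide), hev]
    have hsd₁ : τ₁.nvar vSd = k := by rw [hA₁.nvar _ (by decide), hk]
    rw [run_branch]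
    simp only [BExp.eval, NExp.eval, hL₁.bb_eq]
    constructor
    · intro hm
      refine Run.seq (run_cmdMinima N hP₁ hL₁ hb hm (hE k hk2) hev₁ hq₁ (by omega) (by omega)
        (by omega)) ?_
      rintro τ₂ t₂ hA₂ ⟨hB₂, ht₂⟩
      rw [hLg₁, ← hX] at ht₂
      refine (run_cmdImprove N hT hk2 hb hm
        (by rw [hA₂.nvar _ (by decide), hP₁.n_eq]) (by rw [hA₂.nvar _ (by decide), hsd₁])
        (by rw [hA₂.nvar _ (by decide), hq₁]) (by omega) (by omega) hB₂
        (fun r c1 c2 => (hC₁ r c1 c2).of_eq (by rw [hA₂.narr _ (by decide)])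
          (by rw [hA₂.rarr _ (by decide)]))).mono ?_
      rintro τ₃ t₃ - ⟨hC₃, ht₃⟩
      refine ⟨fun r c1 c2 => (hC₃ r c1 c2).of_eq rfl rfl, ?_⟩
      simp only [NExp.cost, BExp.cost]
      rw [hd, hd', Nat.mul_succ]
      omega
    · intro hm
      rw [run_nop]
      refine ⟨fun r c1 c2 => ?_, ?_⟩
      · obtain ⟨d1, d2, d3, d4, d5⟩ := hC₁ r c1 c2
        refine Candidate.of_eq (σ := τ₁) ⟨d1, d2, d3, d4, fun sd e1 i e2 e3 => ?_⟩ rfl rfl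
        rcases Nat.lt_or_ge sd k with c | c
        · exact d5 sd c i e2 e3
        · obtain rfl : sd = k := by omega
          omega
      · simp only [NExp.cost, BExp.cost]
        rw [hd, hd', Nat.mul_succ]
        omega
  · intro τ t hA hk hI ht
    refine ⟨hI, ?_⟩
    simp only [NExp.cost] at ht
    omega

theorem run_cmdReport {σ : State} {T b q cnt : ℕ} {lo : ℕ → ℝ} (hvT : σ.nvar vT = T)
    (hvb : σ.nvar vB = b) (hq : σ.nvar vQ = q) (hcnt : σ.nvar vCnt = cnt) (hlo : σ.rarr aLo = lo)
    (hW : cnt + q + 1 ≤ W) (hTW : T ≤ W) (hbW : b ≤ W)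
    (hi : ∀ r, 1 ≤ r → r ≤ q → σ.narr aIdx r ≤ W) :
    Run W cmdReport σ fun τ t => τ.nvar vCnt = cnt + q ∧
      (∀ r < cnt, τ.narr 0 r = σ.narr 0 r ∧ τ.narr 1 r = σ.narr 1 r ∧ τ.narr 2 r = σ.narr 2 r ∧
        τ.rarr 0 r = σ.rarr 0 r) ∧
      (∀ r, 1 ≤ r → r ≤ q → τ.narr 0 (cnt + r - 1) = T ∧ τ.narr 1 (cnt + r - 1) = b ∧
        τ.narr 2 (cnt + r - 1) = σ.narr aIdx r ∧
        τ.rarr 0 (cnt + r - 1) = lo b + σ.rarr aEv r) ∧ t ≤ 60 * (q + 1) := by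
  refine Run.forUp 1 (q + 1) (fun k τ => τ.nvar vCnt + 1 = cnt + k ∧
      (∀ r < cnt, τ.narr 0 r = σ.narr 0 r ∧ τ.narr 1 r = σ.narr 1 r ∧ τ.narr 2 r = σ.narr 2 r ∧
        τ.rarr 0 r = σ.rarr 0 r) ∧
      (∀ r, 1 ≤ r → r < k → τ.narr 0 (cnt + r - 1) = T ∧ τ.narr 1 (cnt + r - 1) = b ∧
        τ.narr 2 (cnt + r - 1) = σ.narr aIdx r ∧
        τ.rarr 0 (cnt + r - 1) = lo b + σ.rarr aEv r))
    (fun k _ => 50 * (q + 1 - k)) (by decide) (by simp) (by omega) (by omega) ?_ ?_ ?_ ?_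
  · refine ⟨by simpa using hcnt, fun r _ => ⟨rfl, rfl, rfl, rfl⟩, fun r h1 h2 => by omega⟩
  · intro τ hA
    simpa [hq] using hA.nvar vQ (by decide)
  · rintro k τ hA hk h1 h2 ⟨hI1, hI2, hI3⟩
    have e1 : τ.nvar vT = T := by rw [hA.nvar _ (by decide), hvT]
    have e2 : τ.nvar vB = b := by rw [hA.nvar _ (by decide), hvb]
    have e3 : τ.narr aIdx = σ.narr aIdx := hA.narr _ (by decide)
    have e4 : τ.rarr aEv = σ.rarr aEv := hA.rarr _ (by decide)
    have e5 : τ.rarr aLo = lo := by rw [hA.rarr _ (by decide), hlo]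
    have e6 : τ.nvar vCnt = cnt + k - 1 := by omega
    have := hi k h1 (by omega)
    simp [e1, e2, e3, e4, e5, e6, hk]
    refine ⟨by omega, by omega, by omega, by omega, ⟨by omega, fun r hr => ?_, fun r g1 g2 => ?_⟩,
      by omega⟩
    · simp only [Function.update_of_ne (show r ≠ cnt + k - 1 by omega)]
      exact hI2 r hr
    · rcases Nat.lt_or_ge r k with g | g
      · simp only [Function.update_of_ne (show cnt + r - 1 ≠ cnt + k - 1 by omega)]
        exact hI3 r g1 g
      · obtain rfl : r = k := by omega
        simp
  · rintro τ t hA hk ⟨hI1, hI2, hI3⟩ ht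
    simp at ht
    exact ⟨by omega, hI2, fun r g1 g2 => hI3 r g1 (by omega), by omega⟩

/-! ### Correctness: the complete program -/

/-- The records written so far are correct, and they comprise all events of those types and boundary
vertices that satisfy `D`. -/
structure Output (N : PathNetwork n) (D : ℕ → ℕ → Prop) (σ : State) : Prop where
  sound : ∀ r < σ.nvar vCnt, ∃ T < 2, ∃ b, (1 ≤ b ∧ b ≤ n) ∧ ∃ sd < 2, ∃ e ∈ evS N T sd b,
    σ.narr 0 r = T ∧ σ.narr 1 r = b ∧ σ.rarr 0 r = N.lo b + evVal N T sd b e ∧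
    (1 ≤ σ.narr 2 r ∧ σ.narr 2 r ≤ n) ∧
    N.IsSink (scen N T b (N.lo b + evVal N T sd b e)) (N.pos (σ.narr 2 r))
  complete : ∀ T < 2, ∀ b, 1 ≤ b → b ≤ n → D T b → ∀ sd < 2, ∀ e ∈ evS N T sd b,
    ∃ r < σ.nvar vCnt, σ.narr 0 r = T ∧ σ.narr 1 r = b ∧
      σ.rarr 0 r = N.lo b + evVal N T sd b e

theorem Output.of_eq {N : PathNetwork n} {D D' : ℕ → ℕ → Prop} {σ τ : State} (h : Output N D σ)
    (hD : ∀ T < 2, ∀ b, 1 ≤ b → b ≤ n → D' T b → D T b) (h1 : τ.nvar vCnt = σ.nvar vCnt)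
    (h2 : τ.narr = σ.narr) (h3 : τ.rarr = σ.rarr) : Output N D' τ := by
  constructor
  · rw [h1, h2, h3]; exact h.sound
  · rw [h1, h2, h3]; exact fun T g1 b g2 g3 g4 => h.complete T g1 b g2 g3 (hD T g1 b g2 g3 g4)

/-- All scenarios of type `T` with boundary vertex `v_b` are reported. The list of events of both
sides is common to the two searches for a best vertex. -/
theorem run_cmdVertex (N : PathNetwork n) {σ : State} {T b m Lg : ℕ} {D : ℕ → ℕ → Prop}
    (hP : Prepared N σ) (hT : T < 2) (hb : 1 ≤ b ∧ b ≤ n) (hvT : σ.nvar vT = T)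
    (hvb : σ.nvar vB = b) (hLg : σ.nvar vLg = Lg)
    (hm : (evS N T 0 b).card + (evS N T 1 b).card = m) (hm' : m ≤ 2 * (n + 1) ^ 2)
    (hW : 20 * (n + 1) ^ 2 ≤ W) (hcnt : σ.nvar vCnt + m + 1 ≤ W) (hO : Output N D σ) :
    Run W cmdVertex σ fun τ t => Output N (fun T' b' => D T' b' ∨ (T' = T ∧ b' = b)) τ ∧
      τ.nvar vCnt ≤ σ.nvar vCnt + m ∧ t ≤ 6000 * ((n + 1 + m) * (Lg + 1)) := by
  have hbg := hP.big_gt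
  have hbl := hP.big_le
  have hnn : n + 1 ≤ (n + 1) ^ 2 := by nlinarith
  have hbe := hP.big_eq
  rw [hLg] at hbe
  refine Run.seq (run_cmdCollect N hP hb hvT hvb (by omega) (by omega)) ?_
  rintro τ₁ t₁ hA₁ ⟨h1, h2, h3, ht₁⟩
  obtain ⟨q, hq⟩ : ∃ q, τ₁.nvar vQ = q := ⟨_, rfl⟩
  rw [hq] at h1 h2 h3
  refine Run.seq (run_cmdSort (q := q) (Lg := Lg) hq (by rw [hA₁.nvar _ (by decide), hLg])
    (by omega) (by omega)) ?_
  rintro τ₂ t₂ hA₂ ⟨h4, h5, ht₂⟩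
  have hA : Agree cmdVertex σ τ₂ := (hA₁.of_subset (d := cmdVertex) (by decide) (by decide)
    (by decide) (by decide)).trans (hA₂.of_subset (by decide) (by decide) (by decide) (by decide))
  have hP₂ : Prepared N τ₂ := hP.of_agree hA (by decide) (by decide)
  have hsound : ∀ r, 1 ≤ r → r ≤ q → ∃ sd < 2, ∃ e ∈ evS N T sd b,
      τ₂.rarr aEv r = evVal N T sd b e := fun r c1 c2 => by
    obtain ⟨r', c3, c4, c5⟩ := h5.1 r c1 (by omega)
    obtain ⟨sd, c6, e, c7, c8⟩ := h2 r' c3 (by omega)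
    exact ⟨sd, c6, e, c7, by rw [← c5, c8]⟩
  have hcomp : ∀ sd < 2, ∀ e ∈ evS N T sd b, ∃ r, 1 ≤ r ∧ r ≤ q ∧
      τ₂.rarr aEv r = evVal N T sd b e := fun sd c1 e c2 => by
    obtain ⟨r, c3, c4, c5⟩ := h3 sd c1 e c2
    obtain ⟨r', c6, c7, c8⟩ := h5.2 r c3 (by omega)
    exact ⟨r', c6, by omega, by rw [c8, c5]⟩
  have hE : ∀ sd < 2, EventList N T sd b q (τ₂.rarr aEv) := fun sd hsd => by
    refine ⟨h4, fun a c1 c2 => ?_, fun a c1 c2 => ?_, hcomp sd hsd⟩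
    · obtain ⟨sd', -, e, c3, c4⟩ := hsound a c1 c2
      rw [c4]; exact (mem_evS.1 c3).2.1
    · obtain ⟨sd', -, e, c3, c4⟩ := hsound a c1 c2
      rw [c4]; exact (mem_evS.1 c3).2.2
  have hq₂ : τ₂.nvar vQ = q := by rw [hA₂.nvar _ (by decide), hq]
  refine Run.seq (run_cmdInitBest N (E := τ₂.rarr aEv) hP₂ hT hb
    (by rw [hA.nvar _ (by decide), hvT])
    (by rw [hA₂.nvar _ (by decide), hA₁.nvar _ (by decide), hvb]) hq₂ (by omega) (by omega)) ?_
  rintro τ₃ t₃ hA₃ ⟨h6, ht₃⟩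
  have hP₃ : Prepared N τ₃ := hP₂.of_agree hA₃ (by decide) (by decide)
  have hT₃ : τ₃.nvar vT = T := by rw [hA₃.nvar _ (by decide), hA.nvar _ (by decide), hvT]
  have hB₃ : τ₃.nvar vB = b := by
    rw [hA₃.nvar _ (by decide), hA₂.nvar _ (by decide), hA₁.nvar _ (by decide), hvb]
  have hLg₃ : τ₃.nvar vLg = Lg := by rw [hA₃.nvar _ (by decide), hA.nvar _ (by decide), hLg]
  refine Run.seq (run_cmdSearch N hT hP₃ hb hT₃ hB₃ hE (hA₃.rarr _ (by decide))
    (by rw [hA₃.nvar _ (by decide), hq₂]) (by omega) hW h6) ?_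
  rintro τ₄ t₄ hA₄ ⟨h7, ht₄⟩
  rw [hLg₃] at ht₄
  have hcnt₄ : τ₄.nvar vCnt = σ.nvar vCnt := by
    rw [hA₄.nvar _ (by decide), hA₃.nvar _ (by decide), hA₂.nvar _ (by decide),
      hA₁.nvar _ (by decide)]
  have hnarr₄ : ∀ x < 3, τ₄.narr x = σ.narr x := fun x hx => by
    interval_cases x <;>
      rw [hA₄.narr _ (by decide), hA₃.narr _ (by decide), hA₂.narr _ (by decide),
        hA₁.narr _ (by decide)]
  have hrarr₄ : τ₄.rarr 0 = σ.rarr 0 := by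
    rw [hA₄.rarr _ (by decide), hA₃.rarr _ (by decide), hA₂.rarr _ (by decide),
      hA₁.rarr _ (by decide)]
  have hev₄ : τ₄.rarr aEv = τ₂.rarr aEv := by
    rw [hA₄.rarr _ (by decide), hA₃.rarr _ (by decide)]
  have hP₄ : Prepared N τ₄ := hP₃.of_agree hA₄ (by decide) (by decide)
  refine (run_cmdReport (T := T) (b := b) (q := q) (cnt := σ.nvar vCnt) (lo := N.lo)
    (by rw [hA₄.nvar _ (by decide), hT₃]) (by rw [hA₄.nvar _ (by decide), hB₃])
    (by rw [hA₄.nvar _ (by decide), hA₃.nvar _ (by decide), hq₂]) hcnt₄ hP₄.lo_eq (by omega)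
    (by omega) (by omega) (fun r c1 c2 => by have := (h7 r c1 c2).idx_le; omega)).mono ?_
  rintro τ₅ t₅ - ⟨h8, h9, h10, ht₅⟩
  rw [hev₄] at h10
  rw [hnarr₄ 0 (by norm_num), hnarr₄ 1 (by norm_num), hnarr₄ 2 (by norm_num), hrarr₄] at h9
  refine ⟨⟨fun r hr => ?_, fun T' c1 b' c2 c3 c4 sd c5 e c6 => ?_⟩, by omega, ?_⟩
  · rcases Nat.lt_or_ge r (σ.nvar vCnt) with g | g
    · obtain ⟨g1, g2, g3, g4⟩ := h9 r g
      rw [g1, g2, g3, g4]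
      exact hO.sound r g
    · obtain ⟨i, g1, g2, rfl⟩ : ∃ i, 1 ≤ i ∧ i ≤ q ∧ r = σ.nvar vCnt + i - 1 :=
        ⟨r + 1 - σ.nvar vCnt, by omega, by omega, by omega⟩
      obtain ⟨f1, f2, f3, f4⟩ := h10 i g1 g2
      obtain ⟨sd, d1, e, d2, d3⟩ := hsound i g1 g2
      have hC := h7 i g1 g2
      have hS := hC.isSink hT hb ((hE 0 (by norm_num)).pos i g1 g2).le
      rw [d3] at f4 hS
      rw [f3]
      exact ⟨T, hT, b, hb, sd, d1, e, d2, f1, f2, f4, ⟨hC.idx_ge, hC.idx_le⟩, hS⟩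
  · rcases c4 with c4 | ⟨rfl, rfl⟩
    · obtain ⟨r, g1, g2, g3, g4⟩ := hO.complete T' c1 b' c2 c3 c4 sd c5 e c6
      obtain ⟨f1, f2, f3, f4⟩ := h9 r g1
      exact ⟨r, by omega, by rw [f1, g2], by rw [f2, g3], by rw [f4, g4]⟩
    · obtain ⟨i, g1, g2, g3⟩ := hcomp sd c5 e c6
      obtain ⟨f1, f2, f3, f4⟩ := h10 i g1 g2
      exact ⟨_, by omega, f1, f2, by rw [f4, g3]⟩
  · have e1 : (q + 1) * (Lg + 1) ≤ (n + 1 + m) * (Lg + 1) := Nat.mul_le_mul_right _ (by omega)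
    have e2 : (q + n + 1) * (Lg + 1) ≤ (n + 1 + m) * (Lg + 1) := Nat.mul_le_mul_right _ (by omega)
    have e3 : n + 1 + m ≤ (n + 1 + m) * (Lg + 1) := Nat.le_mul_of_pos_right _ (by omega)
    omega

/-- The number of events of type `T` at the boundary vertex `v_b`. -/
noncomputable def numEv (N : PathNetwork n) (T b : ℕ) : ℕ :=
  (evS N T 0 b).card + (evS N T 1 b).card

theorem sum_numEv_le (N : PathNetwork n) {T : ℕ} (hT : T < 2) :
    ∑ b ∈ Finset.Ico 1 (n + 1), numEv N T b ≤ 2 * (n + 1) ^ 2 := by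
  have hI : Finset.Ico 1 (n + 1) = Finset.Icc 1 n := by
    ext; simp only [Finset.mem_Ico, Finset.mem_Icc]; omega
  simp only [numEv]
  rw [hI, Finset.sum_add_distrib]
  have h0 := sum_card_evS_le N hT (show 0 < 2 by norm_num)
  have h1 := sum_card_evS_le N hT (show 1 < 2 by norm_num)
  omega

/-- The times for the boundary vertices add up because the events do. -/
theorem run_vertices (N : PathNetwork n) {σ : State} {T Lg : ℕ}
    (hP : Prepared N σ) (hT : T < 2) (hvT : σ.nvar vT = T) (hLg : σ.nvar vLg = Lg)
    (hW : 20 * (n + 1) ^ 2 ≤ W) (hcnt : σ.nvar vCnt ≤ T * (2 * (n + 1) ^ 2))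
    (hO : Output N (fun T' _ => T' < T) σ) :
    Run W (.forUp vB (#ₙ 1) (!ₙ vN +ₙ #ₙ 1) cmdVertex) σ fun τ t =>
      Output N (fun T' _ => T' < T + 1) τ ∧ τ.nvar vCnt ≤ (T + 1) * (2 * (n + 1) ^ 2) ∧
      t ≤ 20000 * ((n + 1) ^ 2 * (Lg + 1)) := by
  have hnn : n + 1 ≤ (n + 1) ^ 2 := by nlinarith
  have hsum := sum_numEv_le N hT
  have hsplit : ∀ k, 1 ≤ k → k ≤ n → ∑ b ∈ Finset.Ico 1 (k + 1), numEv N T b ≤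
      2 * (n + 1) ^ 2 := fun k h1 h2 =>
    (Finset.sum_le_sum_of_subset (Finset.Ico_subset_Ico_right (by omega))).trans hsum
  refine Run.forUp 1 (n + 1) (fun k τ =>
      Output N (fun T' b' => T' < T ∨ (T' = T ∧ b' < k)) τ ∧
      τ.nvar vCnt ≤ T * (2 * (n + 1) ^ 2) + ∑ b ∈ Finset.Ico 1 k, numEv N T b)
    (fun k _ => 6020 * ((∑ b ∈ Finset.Ico k (n + 1), (n + 1 + numEv N T b)) * (Lg + 1)))
    (by decide) (by simp) (by omega) (by omega) ?_ ?_ ?_ ?_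
  · refine ⟨hO.of_eq (fun T' _ b' c1 _ c2 => ?_) (by simp) rfl rfl, by simpa using hcnt⟩
    rcases c2 with c2 | c2
    · exact c2
    · omega
  · intro τ hA
    simpa [hP.n_eq] using hA.nvar vN (by decide)
  · rintro k τ hA hk h1 h2 ⟨hI1, hI2⟩
    have hs := hsplit k h1 (by omega)
    rw [Finset.sum_Ico_succ_top h1] at hs
    have hTm : T * (2 * (n + 1) ^ 2) ≤ 1 * (2 * (n + 1) ^ 2) := Nat.mul_le_mul_right _ (by omega)
    have hP' : Prepared N τ := hP.of_agree hA (by decide) (by decide)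
    refine (run_cmdVertex N hP' hT ⟨h1, by omega⟩ (by rw [hA.nvar _ (by decide), hvT]) hk
      (by rw [hA.nvar _ (by decide), hLg]) (m := numEv N T k) rfl (by omega) hW (by omega)
      hI1).mono ?_
    rintro τ' t' - ⟨g1, g2, ht'⟩
    refine ⟨⟨g1.of_eq (fun T' _ b' _ _ c => by omega) (by simp) rfl rfl, ?_⟩, ?_⟩
    · rw [nvar_setN, if_neg (by decide), Finset.sum_Ico_succ_top h1]
      omega
    · rw [Finset.sum_eq_sum_Ico_succ_bot h2, add_mul]
      have : 1 ≤ (n + 1 + numEv N T k) * (Lg + 1) := Nat.one_le_iff_ne_zero.2 (by positivity)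
      simp only [NExp.cost]
      omega
  · rintro τ t hA hk ⟨hI1, hI2⟩ ht
    refine ⟨hI1.of_eq (fun T' _ b' _ _ c => by omega) rfl rfl rfl, ?_, ?_⟩
    · rw [add_mul, one_mul]; omega
    · simp only [NExp.cost] at ht
      have e1 : ∑ b ∈ Finset.Ico 1 (n + 1), (n + 1 + numEv N T b) ≤ 3 * (n + 1) ^ 2 := by
        rw [Finset.sum_add_distrib, Finset.sum_const, Nat.card_Ico, smul_eq_mul, Nat.add_sub_cancel]
        nlinarith
      have e2 := Nat.mul_le_mul_right (Lg + 1) e1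
      have e3 : 1 ≤ (n + 1) ^ 2 * (Lg + 1) := Nat.one_le_iff_ne_zero.2 (by positivity)
      rw [mul_assoc] at e2
      omega

theorem run_cmdPrepare (N : PathNetwork n) (hW : 20 * (n + 1) ^ 2 ≤ W) :
    Run W cmdPrepare N.initState fun τ t => Prepared N τ ∧ τ.nvar vCnt = 0 ∧
      t ≤ 4000 * (n + 1) ^ 2 := by
  have hnn : n + 1 ≤ (n + 1) ^ 2 := by nlinarith
  refine Run.seq (R := fun τ t => Input N τ ∧ τ.nvar vCnt = 0 ∧ τ.rvar rCap = N.cap ∧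
    τ.rvar rTau = N.tau ∧ τ.rarr aLen = N.len ∧ t ≤ 10) ?_ ?_
  · simp [PathNetwork.initState]
    exact ⟨by omega, by constructor <;> simp⟩
  rintro τ₁ t₁ - ⟨h1, h2, h3, h4, h5, ht₁⟩
  refine Run.seq (run_cmdSides N (by omega) h1 h3 h4 h5) ?_
  rintro τ₂ t₂ hA₂ ⟨h6, ht₂⟩
  refine Run.seq (run_cmdLog (n := n) (by omega) h6.n_eq) ?_
  rintro τ₃ t₃ hA₃ ⟨h7, h8, h9, ht₃⟩
  have hS₃ : Sides N τ₃ := h6.of_agree hA₃ (by decide) (by decide) (by decide) (by decide)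
    (by decide)
  have hcnt₃ : τ₃.nvar vCnt = 0 := by rw [hA₃.nvar _ (by decide), hA₂.nvar _ (by decide), h2]
  refine (run_cmdTables N (by omega) hS₃).mono ?_
  rintro τ₄ t₄ hA₄ ⟨h10, ht₄⟩
  have hS₄ : Sides N τ₄ := hS₃.of_agree hA₄ (by decide) (by decide) (by decide) (by decide)
    (by decide)
  have e1 : τ₄.nvar vBig = τ₃.nvar vBig := hA₄.nvar _ (by decide)
  have e2 : τ₄.nvar vLg = τ₃.nvar vLg := hA₄.nvar _ (by decide)
  refine ⟨⟨hS₄, ?_, ?_, ?_, h10⟩, ?_, by omega⟩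
  · rw [e1, e2, h7]
  · rw [e1]; exact h8
  · rw [e1]; exact h9
  · rw [hA₄.nvar _ (by decide), hcnt₃]

theorem run_cmdMain (N : PathNetwork n) (hW : 20 * (n + 1) ^ 2 ≤ W) :
    Run W cmdMain N.initState fun τ t => ∃ Lg, 2 ^ Lg ≤ 4 * (n + 1) ^ 2 ∧
      Output N (fun _ _ => True) τ ∧ τ.nvar vCnt ≤ 4 * (n + 1) ^ 2 ∧
      t ≤ 50000 * ((n + 1) ^ 2 * (Lg + 1)) := by
  have hnn : n + 1 ≤ (n + 1) ^ 2 := by nlinarith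
  refine Run.seq (run_cmdPrepare N hW) ?_
  rintro σ t₀ - ⟨hP, hcnt, ht₀⟩
  have hbg := hP.big_eq
  have hbl := hP.big_le
  obtain ⟨Lg, hLg⟩ : ∃ Lg, σ.nvar vLg = Lg := ⟨_, rfl⟩
  rw [hLg] at hbg
  rw [hbg] at hbl
  obtain ⟨X, hX⟩ : ∃ X, X = (n + 1) ^ 2 * (Lg + 1) := ⟨_, rfl⟩
  have hX' : (n + 1) ^ 2 ≤ X := by rw [hX]; exact Nat.le_mul_of_pos_right _ (by omega)
  refine Run.forUp 0 2 (fun T τ => Output N (fun T' _ => T' < T) τ ∧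
      τ.nvar vCnt ≤ T * (2 * (n + 1) ^ 2)) (fun T _ => 20020 * X * (2 - T))
    (by decide) (by simp) (by omega) (by omega) ?_ (fun τ _ => by simp) ?_ ?_
  · refine ⟨⟨fun r hr => ?_, fun T _ b _ _ h => by omega⟩, by simp [hcnt]⟩
    rw [nvar_setN, if_neg (by decide), hcnt] at hr
    omega
  · rintro T τ hA hk - hT ⟨hI1, hI2⟩
    have hP' : Prepared N τ := hP.of_agree hA (by decide) (by decide)
    refine (run_vertices N hP' hT hk (by rw [hA.nvar _ (by decide), hLg]) hW hI2 hI1).mono ?_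
    rintro τ' t' - ⟨g1, g2, ht'⟩
    rw [← hX] at ht'
    refine ⟨⟨g1.of_eq (fun _ _ _ _ _ h => h) (by simp) rfl rfl, ?_⟩, ?_⟩
    · rw [nvar_setN, if_neg (by decide)]; exact g2
    · obtain ⟨d, hd⟩ : ∃ d, 2 - T = d + 1 := ⟨2 - T - 1, by omega⟩
      have hd' : 2 - (T + 1) = d := by omega
      simp only [NExp.cost]
      rw [hd, hd', Nat.mul_succ]
      omega
  · rintro τ t hA hk ⟨hI1, hI2⟩ ht
    refine ⟨Lg, hbl, hI1.of_eq (fun T hT _ _ _ _ => hT) rfl rfl rfl, by omega, ?_⟩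
    simp only [NExp.cost] at ht
    rw [← hX]
    omega

theorem mem_Sstar_iff (N : PathNetwork n) (s : ℕ → ℝ) :
    s ∈ N.Sstar ↔ ∃ T < 2, ∃ b, (1 ≤ b ∧ b ≤ n) ∧ ∃ sd < 2, ∃ e ∈ evS N T sd b,
      s = scen N T b (N.lo b + evVal N T sd b e) := by
  have key : ∀ T < 2, (∃ b w, 1 ≤ b ∧ b ≤ n ∧ N.IsCritical (scen N T b) b w ∧ s = scen N T b w) ↔
      ∃ b, (1 ≤ b ∧ b ≤ n) ∧ ∃ sd < 2, ∃ e ∈ evS N T sd b,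
        s = scen N T b (N.lo b + evVal N T sd b e) := by
    intro T hT
    constructor
    · rintro ⟨b, w, h1, h2, h3, rfl⟩
      obtain ⟨sd, h4, e, h5, rfl⟩ := (isCritical_iff N hT ⟨h1, h2⟩ w).1 h3
      exact ⟨b, ⟨h1, h2⟩, sd, h4, e, h5, rfl⟩
    · rintro ⟨b, hb, sd, h4, e, h5, rfl⟩
      exact ⟨b, _, hb.1, hb.2, (isCritical_iff N hT hb _).2 ⟨sd, h4, e, h5, rfl⟩, rfl⟩
  constructor
  · rintro (h | h)
    · exact ⟨0, by norm_num, (key 0 (by norm_num)).1 h⟩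
    · exact ⟨1, by norm_num, (key 1 (by norm_num)).1 h⟩
  · rintro ⟨T, hT, h⟩
    have := (key T hT).2 h
    interval_cases T
    · exact Or.inl this
    · exact Or.inr this

theorem Output.isSinkTable {N : PathNetwork n} {σ : State} (h : Output N (fun _ _ => True) σ) :
    N.IsSinkTable σ := by
  refine ⟨fun r hr => ?_, fun s hs => ?_⟩
  · obtain ⟨T, hT, b, hb, sd, hsd, e, he, h1, h2, h3, h4, h5⟩ := h.sound r hr
    have hout : N.outScenario σ r = scen N T b (N.lo b + evVal N T sd b e) := by
      rw [← h1, ← h2] at *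
      rw [← h3]; rfl
    rw [hout, h2]
    exact ⟨hb, (mem_Sstar_iff N _).2 ⟨T, hT, b, hb, sd, hsd, e, he, rfl⟩, h4, h5⟩
  · obtain ⟨T, hT, b, hb, sd, hsd, e, he, rfl⟩ := (mem_Sstar_iff N s).1 hs
    obtain ⟨r, h1, h2, h3, h4⟩ := h.complete T hT b hb.1 hb.2 trivial sd hsd e he
    refine ⟨r, h1, ?_⟩
    rw [← h4, ← h3, ← h2]; rfl

end Evac

theorem mainTheorem4 :
    ∃ (P : RealRAM.Cmd) (K : ℕ) (C : ℝ),
      ∀ (n : ℕ), 2 ≤ n → ∀ N : PathNetwork n,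
        (N.Sstar.Finite ∧ (N.Sstar.ncard : ℝ) ≤ C * (n : ℝ) ^ 2) ∧
        ∃ (σ : RealRAM.State) (t : ℕ),
          RealRAM.Exec (n ^ K) P N.initState σ t ∧
          (t : ℝ) ≤ C * ((n : ℝ) ^ 2 * Real.log n) ∧
          N.IsSinkTable σ := by
  -- all natural numbers stored are at most `20 * (n + 1) ^ 2`, which is at most `n ^ 8` for `n ≥ 2`
  refine ⟨Evac.cmdMain, 8, 2000000, fun n hn N => ?_⟩
  have hsq : 4 * (n + 1) ^ 2 ≤ 9 * n ^ 2 := by nlinarith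
  have hW : 20 * (n + 1) ^ 2 ≤ n ^ 8 := by
    have : 2 ^ 6 ≤ n ^ 6 := Nat.pow_le_pow_left hn 6
    have e : n ^ 8 = n ^ 6 * n ^ 2 := by ring
    rw [e]
    nlinarith [Nat.mul_le_mul_right (n ^ 2) this]
  obtain ⟨σ, t, hex, Lg, hLg, hO, hcnt, ht⟩ := Evac.run_cmdMain N hW
  have htab := hO.isSinkTable
  have hn' : (2 : ℝ) ≤ n := by exact_mod_cast hn
  have hsub : N.Sstar ⊆ (N.outScenario σ) '' (Finset.range (σ.nvar 0) : Set ℕ) := by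
    intro s hs
    obtain ⟨r, h1, h2⟩ := htab.2 s hs
    exact ⟨r, by simpa using h1, h2⟩
  have hfin : ((N.outScenario σ) '' (Finset.range (σ.nvar 0) : Set ℕ)).Finite :=
    (Finset.finite_toSet _).image _
  refine ⟨⟨hfin.subset hsub, ?_⟩, σ, t, hex, ?_, htab⟩
  · have h1 : N.Sstar.ncard ≤ σ.nvar 0 := by
      refine (Set.ncard_le_ncard hsub hfin).trans
        ((Set.ncard_image_le (Finset.finite_toSet _)).trans ?_)
      rw [Set.ncard_coe_finset, Finset.card_range]
    have h2 : (N.Sstar.ncard : ℝ) ≤ 9 * (n : ℝ) ^ 2 := by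
      exact_mod_cast h1.trans (hcnt.trans hsq)
    nlinarith [sq_nonneg (n : ℝ)]
  · have h1 : (t : ℝ) ≤ 50000 * (((n : ℝ) + 1) ^ 2 * (Lg + 1)) := by exact_mod_cast ht
    have h2 : 4 * ((n : ℝ) + 1) ^ 2 ≤ 9 * (n : ℝ) ^ 2 := by exact_mod_cast hsq
    -- the number of rounds is at most the logarithm of `4 * (n + 1) ^ 2`, hence `O(log n)`
    have h3 : (2 : ℝ) ^ Lg ≤ (n : ℝ) ^ 6 := by
      have : 2 ^ Lg ≤ n ^ 6 := by
        have h4 : 2 ^ 4 ≤ n ^ 4 := Nat.pow_le_pow_left hn 4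
        have e : n ^ 6 = n ^ 4 * n ^ 2 := by ring
        rw [e]
        nlinarith [Nat.mul_le_mul_right (n ^ 2) h4]
      exact_mod_cast this
    have h4 : (Lg : ℝ) * Real.log 2 ≤ 6 * Real.log n := by
      have := Real.log_le_log (by positivity) h3
      rwa [Real.log_pow, Real.log_pow] at this
    have h5 : Real.log 2 ≤ Real.log n := Real.log_le_log (by norm_num) hn'
    have h6 := Real.log_two_gt_d9
    have hlog : (Lg : ℝ) + 1 ≤ 11 * Real.log n := by nlinarith
    have hpos : (0 : ℝ) ≤ Lg + 1 := by positivity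
    calc (t : ℝ) ≤ 50000 * (((n : ℝ) + 1) ^ 2 * (Lg + 1)) := h1
      _ ≤ 50000 * ((9 / 4 * (n : ℝ) ^ 2) * (11 * Real.log n)) := by
        gcongr
        linarith
      _ ≤ 2000000 * ((n : ℝ) ^ 2 * Real.log n) := by
        have : 0 ≤ (n : ℝ) ^ 2 * Real.log n := by
          have : 0 ≤ Real.log n := by linarith
          positivity
        nlinarith
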